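/- Let $H$ be a Hopf algebra over a field $k$ with bijective antipode, comultiplication $\Delta$ and counit $\varepsilon$. A right coideal subalgebra of $H$ is a subalgebra $A\subseteq H$ with $\Delta(A)\subseteq A\otimes H$; put $A^+=A\cap\ker\varepsilon$. A left $H$-module factor coalgebra of $H$ is a quotient $C=H/I$ where $I$ is both a left ideal and a coideal of $H$; let $\pi:H\to C$ be the canonical surjection and put ${}^{\mathrm{co}\,C}H=\{h\in H\mid(\pi\otimes\mathrm{id})\Delta(h)=\pi(1)\otimes h\}$. Takeuchi's correspondence consists of the assignments $A\mapsto H/HA^+$, from right coideal subalgebras to left $H$-module factor coalgebras, and $C\mapsto{}^{\mathrm{co}\,C}H$, in the opposite direction. Let $\mathcal M_A^H$ (respectively ${}_A\mathcal M^H$) be the category of right (respectively left) $A$-modules with a right $H$-comodule structure for which the action map $M\otimes A\to M$ (respectively $A\otimes M\to M$) is $H$-colinear, and let ${}_H^{\,C}\mathcal M$ (respectively ${}_H\mathcal M^C$) be the category of left $H$-modules with a left (respectively right) $C$-comodule structure for which the action map $H\otimes M\to M$ is $C$-colinear; tensor products carry the tensor product comodule structures. Consider the conditions: (0.1) all objects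 of $\mathcal M_A^H$ are projective as right $A$-modules; (0.2) all objects of ${}_H^{\,C}\mathcal M$ are injective as left $C$-comodules; (0.3) all objects of ${}_A\mathcal M^H$ are projective as left $A$-modules; (0.4) all objects of ${}_H\mathcal M^C$ are injective as right $C$-comodules. **Theorem 8.4.** The assignments $A\mapsto H/HA^+$ and $C\mapsto{}^{\mathrm{co}\,C}H$ restrict to mutually inverse bijections between the set of right coideal subalgebras $A$ of $H$ satisfying (0.1) and the set of left $H$-module factor coalgebras $C$ of $H$ satisfying (0.2). The same two assignments also restrict to mutually inverse bijections between the set of right coideal subalgebras of $H$ satisfying (0.3) and the set of left $H$-module factor coalgebras of $H$ satisfying (0.4). -/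

import Mathlib

open scoped TensorProduct

universe v u

/-! ### Comodules over a coalgebra -/

/-- A structure of right `C`-comodule on the `k`-module `M`. -/
structure RightCoaction (k : Type*) (C : Type*) (M : Type*) [CommRing k]
    [AddCommGroup C] [Module k C] [Coalgebra k C] [AddCommGroup M] [Module k M] where
  /-- The structure map `M → M ⊗ C`. -/
  coact : M →ₗ[k] M ⊗[k] C
  coassoc : (TensorProduct.assoc k M C C).toLinearMap ∘ₗ coact.rTensor C ∘ₗ coact =
    (Coalgebra.comul (R := k) (A := C)).lTensor M ∘ₗ coact
  counit : (TensorProduct.rid k M).toLinearMap ∘ₗ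
    (Coalgebra.counit (R := k) (A := C)).lTensor M ∘ₗ coact = LinearMap.id

/-- A structure of left `C`-comodule on the `k`-module `M`. -/
structure LeftCoaction (k : Type*) (C : Type*) (M : Type*) [CommRing k]
    [AddCommGroup C] [Module k C] [Coalgebra k C] [AddCommGroup M] [Module k M] where
  /-- The structure map `M → C ⊗ M`. -/
  coact : M →ₗ[k] C ⊗[k] M
  coassoc : (TensorProduct.assoc k C C M).toLinearMap ∘ₗ
      (Coalgebra.comul (R := k) (A := C)).rTensor M ∘ₗ coact = coact.lTensor C ∘ₗ coact
  counit : (TensorProduct.lid k M).toLinearMap ∘ₗ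
    (Coalgebra.counit (R := k) (A := C)).rTensor M ∘ₗ coact = LinearMap.id

/-- Morphisms of right `C`-comodules. -/
def RightCoaction.Colinear {k C M N : Type*} [CommRing k]
    [AddCommGroup C] [Module k C] [Coalgebra k C] [AddCommGroup M] [Module k M]
    [AddCommGroup N] [Module k N] (ρM : RightCoaction k C M) (ρN : RightCoaction k C N)
    (f : M →ₗ[k] N) : Prop :=
  ρN.coact ∘ₗ f = f.rTensor C ∘ₗ ρM.coact

/-- Morphisms of left `C`-comodules. -/
def LeftCoaction.Colinear {k C M N : Type*} [CommRing k]
    [AddCommGroup C] [Module k C] [Coalgebra k C] [AddCommGroup M] [Module k M]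
    [AddCommGroup N] [Module k N] (lM : LeftCoaction k C M) (lN : LeftCoaction k C N)
    (f : M →ₗ[k] N) : Prop :=
  lN.coact ∘ₗ f = f.lTensor C ∘ₗ lM.coact

/-- `M` is an injective object of the category of right comodules over the coalgebra `C` over a
field. (Over a field the monomorphisms of comodules are the injective colinear maps.) -/
def RightCoaction.IsInjective {k : Type v} {C M : Type u} [Field k]
    [AddCommGroup C] [Module k C] [Coalgebra k C] [AddCommGroup M] [Module k M]
    (ρM : RightCoaction k C M) : Prop :=
  ∀ (X Y : Type u) [AddCommGroup X] [Module k X] [AddCommGroup Y] [Module k Y]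
    (ρX : RightCoaction k C X) (ρY : RightCoaction k C Y) (i : X →ₗ[k] Y) (f : X →ₗ[k] M),
    ρX.Colinear ρY i → Function.Injective i → ρX.Colinear ρM f →
      ∃ g : Y →ₗ[k] M, ρY.Colinear ρM g ∧ g ∘ₗ i = f

/-- `M` is an injective object of the category of left comodules over the coalgebra `C` over a
field. (Over a field the monomorphisms of comodules are the injective colinear maps.) -/
def LeftCoaction.IsInjective {k : Type v} {C M : Type u} [Field k]
    [AddCommGroup C] [Module k C] [Coalgebra k C] [AddCommGroup M] [Module k M]
    (lM : LeftCoaction k C M) : Prop :=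
  ∀ (X Y : Type u) [AddCommGroup X] [Module k X] [AddCommGroup Y] [Module k Y]
    (lX : LeftCoaction k C X) (lY : LeftCoaction k C Y) (i : X →ₗ[k] Y) (f : X →ₗ[k] M),
    lX.Colinear lY i → Function.Injective i → lX.Colinear lM f →
      ∃ g : Y →ₗ[k] M, lY.Colinear lM g ∧ g ∘ₗ i = f

/-! ### Actions as linear maps on tensor products -/

/-- The map `R ⊗ M → M`, `r ⊗ m ↦ r m`, of a left `R`-module `M`. -/
noncomputable def leftAct (k R M : Type*) [CommRing k] [Ring R] [Algebra k R]
    [AddCommGroup M] [Module k M] [Module R M] [IsScalarTower k R M] :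
    R ⊗[k] M →ₗ[k] M :=
  TensorProduct.lift (Algebra.lsmul k k M (A := R)).toLinearMap

/-- The map `M ⊗ R → M`, `m ⊗ r ↦ m r`, of a right `R`-module `M`, that is, of a left module over
the opposite ring. -/
noncomputable def rightAct (k R M : Type*) [CommRing k] [Ring R] [Algebra k R]
    [AddCommGroup M] [Module k M] [Module Rᵐᵒᵖ M] [IsScalarTower k Rᵐᵒᵖ M] :
    M ⊗[k] R →ₗ[k] M :=
  TensorProduct.lift ((Algebra.lsmul k k M (A := Rᵐᵒᵖ)).toLinearMap ∘ₗ
    (MulOpposite.opLinearEquiv k (M := R)).toLinearMap).flip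

theorem leftAct_tmul (k : Type*) {R M : Type*} [CommRing k] [Ring R] [Algebra k R]
    [AddCommGroup M] [Module k M] [Module R M] [IsScalarTower k R M] (r : R) (m : M) :
    leftAct k R M (r ⊗ₜ m) = r • m := rfl

theorem rightAct_tmul (k : Type*) {R M : Type*} [CommRing k] [Ring R] [Algebra k R]
    [AddCommGroup M] [Module k M] [Module Rᵐᵒᵖ M] [IsScalarTower k Rᵐᵒᵖ M] (r : R) (m : M) :
    rightAct k R M (m ⊗ₜ r) = MulOpposite.op r • m := rfl

/-! ### Right coideal subalgebras -/

/-- A right coideal subalgebra of `H`: a subalgebra `A` with `Δ(A) ⊆ A ⊗ H`. -/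
@[ext]
structure RightCoidealSubalgebra (k : Type v) (H : Type u) [Field k] [Ring H] [HopfAlgebra k H] where
  /-- The underlying subalgebra. -/
  alg : Subalgebra k H
  comul_mem : ∀ a ∈ alg, Coalgebra.comul (R := k) a ∈
    LinearMap.range ((Subalgebra.toSubmodule alg).subtype.rTensor H)

namespace RightCoidealSubalgebra

variable {k : Type v} {H : Type u} [Field k] [Ring H] [HopfAlgebra k H]
  (A : RightCoidealSubalgebra k H)

/-- The inclusion `A ⊗ H → H ⊗ H`. -/
noncomputable def incl : A.alg ⊗[k] H →ₗ[k] H ⊗[k] H :=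
  A.alg.val.toLinearMap.rTensor H

theorem incl_injective : Function.Injective A.incl :=
  Module.Flat.rTensor_preserves_injective_linearMap _ Subtype.val_injective

/-- The restriction `Δ : A → A ⊗ H` of the comultiplication of `H`; it makes `A` a right
`H`-comodule. -/
noncomputable def coaction : A.alg →ₗ[k] A.alg ⊗[k] H :=
  (LinearEquiv.ofInjective A.incl A.incl_injective).symm.toLinearMap ∘ₗ
    (Coalgebra.comul (R := k) (A := H) ∘ₗ A.alg.val.toLinearMap).codRestrict
      (LinearMap.range A.incl) (fun a => A.comul_mem a a.2)

/-- `A.coaction` is characterized by being the restriction of the comultiplication. -/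
theorem incl_coaction (a : A.alg) : A.incl (A.coaction a) = Coalgebra.comul (R := k) (a : H) := by
  have h := LinearEquiv.apply_symm_apply (LinearEquiv.ofInjective A.incl A.incl_injective)
    ((Coalgebra.comul (R := k) (A := H) ∘ₗ A.alg.val.toLinearMap).codRestrict
      (LinearMap.range A.incl) (fun a => A.comul_mem a a.2) a)
  exact congrArg Subtype.val h

/-- The compatibility of the action and the coaction in an object `M` of the category of
right-right `(H, A)`-Hopf modules: the action `M ⊗ A → M` is `H`-colinear, i.e.
`ρ(m a) = ∑ m₍₀₎ a₍₁₎ ⊗ m₍₁₎ a₍₂₎`. -/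
def IsRightHopfModule {M : Type*} [AddCommGroup M] [Module k M] [Module A.algᵐᵒᵖ M]
    [IsScalarTower k A.algᵐᵒᵖ M] (ρ : RightCoaction k H M) : Prop :=
  ρ.coact ∘ₗ rightAct k A.alg M =
    TensorProduct.map (rightAct k A.alg M) (LinearMap.mul' k H) ∘ₗ
      (TensorProduct.tensorTensorTensorComm k M H A.alg H).toLinearMap ∘ₗ
        TensorProduct.map ρ.coact A.coaction

/-- The compatibility of the action and the coaction in an object `M` of the category of
left-right `(A, H)`-Hopf modules: the action `A ⊗ M → M` is `H`-colinear, i.e.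
`ρ(a m) = ∑ a₍₁₎ m₍₀₎ ⊗ a₍₂₎ m₍₁₎`. -/
def IsLeftHopfModule {M : Type*} [AddCommGroup M] [Module k M] [Module A.alg M]
    [IsScalarTower k A.alg M] (ρ : RightCoaction k H M) : Prop :=
  ρ.coact ∘ₗ leftAct k A.alg M =
    TensorProduct.map (leftAct k A.alg M) (LinearMap.mul' k H) ∘ₗ
      (TensorProduct.tensorTensorTensorComm k A.alg H M H).toLinearMap ∘ₗ
        TensorProduct.map A.coaction ρ.coact

/-- All objects of `M_A^H` are projective as right `A`-modules. -/
def RightHopfModulesProjective : Prop :=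
  ∀ (M : Type u) [AddCommGroup M] [Module k M] [Module A.algᵐᵒᵖ M] [IsScalarTower k A.algᵐᵒᵖ M]
    (ρ : RightCoaction k H M), A.IsRightHopfModule ρ → Module.Projective A.algᵐᵒᵖ M

/-- All objects of `_A M^H` are projective as left `A`-modules. -/
def LeftHopfModulesProjective : Prop :=
  ∀ (M : Type u) [AddCommGroup M] [Module k M] [Module A.alg M] [IsScalarTower k A.alg M]
    (ρ : RightCoaction k H M), A.IsLeftHopfModule ρ → Module.Projective A.alg M

end RightCoidealSubalgebra

/-! ### Left module factor coalgebras -/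

/-- A left `H`-module factor coalgebra `C = H / I` of `H`, given by the kernel `I` of the canonical
surjection `H → C`, which is a left ideal and a coideal of `H`. -/
@[ext]
structure ModuleFactorCoalgebra (k : Type v) (H : Type u) [Field k] [Ring H] [HopfAlgebra k H] where
  /-- The left ideal `I` (Mathlib's `Ideal`s are left ideals). -/
  ideal : Ideal H
  isCoideal : (ideal.restrictScalars k).IsCoideal

namespace ModuleFactorCoalgebra

variable {k : Type v} {H : Type u} [Field k] [Ring H] [HopfAlgebra k H]
  (C : ModuleFactorCoalgebra k H)

/-- The quotient `C = H / I`. -/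
def Quot : Type u := H ⧸ C.ideal

noncomputable instance : AddCommGroup C.Quot := inferInstanceAs (AddCommGroup (H ⧸ C.ideal))

noncomputable instance : Module H C.Quot := inferInstanceAs (Module H (H ⧸ C.ideal))

noncomputable instance : Module k C.Quot := inferInstanceAs (Module k (H ⧸ C.ideal))

instance : IsScalarTower k H C.Quot := inferInstanceAs (IsScalarTower k H (H ⧸ C.ideal))

/-- The coalgebra structure of `C = H / I` induced from `H`. -/
noncomputable instance : Coalgebra k C.Quot :=
  haveI := C.isCoideal
  inferInstanceAs (Coalgebra k (H ⧸ C.ideal.restrictScalars k))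

/-- The canonical surjection `π : H → C`. -/
def proj : H →ₗ[k] C.Quot := C.ideal.mkQ.restrictScalars k

theorem proj_surjective : Function.Surjective C.proj := C.ideal.mkQ_surjective

theorem proj_mul (a b : H) : C.proj (a * b) = a • C.proj b := rfl

theorem proj_eq_zero_iff (a : H) : C.proj a = 0 ↔ a ∈ C.ideal :=
  Submodule.Quotient.mk_eq_zero C.ideal

theorem comul_proj (a : H) : Coalgebra.comul (R := k) (C.proj a) =
    TensorProduct.map C.proj C.proj (Coalgebra.comul (R := k) a) := rfl

theorem counit_proj (a : H) :
    Coalgebra.counit (R := k) (C.proj a) = Coalgebra.counit (R := k) a := rfl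

/-- The left coaction `(π ⊗ id) Δ : H → C ⊗ H` of `C` on `H`. -/
noncomputable def leftCoactH : H →ₗ[k] C.Quot ⊗[k] H :=
  C.proj.rTensor H ∘ₗ Coalgebra.comul

/-- The compatibility of the action and the coaction in an object `M` of the category `_H^C M`:
the action `H ⊗ M → M` is left `C`-colinear, i.e. `λ(h m) = ∑ h₍₁₎ m₍₋₁₎ ⊗ h₍₂₎ m₍₀₎`. -/
def IsLeftHopfModule {M : Type*} [AddCommGroup M] [Module k M] [Module H M] [IsScalarTower k H M]
    (l : LeftCoaction k C.Quot M) : Prop :=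
  l.coact ∘ₗ leftAct k H M =
    TensorProduct.map (leftAct k H C.Quot) (leftAct k H M) ∘ₗ
      (TensorProduct.tensorTensorTensorComm k H H C.Quot M).toLinearMap ∘ₗ
        TensorProduct.map Coalgebra.comul l.coact

/-- The compatibility of the action and the coaction in an object `M` of the category `_H M^C`:
the action `H ⊗ M → M` is right `C`-colinear, i.e. `ρ(h m) = ∑ h₍₁₎ m₍₀₎ ⊗ h₍₂₎ m₍₁₎`. -/
def IsRightHopfModule {M : Type*} [AddCommGroup M] [Module k M] [Module H M] [IsScalarTower k H M]
    (ρ : RightCoaction k C.Quot M) : Prop :=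
  ρ.coact ∘ₗ leftAct k H M =
    TensorProduct.map (leftAct k H M) (leftAct k H C.Quot) ∘ₗ
      (TensorProduct.tensorTensorTensorComm k H H M C.Quot).toLinearMap ∘ₗ
        TensorProduct.map Coalgebra.comul ρ.coact

/-- All objects of `_H^C M` are injective as left `C`-comodules. -/
def LeftHopfModulesInjective : Prop :=
  ∀ (M : Type u) [AddCommGroup M] [Module k M] [Module H M] [IsScalarTower k H M]
    (l : LeftCoaction k C.Quot M), C.IsLeftHopfModule l → l.IsInjective

/-- All objects of `_H M^C` are injective as right `C`-comodules. -/
def RightHopfModulesInjective : Prop :=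
  ∀ (M : Type u) [AddCommGroup M] [Module k M] [Module H M] [IsScalarTower k H M]
    (ρ : RightCoaction k C.Quot M), C.IsRightHopfModule ρ → ρ.IsInjective

theorem leftCoactH_mul (g h : H) :
    C.leftCoactH (g * h) =
      TensorProduct.map (leftAct k H C.Quot) (leftAct k H H)
        (TensorProduct.tensorTensorTensorComm k H H C.Quot H
          (Coalgebra.comul (R := k) g ⊗ₜ C.leftCoactH h)) := by
  simp only [leftCoactH, LinearMap.comp_apply, Bialgebra.comul_mul]
  generalize Coalgebra.comul (R := k) g = s
  generalize Coalgebra.comul (R := k) h = t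
  induction s with
  | zero => simp
  | add x y hx hy => simp only [add_mul, map_add, TensorProduct.add_tmul, hx, hy]
  | tmul a b =>
    induction t with
    | zero => simp
    | add x y hx hy => simp only [mul_add, map_add, TensorProduct.tmul_add, hx, hy]
    | tmul c d =>
      rw [Algebra.TensorProduct.tmul_mul_tmul]
      rfl

theorem leftCoactH_mul_of_mem {g h : H} (hg : C.leftCoactH g = C.proj 1 ⊗ₜ[k] g)
    (hh : C.leftCoactH h = C.proj 1 ⊗ₜ[k] h) :
    C.leftCoactH (g * h) = C.proj 1 ⊗ₜ[k] (g * h) := by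
  have key : ∀ s : H ⊗[k] H,
      TensorProduct.map (leftAct k H C.Quot) (leftAct k H H)
        (TensorProduct.tensorTensorTensorComm k H H C.Quot H (s ⊗ₜ (C.proj 1 ⊗ₜ[k] h))) =
      (LinearMap.mulRight k h).lTensor C.Quot (C.proj.rTensor H s) := by
    intro s
    induction s with
    | zero => simp
    | add x y hx hy => simp only [map_add, TensorProduct.add_tmul, hx, hy]
    | tmul a b =>
      have : a • C.proj (1 : H) = C.proj a := by rw [← proj_mul, mul_one]
      simp [leftAct_tmul, this]
  rw [leftCoactH_mul, hh, key]
  change (LinearMap.mulRight k h).lTensor C.Quot (C.leftCoactH g) = _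
  rw [hg]
  simp

/-- The elements of `H` that are invariant under the left coaction of `C`:
all `h` with `(π ⊗ id) Δ(h) = π(1) ⊗ h`. They form a subalgebra. -/
noncomputable def coinvariantSubalgebra : Subalgebra k H where
  carrier := {h | C.leftCoactH h = C.proj 1 ⊗ₜ[k] h}
  mul_mem' hg hh := C.leftCoactH_mul_of_mem hg hh
  add_mem' {g h} hg hh := by
    simp only [Set.mem_ofPred_eq] at *
    rw [map_add, hg, hh, TensorProduct.tmul_add]
  algebraMap_mem' r := by
    simp only [Set.mem_ofPred_eq, Algebra.algebraMap_eq_smul_one, map_smul,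
      TensorProduct.tmul_smul]
    simp [leftCoactH, Algebra.TensorProduct.one_def]

theorem comul_mem_coinvariants (a : H) (ha : a ∈ C.coinvariantSubalgebra) :
    Coalgebra.comul (R := k) a ∈
      LinearMap.range ((Subalgebra.toSubmodule C.coinvariantSubalgebra).subtype.rTensor H) := by
  let T : H →ₗ[k] C.Quot ⊗[k] H := C.leftCoactH - TensorProduct.mk k C.Quot H (C.proj 1)
  have hex : Function.Exact (Subalgebra.toSubmodule C.coinvariantSubalgebra).subtype T := by
    intro x
    simp only [T, LinearMap.sub_apply, sub_eq_zero, TensorProduct.mk_apply]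
    constructor
    · intro h
      exact ⟨⟨x, h⟩, rfl⟩
    · rintro ⟨y, rfl⟩
      exact y.2
  have hT := Module.Flat.rTensor_exact H hex
  refine (hT _).1 ?_
  apply (TensorProduct.assoc k C.Quot H H).injective
  rw [map_zero]
  have key : (TensorProduct.assoc k C.Quot H H).toLinearMap ∘ₗ T.rTensor H ∘ₗ
      Coalgebra.comul (R := k) = (Coalgebra.comul (R := k)).lTensor C.Quot ∘ₗ T := by
    have h1 : ∀ s : H ⊗[k] H, TensorProduct.assoc k C.Quot H H
        ((C.proj.rTensor H).rTensor H ((Coalgebra.comul (R := k)).rTensor H s)) =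
        C.proj.rTensor (H ⊗[k] H)
          (TensorProduct.assoc k H H H ((Coalgebra.comul (R := k)).rTensor H s)) := by
      intro s
      generalize (Coalgebra.comul (R := k)).rTensor H s = t
      induction t with
      | zero => simp
      | add x y hx hy => simp only [map_add, hx, hy]
      | tmul x c =>
        induction x with
        | zero => simp
        | add x y hx hy => simp only [map_add, TensorProduct.add_tmul, hx, hy]
        | tmul a b => simp
    have h2 : ∀ s : H ⊗[k] H, TensorProduct.assoc k C.Quot H H
        ((TensorProduct.mk k C.Quot H (C.proj 1)).rTensor H s) = C.proj 1 ⊗ₜ[k] s := by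
      intro s
      induction s with
      | zero => simp
      | add x y hx hy => simp only [map_add, TensorProduct.tmul_add, hx, hy]
      | tmul a b => simp
    have h3 : ∀ s : H ⊗[k] H, T.rTensor H s = C.leftCoactH.rTensor H s -
        (TensorProduct.mk k C.Quot H (C.proj 1)).rTensor H s := fun s =>
      LinearMap.congr_fun (LinearMap.rTensor_sub C.leftCoactH _) s
    have h4 : ∀ s : H ⊗[k] H, C.leftCoactH.rTensor H s =
        (C.proj.rTensor H).rTensor H ((Coalgebra.comul (R := k)).rTensor H s) := fun s =>
      LinearMap.rTensor_comp_apply H _ _ s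
    have h5 : ∀ s : H ⊗[k] H, C.proj.rTensor (H ⊗[k] H) ((Coalgebra.comul (R := k)).lTensor H s) =
        (Coalgebra.comul (R := k)).lTensor C.Quot (C.proj.rTensor H s) := by
      intro s
      induction s with
      | zero => simp
      | add x y hx hy => simp only [map_add, hx, hy]
      | tmul a b => simp
    ext x
    simp only [LinearMap.comp_apply, LinearEquiv.coe_coe]
    rw [h3, map_sub, h4, h1, h2, Coalgebra.coassoc_apply, h5]
    simp only [T, LinearMap.sub_apply, map_sub, TensorProduct.mk_apply, LinearMap.lTensor_tmul]
    rfl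
  have h0 : T a = 0 := by
    simp only [T, LinearMap.sub_apply, sub_eq_zero, TensorProduct.mk_apply]
    exact ha
  have := LinearMap.congr_fun key a
  simpa [h0] using this

/-- Takeuchi's correspondence, from factor coalgebras to coideal subalgebras: `C ↦ ^{co C}H`. -/
noncomputable def toCoidealSubalgebra : RightCoidealSubalgebra k H where
  alg := C.coinvariantSubalgebra
  comul_mem := C.comul_mem_coinvariants

end ModuleFactorCoalgebra

namespace RightCoidealSubalgebra

variable {k : Type v} {H : Type u} [Field k] [Ring H] [HopfAlgebra k H]
  (A : RightCoidealSubalgebra k H)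

/-- The left ideal `H A⁺` of `H` generated by the augmentation ideal `A⁺ = A ∩ ker ε` of `A`. -/
def augIdeal : Ideal H :=
  Ideal.span {a | a ∈ A.alg ∧ Coalgebra.counit (R := k) a = 0}

theorem augIdeal_isCoideal : (A.augIdeal.restrictScalars k).IsCoideal := by
  let I := A.augIdeal
  let p : H →ₗ[k] H ⧸ I := I.mkQ.restrictScalars k
  have hp : ∀ a ∈ A.alg, p a = Coalgebra.counit (R := k) a • p 1 := by
    intro a ha
    rw [← map_smul, ← sub_eq_zero, ← map_sub]
    refine (Submodule.Quotient.mk_eq_zero I).2 (Ideal.subset_span ⟨?_, ?_⟩)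
    · exact A.alg.sub_mem ha (A.alg.smul_mem A.alg.one_mem _)
    · simp
  constructor
  · intro x hx
    refine Submodule.span_induction (p := fun x _ => Coalgebra.counit (R := k) x = 0)
      (fun x hx => hx.2) (by simp) (fun x y _ _ hx hy => by simp [hx, hy])
      (fun a x _ hx => by simp [hx]) hx
  · intro x hx
    change TensorProduct.map p p (Coalgebra.comul (R := k) x) = 0
    refine Submodule.span_induction
      (p := fun x _ => TensorProduct.map p p (Coalgebra.comul (R := k) x) = 0)
      ?_ (by simp) (fun x y _ _ hx hy => by simp [hx, hy]) ?_ hx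
    · rintro x ⟨hxA, hx0⟩
      obtain ⟨t, ht⟩ := A.comul_mem x hxA
      have h1 : ∀ t : Subalgebra.toSubmodule A.alg ⊗[k] H,
          TensorProduct.map p p ((Subalgebra.toSubmodule A.alg).subtype.rTensor H t) =
          p 1 ⊗ₜ[k] p (TensorProduct.lid k H ((Coalgebra.counit (R := k)).rTensor H
            ((Subalgebra.toSubmodule A.alg).subtype.rTensor H t))) := by
        intro t
        induction t with
        | zero => simp
        | add x y hx hy => simp only [map_add, TensorProduct.tmul_add, hx, hy]
        | tmul a b =>
          simp only [LinearMap.rTensor_tmul, TensorProduct.map_tmul, Submodule.subtype_apply,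
            hp a a.2, TensorProduct.lid_tmul, map_smul, TensorProduct.tmul_smul,
            TensorProduct.smul_tmul']
      have hx : p x = 0 := by rw [hp x hxA, hx0, zero_smul]
      rw [← ht, h1, ht, Coalgebra.rTensor_counit_comul, TensorProduct.lid_tmul, one_smul, hx,
        TensorProduct.tmul_zero]
    · intro h x _ hx
      have h2 : ∀ s t : H ⊗[k] H, TensorProduct.map p p t = 0 →
          TensorProduct.map p p (s * t) = 0 := by
        intro s t ht
        induction s with
        | zero => simp
        | add x y hx hy => simp only [add_mul, map_add, hx, hy, add_zero]
        | tmul a b =>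
          have h3 : ∀ t : H ⊗[k] H, TensorProduct.map p p (a ⊗ₜ[k] b * t) =
              TensorProduct.map (Algebra.lsmul k k (H ⧸ I) a) (Algebra.lsmul k k (H ⧸ I) b)
                (TensorProduct.map p p t) := by
            intro t
            induction t with
            | zero => simp
            | add x y hx hy => simp only [mul_add, map_add, hx, hy]
            | tmul c d =>
              rw [Algebra.TensorProduct.tmul_mul_tmul]
              rfl
          rw [h3, ht, map_zero]
      rw [smul_eq_mul, Bialgebra.comul_mul]
      exact h2 _ _ hx

/-- Takeuchi's correspondence, from coideal subalgebras to factor coalgebras: `A ↦ H / H A⁺`. -/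
def toFactorCoalgebra : ModuleFactorCoalgebra k H where
  ideal := A.augIdeal
  isCoideal := A.augIdeal_isCoideal

end RightCoidealSubalgebra

/-!
# Takeuchi's correspondence for coideal subalgebras and module factor coalgebras

Everything rests on the Galois map `h ⊗ m ↦ h₍₁₎ ⊗ h₍₂₎ m` of an `H`-module `M`, whose inverse
is `h ⊗ m ↦ h₍₁₎ ⊗ S(h₍₂₎) m`. If `M` is an object of `_H^C M` and `V` is its space of invariants,
all `m` with coaction `π(1) ⊗ m`, the inverse Galois map carries the cotensor product `H □_C M` into
`H ⊗ V` (`ModuleFactorCoalgebra.galoisInv_mem_invariants`). For `C = H/HA⁺` an `A`-balanced map on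
`H × M` factors, after the inverse Galois map, through `C ⊗ M` (`lift_galoisInv_eq_zero`).

Let all Hopf modules in `M_A^H` be projective, and let `C = H/HA⁺`.
* Since `H/A` is projective, there is an `A`-linear retraction `p : H → A`. The balanced map
  `h ⊗ y ↦ p(h) y` shows that `x = p(x) ∈ A` for every coinvariant `x`, so `A` is recovered from `C`
  (`RightHopfModulesProjective.toCoidealSubalgebra_toFactorCoalgebra`).
* A dual basis of `H` over `A` shows that an object `M` of `_H^C M` is generated by `V`, hence
  `T ⊗ M` is the tensor product of `T ⊗ H` and `V` over `A`, functorially in `A`-linear maps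
  `T ⊗ H → T' ⊗ H` (`RightCoidealSubalgebra.exists_extension`). By projectivity, the kernel and the
  image of a morphism of Hopf modules are direct summands over `A`. Applied to the cobar
  differentials of `T ⊗ H`, where `T` is a right `C`-comodule, this reduces the exactness of the
  cobar complex of `M` to that of a cofree comodule
  (`RightHopfModulesProjective.exists_cobar_eq`). For finite-dimensional `T` this exactness says that
  the obstructions to extending colinear maps into `M` vanish; comodules are locally finite, so
  Zorn's lemma makes `M` injective (`LeftCoaction.isInjective_of_cocycles`).

Let all Hopf modules in `_H^C M` be injective comodules, and let `A` be the algebra of coinvariants.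
* An object `M` has a colinear retraction `r : C ⊗ M → M` of its coaction, and the integral
  `h ⊗ m ↦ S(h₍₁₎) r(π(h₍₂₎) ⊗ m)` takes values in the invariants. So `M` is generated by its
  invariants (`LeftHopfModulesInjective.exists_actionMap_eq`). For the kernel of `π` this yields that
  the kernel is `HA⁺`
  (`LeftHopfModulesInjective.toFactorCoalgebra_toCoidealSubalgebra`).
* For a Hopf module `N` in `M_A^H`, the integral of `H` shows that the map `N → N/NA⁺ ⊗ H` induced by
  the coaction is injective (`RightCoidealSubalgebra.reducedCoaction_injective`). The solutions in
  `Hⁿ` of linear equations with coefficients in `A` form an object of `_H^C M`, so they are generated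
  by the solutions in `A`. If `N` is finitely generated, the reduced coactions of generators are a
  solution of all their relations, and it follows that `N` is projective
  (`RightCoidealSubalgebra.projective_of_finite`). In general, a section of a surjection onto `N` is
  extended over larger and larger Hopf submodules
  (`RightCoidealSubalgebra.exists_section_extension`).

The second pair of conditions is the first pair for the co-opposite Hopf algebra `K`, whose antipode
is the inverse of `S`; this is where bijectivity of `S` enters. A coideal subalgebra `A` of `H`
corresponds to `S⁻¹(A)` in `K`, and a factor coalgebra `H/I` to `K/I`; the two assignments are
compatible with this (`CoopTwist`).
-/

/-! ### Linear algebra over a field -/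

section LinearAlgebra

variable {k : Type*} [Field k] {M N P : Type*} [AddCommGroup M] [Module k M] [AddCommGroup N]
  [Module k N] [AddCommGroup P] [Module k P]

theorem exists_comp_eq_of_ker_le {q : M →ₗ[k] N} (hq : Function.Surjective q) {g : M →ₗ[k] P}
    (h : ∀ x, q x = 0 → g x = 0) : ∃ g' : N →ₗ[k] P, ∀ x, g' (q x) = g x := by
  obtain ⟨s, hs⟩ := q.exists_rightInverse_of_surjective (LinearMap.range_eq_top.2 hq)
  refine ⟨g ∘ₗ s, fun x => ?_⟩
  have := h (s (q x) - x) (by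
    rw [map_sub, ← LinearMap.comp_apply q s, hs, LinearMap.id_apply, sub_self])
  rwa [map_sub, sub_eq_zero] at this

theorem rTensor_injective {i : M →ₗ[k] N} (hi : Function.Injective i) :
    Function.Injective (i.rTensor P) :=
  Module.Flat.rTensor_preserves_injective_linearMap i hi

theorem lTensor_injective {i : M →ₗ[k] N} (hi : Function.Injective i) :
    Function.Injective (i.lTensor P) :=
  Module.Flat.lTensor_preserves_injective_linearMap i hi

theorem mem_range_lTensor_ker (T : M →ₗ[k] N) {x : P ⊗[k] M} (hx : T.lTensor P x = 0) :
    x ∈ LinearMap.range ((LinearMap.ker T).subtype.lTensor P) :=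
  (Module.Flat.lTensor_exact P (LinearMap.exact_subtype_ker_map T) x).1 hx

theorem mem_range_rTensor_subtype (W : Submodule k M) {x : M ⊗[k] P}
    (hx : W.mkQ.rTensor P x = 0) : x ∈ LinearMap.range (W.subtype.rTensor P) :=
  (Module.Flat.rTensor_exact P (LinearMap.exact_subtype_mkQ W) x).1 hx

theorem mem_range_lTensor_subtype (W : Submodule k M) {x : P ⊗[k] M}
    (hx : W.mkQ.lTensor P x = 0) : x ∈ LinearMap.range (W.subtype.lTensor P) :=
  (Module.Flat.lTensor_exact P (LinearMap.exact_subtype_mkQ W) x).1 hx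

end LinearAlgebra

/-! ### The Galois map of a Hopf algebra -/

section Galois

variable {k : Type v} {H : Type u} [Field k] [Ring H] [HopfAlgebra k H] {M N : Type*}
  [AddCommGroup M] [Module k M] [AddCommGroup N] [Module k N]
  (α : H →ₐ[k] Module.End k M) (β : H →ₐ[k] Module.End k N)

/-- The action `H ⊗ M → M`, where the `H`-module structure of `M` is given by an algebra
homomorphism `α : H → End M`. -/
noncomputable def actionMap : H ⊗[k] M →ₗ[k] M := TensorProduct.lift α.toLinearMap

@[simp]
theorem actionMap_tmul (h : H) (m : M) : actionMap α (h ⊗ₜ m) = α h m := rfl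

/-- The map `h ↦ h m`. -/
noncomputable def orbitMap (m : M) : H →ₗ[k] M := α.toLinearMap.flip m

@[simp]
theorem orbitMap_apply (m : M) (h : H) : orbitMap α m h = α h m := rfl

/-- The map `H ⊗ M → H ⊗ M`, `h ⊗ m ↦ h₍₁₎ ⊗ h₍₂₎ m`. -/
noncomputable def galoisMap : H ⊗[k] M →ₗ[k] H ⊗[k] M :=
  (actionMap α).lTensor H ∘ₗ (TensorProduct.assoc k H H M).toLinearMap ∘ₗ
    (Coalgebra.comul (R := k)).rTensor M

/-- The map `H ⊗ M → H ⊗ M`, `h ⊗ m ↦ h₍₁₎ ⊗ S(h₍₂₎) m`. -/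
noncomputable def galoisInv : H ⊗[k] M →ₗ[k] H ⊗[k] M :=
  (actionMap α).lTensor H ∘ₗ (TensorProduct.assoc k H H M).toLinearMap ∘ₗ
    ((HopfAlgebra.antipode k).lTensor H ∘ₗ Coalgebra.comul (R := k)).rTensor M

theorem galoisMap_tmul (h : H) (m : M) :
    galoisMap α (h ⊗ₜ m) = (orbitMap α m).lTensor H (Coalgebra.comul (R := k) h) := by
  simp only [galoisMap, LinearMap.comp_apply, LinearMap.rTensor_tmul, LinearEquiv.coe_coe]
  generalize Coalgebra.comul (R := k) h = t
  induction t with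
  | zero => simp
  | add x y hx hy => simp only [map_add, TensorProduct.add_tmul, hx, hy]
  | tmul a b => simp

theorem galoisInv_tmul (h : H) (m : M) :
    galoisInv α (h ⊗ₜ m) = (orbitMap α m).lTensor H
      ((HopfAlgebra.antipode k).lTensor H (Coalgebra.comul (R := k) h)) := by
  simp only [galoisInv, LinearMap.comp_apply, LinearMap.rTensor_tmul, LinearEquiv.coe_coe]
  generalize Coalgebra.comul (R := k) h = t
  induction t with
  | zero => simp
  | add x y hx hy => simp only [map_add, TensorProduct.add_tmul, hx, hy]
  | tmul a b => simp

theorem galoisMap_galoisInv (x : H ⊗[k] M) : galoisMap α (galoisInv α x) = x := by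
  induction x with
  | zero => simp
  | add x y hx hy => simp only [map_add, hx, hy]
  | tmul h m =>
    have key : ∀ t : H ⊗[k] H, galoisMap α ((orbitMap α m).lTensor H
        ((HopfAlgebra.antipode k).lTensor H t)) =
        (orbitMap α m).lTensor H ((LinearMap.mul' k H).lTensor H
          (((HopfAlgebra.antipode k).lTensor H).lTensor H
          (TensorProduct.assoc k H H H ((Coalgebra.comul (R := k)).rTensor H t)))) := by
      intro t
      induction t with
      | zero => simp
      | add x y hx hy => simp only [map_add, hx, hy]
      | tmul a b =>
        simp only [LinearMap.lTensor_tmul, galoisMap_tmul, LinearMap.rTensor_tmul, orbitMap_apply]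
        generalize Coalgebra.comul (R := k) a = t
        induction t with
        | zero => simp
        | add x y hx hy => simp only [map_add, TensorProduct.add_tmul, hx, hy]
        | tmul c d => simp
    have h2 : ∀ t : H ⊗[k] H, (LinearMap.mul' k H).lTensor H
          (((HopfAlgebra.antipode k).lTensor H).lTensor H
            ((Coalgebra.comul (R := k)).lTensor H t)) =
          (Algebra.linearMap k H).lTensor H ((Coalgebra.counit (R := k)).lTensor H t) := by
      intro t
      induction t with
      | zero => simp
      | add x y hx hy => simp only [map_add, hx, hy]
      | tmul a b => simp
    rw [galoisInv_tmul, key, Coalgebra.coassoc_apply, h2, Coalgebra.lTensor_counit_comul]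
    simp

theorem galoisInv_galoisMap (x : H ⊗[k] M) : galoisInv α (galoisMap α x) = x := by
  induction x with
  | zero => simp
  | add x y hx hy => simp only [map_add, hx, hy]
  | tmul h m =>
    have key : ∀ t : H ⊗[k] H, galoisInv α ((orbitMap α m).lTensor H t) =
        (orbitMap α m).lTensor H ((LinearMap.mul' k H).lTensor H
          (((HopfAlgebra.antipode k).rTensor H).lTensor H
          (TensorProduct.assoc k H H H ((Coalgebra.comul (R := k)).rTensor H t)))) := by
      intro t
      induction t with
      | zero => simp
      | add x y hx hy => simp only [map_add, hx, hy]
      | tmul a b =>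
        simp only [LinearMap.lTensor_tmul, galoisInv_tmul, LinearMap.rTensor_tmul, orbitMap_apply]
        generalize Coalgebra.comul (R := k) a = t
        induction t with
        | zero => simp
        | add x y hx hy => simp only [map_add, TensorProduct.add_tmul, hx, hy]
        | tmul c d => simp
    have h2 : ∀ t : H ⊗[k] H, (LinearMap.mul' k H).lTensor H
          (((HopfAlgebra.antipode k).rTensor H).lTensor H
            ((Coalgebra.comul (R := k)).lTensor H t)) =
          (Algebra.linearMap k H).lTensor H ((Coalgebra.counit (R := k)).lTensor H t) := by
      intro t
      induction t with
      | zero => simp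
      | add x y hx hy => simp only [map_add, hx, hy]
      | tmul a b => simp
    rw [galoisMap_tmul, key, Coalgebra.coassoc_apply, h2, Coalgebra.lTensor_counit_comul]
    simp

theorem galoisMap_injective : Function.Injective (galoisMap α) :=
  Function.LeftInverse.injective (galoisInv_galoisMap α)

theorem galoisMap_surjective : Function.Surjective (galoisMap α) :=
  fun x => ⟨_, galoisMap_galoisInv α x⟩

/-- `(ε ⊗ id)(h₍₁₎ ⊗ h₍₂₎ m) = h m`. -/
theorem counit_galoisMap (x : H ⊗[k] M) :
    TensorProduct.lid k M ((Coalgebra.counit (R := k)).rTensor M (galoisMap α x)) =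
      actionMap α x := by
  induction x with
  | zero => simp
  | add x y hx hy => simp only [map_add, hx, hy]
  | tmul h m =>
    have key : ∀ t : H ⊗[k] H, TensorProduct.lid k M ((Coalgebra.counit (R := k)).rTensor M
        ((orbitMap α m).lTensor H t)) = orbitMap α m (TensorProduct.lid k H
          ((Coalgebra.counit (R := k)).rTensor H t)) := by
      intro t
      induction t with
      | zero => simp
      | add x y hx hy => simp only [map_add, hx, hy]
      | tmul a b => simp
    rw [galoisMap_tmul, key, Coalgebra.rTensor_counit_comul]
    simp

/-- `h₍₁₎ S(h₍₂₎) m = ε(h) m`. -/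
theorem actionMap_galoisInv (x : H ⊗[k] M) :
    actionMap α (galoisInv α x) =
      TensorProduct.lid k M ((Coalgebra.counit (R := k)).rTensor M x) := by
  rw [← counit_galoisMap, galoisMap_galoisInv]

/-- The Galois map is natural in the `H`-module `M`. -/
theorem galoisMap_lTensor {f : M →ₗ[k] N} (hf : ∀ h m, f (α h m) = β h (f m)) (x : H ⊗[k] M) :
    galoisMap β (f.lTensor H x) = f.lTensor H (galoisMap α x) := by
  induction x with
  | zero => simp
  | add x y hx hy => simp only [map_add, hx, hy]
  | tmul h m =>
    have : orbitMap β (f m) = f ∘ₗ orbitMap α m := by ext h; simp [hf]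
    rw [LinearMap.lTensor_tmul, galoisMap_tmul, galoisMap_tmul, this, LinearMap.lTensor_comp,
      LinearMap.comp_apply]

theorem galoisInv_lTensor {f : M →ₗ[k] N} (hf : ∀ h m, f (α h m) = β h (f m)) (x : H ⊗[k] M) :
    galoisInv β (f.lTensor H x) = f.lTensor H (galoisInv α x) := by
  apply galoisMap_injective β
  rw [galoisMap_lTensor α β hf, galoisMap_galoisInv, galoisMap_galoisInv]

/-- The right multiplication by `a` composed with the Galois map `h ⊗ m ↦ h₍₁₎ ⊗ h₍₂₎ m` is
`h ⊗ m ↦ h₍₁₎ a ⊗ h₍₂₎ m`, which is the image under the Galois map of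
`h a₍₁₎ ⊗ S(a₍₂₎) m`. -/
theorem galoisInv_mulRight_galoisMap (a h : H) (m : M) :
    galoisInv α ((LinearMap.mulRight k a).rTensor M (galoisMap α (h ⊗ₜ m))) =
      (LinearMap.mulLeft k h).rTensor M (galoisInv α (a ⊗ₜ m)) := by
  apply galoisMap_injective α
  rw [galoisMap_galoisInv]
  -- the Galois map is linear for the diagonal action on its target
  have key : ∀ x : H ⊗[k] M, galoisMap α ((LinearMap.mulLeft k h).rTensor M x) =
      TensorProduct.lift ((TensorProduct.mapBilinear (RingHom.id k) H M H M).compl₁₂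
        (LinearMap.mul k H) α.toLinearMap) (Coalgebra.comul (R := k) h) (galoisMap α x) := by
    intro x
    induction x with
    | zero => simp
    | add x y hx hy => simp only [map_add, hx, hy]
    | tmul g m =>
      rw [LinearMap.rTensor_tmul, galoisMap_tmul, galoisMap_tmul, LinearMap.mulLeft_apply,
        Bialgebra.comul_mul]
      generalize Coalgebra.comul (R := k) h = s
      generalize Coalgebra.comul (R := k) g = t
      induction s with
      | zero => simp
      | add x y hx hy => simp only [add_mul, map_add, LinearMap.add_apply, hx, hy]
      | tmul a b =>
        induction t with
        | zero => simp
        | add x y hx hy => simp only [mul_add, map_add, hx, hy]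
        | tmul c d => simp
  rw [key, galoisMap_galoisInv, galoisMap_tmul]
  generalize Coalgebra.comul (R := k) h = s
  induction s with
  | zero => simp
  | add x y hx hy => simp only [map_add, LinearMap.add_apply, hx, hy]
  | tmul a b => simp

end Galois

/-! ### Diagonal actions and invariants -/

section Diagonal

variable {k : Type v} {H : Type u} [Field k] [Ring H] [HopfAlgebra k H] {M N : Type*}
  [AddCommGroup M] [Module k M] [AddCommGroup N] [Module k N]
  (α : H →ₐ[k] Module.End k M) (β : H →ₐ[k] Module.End k N)

/-- The action of `H` on `M ⊗ N` through the comultiplication, `h (m ⊗ n) = h₍₁₎ m ⊗ h₍₂₎ n`. -/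
noncomputable def diagAction : H →ₐ[k] Module.End k (M ⊗[k] N) :=
  Module.endTensorEndAlgHom.comp
    ((Algebra.TensorProduct.map α β).comp (Bialgebra.comulAlgHom k H))

theorem diagAction_tmul (h : H) (m : M) (n : N) :
    diagAction α β h (m ⊗ₜ n) =
      TensorProduct.map (orbitMap α m) (orbitMap β n) (Coalgebra.comul (R := k) h) := by
  change Module.endTensorEndAlgHom (R := k) (S := k) (A := k) (Algebra.TensorProduct.map α β
    (Coalgebra.comul (R := k) h)) (m ⊗ₜ n) = _
  generalize Coalgebra.comul (R := k) h = t
  induction t with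
  | zero => simp
  | add x y hx hy => simp only [map_add, LinearMap.add_apply, hx, hy]
  | tmul a b => simp [Module.endTensorEndAlgHom_apply]

theorem orbitMap_diagAction (m : M) (n : N) :
    orbitMap (diagAction α β) (m ⊗ₜ n) =
      TensorProduct.map (orbitMap α m) (orbitMap β n) ∘ₗ Coalgebra.comul (R := k) := by
  ext h
  exact diagAction_tmul α β h m n

end Diagonal

namespace ModuleFactorCoalgebra

variable {k : Type v} {H : Type u} [Field k] [Ring H] [HopfAlgebra k H]
  (C : ModuleFactorCoalgebra k H) {M : Type*} [AddCommGroup M] [Module k M]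
  (α : H →ₐ[k] Module.End k M)

/-- The action of `H` on `C`. -/
noncomputable def action : H →ₐ[k] Module.End k C.Quot := Algebra.lsmul k k C.Quot

@[simp]
theorem action_proj (a b : H) : C.action a (C.proj b) = C.proj (a * b) := rfl

theorem orbitMap_action_proj_one : orbitMap C.action (C.proj 1) = C.proj := by
  ext h
  simp

/-- The compatibility `l (h m) = h₍₁₎ m₍₋₁₎ ⊗ h₍₂₎ m₍₀₎` of an action of `H` on `M` and a map
`l : M → C ⊗ M`. -/
def IsCompatible (l : M →ₗ[k] C.Quot ⊗[k] M) : Prop :=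
  ∀ h m, l (α h m) = diagAction C.action α h (l m)

/-- The subspace of all `m` with `l m = π(1) ⊗ m`. -/
noncomputable def invariants (l : M →ₗ[k] C.Quot ⊗[k] M) : Submodule k M :=
  LinearMap.ker (l - TensorProduct.mk k C.Quot M (C.proj 1))

variable {C α}

theorem mem_invariants {l : M →ₗ[k] C.Quot ⊗[k] M} {m : M} :
    m ∈ C.invariants l ↔ l m = C.proj 1 ⊗ₜ m := by
  simp [invariants, sub_eq_zero]

variable (C α) in
/-- The Galois map carries `h ⊗ π(1) ⊗ m` to `h₍₁₎ ⊗ π(h₍₂₎) ⊗ h₍₃₎ m`. -/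
theorem galoisMap_diagAction_proj_one (x : H ⊗[k] M) :
    galoisMap (diagAction C.action α) ((TensorProduct.mk k C.Quot M (C.proj 1)).lTensor H x) =
      TensorProduct.assoc k H C.Quot M
        ((C.proj.lTensor H ∘ₗ Coalgebra.comul (R := k)).rTensor M (galoisMap α x)) := by
  induction x with
  | zero => simp
  | add x y hx hy => simp only [map_add, hx, hy]
  | tmul h m =>
    have key : ∀ t : H ⊗[k] H, TensorProduct.assoc k H C.Quot M
        ((C.proj.lTensor H ∘ₗ Coalgebra.comul (R := k)).rTensor M
          ((orbitMap α m).lTensor H t)) =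
        (TensorProduct.map C.proj (orbitMap α m)).lTensor H (TensorProduct.assoc k H H H
          ((Coalgebra.comul (R := k)).rTensor H t)) := by
      intro t
      induction t with
      | zero => simp
      | add x y hx hy => simp only [map_add, hx, hy]
      | tmul a b =>
        simp only [LinearMap.lTensor_tmul, LinearMap.rTensor_tmul, LinearMap.comp_apply]
        generalize Coalgebra.comul (R := k) a = s
        induction s with
        | zero => simp
        | add x y hx hy => simp only [map_add, TensorProduct.add_tmul, hx, hy]
        | tmul c d => simp
    rw [LinearMap.lTensor_tmul, TensorProduct.mk_apply, galoisMap_tmul, galoisMap_tmul, key,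
      Coalgebra.coassoc_apply, orbitMap_diagAction, orbitMap_action_proj_one,
      LinearMap.lTensor_comp, LinearMap.comp_apply]

/-- The inverse of the Galois map carries the cotensor product `H □_C M` into `H ⊗ V`, where `V` is
the space of invariants of `M`. -/
theorem galoisInv_mem_invariants {l : M →ₗ[k] C.Quot ⊗[k] M} (hl : C.IsCompatible α l)
    {x : H ⊗[k] M} (hx : l.lTensor H x = TensorProduct.assoc k H C.Quot M
        ((C.proj.lTensor H ∘ₗ Coalgebra.comul (R := k)).rTensor M x)) :
    galoisInv α x ∈ LinearMap.range ((C.invariants l).subtype.lTensor H) := by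
  refine mem_range_lTensor_ker _ ?_
  rw [LinearMap.lTensor_sub, LinearMap.sub_apply, sub_eq_zero]
  apply galoisMap_injective (diagAction C.action α)
  rw [galoisMap_diagAction_proj_one, galoisMap_galoisInv, ← hx,
    galoisMap_lTensor α _ hl, galoisMap_galoisInv]

/-- In an object of `_H^C M`, the coaction of `h v`, with `v` invariant, is `π(h₍₁₎) ⊗ h₍₂₎ v`. -/
theorem IsCompatible.coact_apply {l : M →ₗ[k] C.Quot ⊗[k] M} (hl : C.IsCompatible α l) (h : H)
    {m : M} (hm : m ∈ C.invariants l) :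
    l (α h m) = C.proj.rTensor M (galoisMap α (h ⊗ₜ m)) := by
  rw [hl, mem_invariants.1 hm, diagAction_tmul, orbitMap_action_proj_one, galoisMap_tmul,
    ← LinearMap.comp_apply (C.proj.rTensor M), LinearMap.rTensor_comp_lTensor]

end ModuleFactorCoalgebra

/-! ### Balanced maps -/

namespace RightCoidealSubalgebra

variable {k : Type v} {H : Type u} [Field k] [Ring H] [HopfAlgebra k H]
  (A : RightCoidealSubalgebra k H) {M R : Type*} [AddCommGroup M] [Module k M]
  [AddCommGroup R] [Module k R] (α : H →ₐ[k] Module.End k M)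

theorem exists_incl_eq_comul {a : H} (ha : a ∈ A.alg) :
    ∃ t, A.incl t = Coalgebra.comul (R := k) a :=
  ⟨A.coaction ⟨a, ha⟩, A.incl_coaction ⟨a, ha⟩⟩

variable {A}

theorem proj_of_mem {C : ModuleFactorCoalgebra k H} (hC : A.augIdeal ≤ C.ideal) {a : H}
    (ha : a ∈ A.alg) : C.proj a = Coalgebra.counit (R := k) a • C.proj 1 := by
  rw [← map_smul, ← sub_eq_zero, ← map_sub, C.proj_eq_zero_iff]
  refine hC (Ideal.subset_span ⟨?_, ?_⟩)
  · exact A.alg.sub_mem ha (A.alg.smul_mem A.alg.one_mem _)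
  · simp

/-- An `A`-balanced map `H × M → R` composed with the inverse of the Galois map factors through
`H/HA⁺ ⊗ M`; this is the isomorphism between `H ⊗_A M` and `H/HA⁺ ⊗ M`. -/
theorem lift_galoisInv_eq_zero {b : H →ₗ[k] M →ₗ[k] R}
    (hb : ∀ h, ∀ a ∈ A.alg, ∀ m, b (h * a) m = b h (α a m)) {x : H ⊗[k] M}
    (hx : A.toFactorCoalgebra.proj.rTensor M x = 0) :
    TensorProduct.lift b (galoisInv α x) = 0 := by
  have h1 : ∀ a ∈ A.alg, ∀ x : H ⊗[k] M,
      TensorProduct.lift b (galoisInv α ((LinearMap.mulRight k a).rTensor M x)) =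
        Coalgebra.counit (R := k) a • TensorProduct.lift b (galoisInv α x) := by
    intro a ha x
    obtain ⟨y, rfl⟩ := galoisMap_surjective α x
    induction y with
    | zero => simp
    | add x y hx hy => simp only [map_add, smul_add, hx, hy]
    | tmul h m =>
      rw [galoisInv_mulRight_galoisMap, galoisInv_galoisMap, TensorProduct.lift.tmul]
      have h2 : ∀ t : A.alg ⊗[k] H, TensorProduct.lift b ((LinearMap.mulLeft k h).rTensor M
          ((orbitMap α m).lTensor H ((HopfAlgebra.antipode k).lTensor H (A.incl t)))) =
          b h (actionMap α ((orbitMap α m).lTensor H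
            ((HopfAlgebra.antipode k).lTensor H (A.incl t)))) := by
        intro t
        induction t with
        | zero => simp
        | add x y hx hy => simp only [map_add, hx, hy]
        | tmul c d => simp [incl, hb _ _ c.2]
      obtain ⟨t, ht⟩ := A.exists_incl_eq_comul ha
      rw [galoisInv_tmul, ← ht, h2, ht, ← galoisInv_tmul, actionMap_galoisInv]
      simp
  have h2 : ∀ i ∈ A.augIdeal, ∀ (g : H) (m : M),
      TensorProduct.lift b (galoisInv α ((g * i) ⊗ₜ m)) = 0 := by
    intro i hi
    refine Submodule.span_induction (p := fun i _ => ∀ (g : H) (m : M),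
      TensorProduct.lift b (galoisInv α ((g * i) ⊗ₜ m)) = 0) ?_ (by simp) ?_ ?_ hi
    · rintro a ⟨ha, ha0⟩ g m
      have := h1 a ha (g ⊗ₜ m)
      rwa [ha0, zero_smul, LinearMap.rTensor_tmul, LinearMap.mulRight_apply] at this
    · intro x y _ _ hx hy g m
      rw [mul_add, TensorProduct.add_tmul, map_add, map_add, hx, hy, add_zero]
    · intro h x _ hx g m
      rw [smul_eq_mul, ← mul_assoc, hx]
  have hex : Function.Exact (A.augIdeal.restrictScalars k).subtype A.toFactorCoalgebra.proj := by
    intro y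
    rw [ModuleFactorCoalgebra.proj_eq_zero_iff]
    exact ⟨fun h => ⟨⟨y, h⟩, rfl⟩, by rintro ⟨z, rfl⟩; exact z.2⟩
  obtain ⟨y, rfl⟩ := (Module.Flat.rTensor_exact M hex x).1 hx
  clear hx
  induction y with
  | zero => simp
  | add x y hx hy => simp only [map_add, hx, hy, add_zero]
  | tmul i m =>
    have := h2 i i.2 1 m
    rwa [one_mul] at this

end RightCoidealSubalgebra

/-! ### Right-right Hopf modules: quotients -/

section Assoc

variable {k : Type*} [Field k] {M N P Q M' N' P' : Type*} [AddCommGroup M] [Module k M]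
  [AddCommGroup N] [Module k N] [AddCommGroup P] [Module k P] [AddCommGroup Q] [Module k Q]
  [AddCommGroup M'] [Module k M'] [AddCommGroup N'] [Module k N'] [AddCommGroup P'] [Module k P']

theorem assoc_rTensor_rTensor (f : M →ₗ[k] N) (x : (M ⊗[k] P) ⊗[k] Q) :
    TensorProduct.assoc k N P Q ((f.rTensor P).rTensor Q x) =
      f.rTensor (P ⊗[k] Q) (TensorProduct.assoc k M P Q x) := by
  have : (TensorProduct.assoc k N P Q).toLinearMap ∘ₗ (f.rTensor P).rTensor Q =
      f.rTensor (P ⊗[k] Q) ∘ₗ (TensorProduct.assoc k M P Q).toLinearMap := by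
    ext; simp
  exact LinearMap.congr_fun this x

theorem assoc_rTensor_lTensor (f : M →ₗ[k] N) (x : (P ⊗[k] M) ⊗[k] Q) :
    TensorProduct.assoc k P N Q ((f.lTensor P).rTensor Q x) =
      (f.rTensor Q).lTensor P (TensorProduct.assoc k P M Q x) := by
  have : (TensorProduct.assoc k P N Q).toLinearMap ∘ₗ (f.lTensor P).rTensor Q =
      (f.rTensor Q).lTensor P ∘ₗ (TensorProduct.assoc k P M Q).toLinearMap := by
    ext; simp
  exact LinearMap.congr_fun this x

theorem assoc_lTensor (f : M →ₗ[k] N) (x : (P ⊗[k] Q) ⊗[k] M) :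
    TensorProduct.assoc k P Q N (f.lTensor (P ⊗[k] Q) x) =
      (f.lTensor Q).lTensor P (TensorProduct.assoc k P Q M x) := by
  have : (TensorProduct.assoc k P Q N).toLinearMap ∘ₗ f.lTensor (P ⊗[k] Q) =
      (f.lTensor Q).lTensor P ∘ₗ (TensorProduct.assoc k P Q M).toLinearMap := by
    ext; simp
  exact LinearMap.congr_fun this x

theorem rTensor_lTensor_comm (f : M →ₗ[k] N) (g : P →ₗ[k] Q) (x : M ⊗[k] P) :
    f.rTensor Q (g.lTensor M x) = g.lTensor N (f.rTensor P x) := by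
  rw [← LinearMap.comp_apply, ← LinearMap.comp_apply, LinearMap.rTensor_comp_lTensor,
    LinearMap.lTensor_comp_rTensor]

end Assoc

section Transport

variable {k C N N' : Type*} [Field k] [AddCommGroup C] [Module k C] [Coalgebra k C]
  [AddCommGroup N] [Module k N] [AddCommGroup N'] [Module k N']

theorem RightCoaction.coassoc_apply (ρ : RightCoaction k C N) (n : N) :
    TensorProduct.assoc k N C C (ρ.coact.rTensor C (ρ.coact n)) =
      (Coalgebra.comul (R := k)).lTensor N (ρ.coact n) :=
  LinearMap.congr_fun ρ.coassoc n

theorem RightCoaction.counit_apply (ρ : RightCoaction k C N) (n : N) :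
    TensorProduct.rid k N ((Coalgebra.counit (R := k)).lTensor N (ρ.coact n)) = n :=
  LinearMap.congr_fun ρ.counit n

theorem LeftCoaction.coassoc_apply (l : LeftCoaction k C N) (n : N) :
    TensorProduct.assoc k C C N ((Coalgebra.comul (R := k)).rTensor N (l.coact n)) =
      l.coact.lTensor C (l.coact n) :=
  LinearMap.congr_fun l.coassoc n

theorem LeftCoaction.counit_apply (l : LeftCoaction k C N) (n : N) :
    TensorProduct.lid k N ((Coalgebra.counit (R := k)).rTensor N (l.coact n)) = n :=
  LinearMap.congr_fun l.counit n

theorem LeftCoaction.coact_injective (l : LeftCoaction k C N) : Function.Injective l.coact := by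
  intro x y h
  rw [← l.counit_apply x, ← l.counit_apply y, h]

/-- The coaction induced on a quotient. -/
def RightCoaction.ofSurjective (ρ : RightCoaction k C N) (q : N →ₗ[k] N')
    (hq : Function.Surjective q) (d : N' →ₗ[k] N' ⊗[k] C)
    (hd : ∀ n, d (q n) = q.rTensor C (ρ.coact n)) : RightCoaction k C N' where
  coact := d
  coassoc := by
    ext n'
    obtain ⟨n, rfl⟩ := hq n'
    have h : d ∘ₗ q = q.rTensor C ∘ₗ ρ.coact := LinearMap.ext hd
    simp only [LinearMap.comp_apply, LinearEquiv.coe_coe, hd]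
    rw [← LinearMap.comp_apply (d.rTensor C), ← LinearMap.rTensor_comp, h, LinearMap.rTensor_comp,
      LinearMap.comp_apply, assoc_rTensor_rTensor, ρ.coassoc_apply, rTensor_lTensor_comm]
  counit := by
    ext n'
    obtain ⟨n, rfl⟩ := hq n'
    simp only [LinearMap.comp_apply, LinearEquiv.coe_coe, hd, LinearMap.id_apply]
    rw [← rTensor_lTensor_comm]
    conv_rhs => rw [← ρ.counit_apply n]
    generalize (Coalgebra.counit (R := k)).lTensor N (ρ.coact n) = t
    induction t with
    | zero => simp
    | add x y hx hy => simp only [map_add, hx, hy]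
    | tmul a b => simp

/-- The coaction induced on a subspace. -/
def RightCoaction.ofInjective (ρ : RightCoaction k C N) (i : N' →ₗ[k] N)
    (hi : Function.Injective i) (d : N' →ₗ[k] N' ⊗[k] C)
    (hd : ∀ n, i.rTensor C (d n) = ρ.coact (i n)) : RightCoaction k C N' where
  coact := d
  coassoc := by
    ext n
    have h : i.rTensor C ∘ₗ d = ρ.coact ∘ₗ i := LinearMap.ext hd
    apply rTensor_injective hi
    simp only [LinearMap.comp_apply, LinearEquiv.coe_coe]
    rw [← assoc_rTensor_rTensor, ← LinearMap.comp_apply ((i.rTensor C).rTensor C),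
      ← LinearMap.rTensor_comp, h, LinearMap.rTensor_comp,
      LinearMap.comp_apply, hd, ρ.coassoc_apply, rTensor_lTensor_comm, hd]
  counit := by
    ext n
    apply hi
    simp only [LinearMap.comp_apply, LinearEquiv.coe_coe, LinearMap.id_apply]
    conv_rhs => rw [← ρ.counit_apply (i n), ← hd, ← rTensor_lTensor_comm]
    generalize (Coalgebra.counit (R := k)).lTensor N' (d n) = t
    induction t with
    | zero => simp
    | add x y hx hy => simp only [map_add, hx, hy]
    | tmul a b => simp

/-- The coaction induced on a subspace. -/
def LeftCoaction.ofInjective (l : LeftCoaction k C N) (i : N' →ₗ[k] N)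
    (hi : Function.Injective i) (d : N' →ₗ[k] C ⊗[k] N')
    (hd : ∀ n, i.lTensor C (d n) = l.coact (i n)) : LeftCoaction k C N' where
  coact := d
  coassoc := by
    ext n
    have h : i.lTensor C ∘ₗ d = l.coact ∘ₗ i := LinearMap.ext hd
    apply lTensor_injective (lTensor_injective hi)
    simp only [LinearMap.comp_apply, LinearEquiv.coe_coe]
    rw [← assoc_lTensor, ← rTensor_lTensor_comm, hd, l.coassoc_apply, ← hd,
      ← LinearMap.comp_apply (l.coact.lTensor C), ← LinearMap.lTensor_comp, ← h,
      LinearMap.lTensor_comp, LinearMap.comp_apply]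
  counit := by
    ext n
    apply hi
    simp only [LinearMap.comp_apply, LinearEquiv.coe_coe, LinearMap.id_apply]
    conv_rhs => rw [← l.counit_apply (i n), ← hd, rTensor_lTensor_comm]
    generalize (Coalgebra.counit (R := k)).rTensor N' (d n) = t
    induction t with
    | zero => simp
    | add x y hx hy => simp only [map_add, hx, hy]
    | tmul a b => simp

/-- The coaction induced on a quotient. -/
def LeftCoaction.ofSurjective (l : LeftCoaction k C N) (q : N →ₗ[k] N')
    (hq : Function.Surjective q) (d : N' →ₗ[k] C ⊗[k] N')
    (hd : ∀ n, d (q n) = q.lTensor C (l.coact n)) : LeftCoaction k C N' where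
  coact := d
  coassoc := by
    ext n'
    obtain ⟨n, rfl⟩ := hq n'
    have h : d ∘ₗ q = q.lTensor C ∘ₗ l.coact := LinearMap.ext hd
    simp only [LinearMap.comp_apply, LinearEquiv.coe_coe, hd]
    rw [← LinearMap.comp_apply (d.lTensor C), ← LinearMap.lTensor_comp, h, LinearMap.lTensor_comp,
      LinearMap.comp_apply, ← l.coassoc_apply, rTensor_lTensor_comm, assoc_lTensor]
  counit := by
    ext n'
    obtain ⟨n, rfl⟩ := hq n'
    simp only [LinearMap.comp_apply, LinearEquiv.coe_coe, hd, LinearMap.id_apply]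
    rw [rTensor_lTensor_comm]
    conv_rhs => rw [← l.counit_apply n]
    generalize (Coalgebra.counit (R := k)).rTensor N (l.coact n) = t
    induction t with
    | zero => simp
    | add x y hx hy => simp only [map_add, hx, hy]
    | tmul a b => simp

end Transport

namespace RightCoidealSubalgebra

variable {k : Type v} {H : Type u} [Field k] [Ring H] [HopfAlgebra k H]
  {A : RightCoidealSubalgebra k H}

/-- The right multiplication by `A ⊗ H` on `M ⊗ H`, for a right `A`-module `M`. -/
noncomputable def tensorRightAct (A : RightCoidealSubalgebra k H) (M : Type*) [AddCommGroup M]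
    [Module k M] [Module A.algᵐᵒᵖ M] [IsScalarTower k A.algᵐᵒᵖ M] :
    (A.alg ⊗[k] H) →ₗ[k] (M ⊗[k] H) →ₗ[k] M ⊗[k] H :=
  TensorProduct.lift ((TensorProduct.mapBilinear (RingHom.id k) M H M H).compl₁₂
    ((Algebra.lsmul k k M (A := A.algᵐᵒᵖ)).toLinearMap ∘ₗ
      (MulOpposite.opLinearEquiv k (M := A.alg)).toLinearMap) (LinearMap.mul k H).flip)

section

variable {M : Type*} [AddCommGroup M] [Module k M] [Module A.algᵐᵒᵖ M] [IsScalarTower k A.algᵐᵒᵖ M]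

@[simp]
theorem tensorRightAct_tmul (a : A.alg) (g : H) (m : M) (h : H) :
    A.tensorRightAct M (a ⊗ₜ g) (m ⊗ₜ h) = (MulOpposite.op a • m) ⊗ₜ (h * g) := rfl

/-- The compatibility in the category of Hopf modules, elementwise. -/
theorem isRightHopfModule_iff {ρ : RightCoaction k H M} : A.IsRightHopfModule ρ ↔
    ∀ (a : A.alg) (m : M), ρ.coact (MulOpposite.op a • m) =
      A.tensorRightAct M (A.coaction a) (ρ.coact m) := by
  have h : ∀ (a : A.alg) (m : M), TensorProduct.map (rightAct k A.alg M) (LinearMap.mul' k H)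
      (TensorProduct.tensorTensorTensorComm k M H A.alg H
        (TensorProduct.map ρ.coact A.coaction (m ⊗ₜ a))) =
      A.tensorRightAct M (A.coaction a) (ρ.coact m) := by
    intro a m
    rw [TensorProduct.map_tmul]
    generalize A.coaction a = s
    generalize ρ.coact m = t
    induction s with
    | zero => simp
    | add x y hx hy => simp only [map_add, TensorProduct.tmul_add, LinearMap.add_apply, hx, hy]
    | tmul a b =>
      induction t with
      | zero => simp
      | add x y hx hy => simp only [map_add, TensorProduct.add_tmul, hx, hy]
      | tmul c d => simp [rightAct_tmul]
  constructor
  · intro H a m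
    rw [← h a m, ← rightAct_tmul k a m]
    exact LinearMap.congr_fun H (m ⊗ₜ a)
  · intro H
    refine TensorProduct.ext' fun m a => ?_
    simp only [LinearMap.comp_apply, LinearEquiv.coe_coe, h, rightAct_tmul, H]

end

variable {N N' : Type*} [AddCommGroup N] [Module k N] [Module A.algᵐᵒᵖ N]
  [IsScalarTower k A.algᵐᵒᵖ N] [AddCommGroup N'] [Module k N'] [Module A.algᵐᵒᵖ N']
  [IsScalarTower k A.algᵐᵒᵖ N']

theorem rTensor_tensorRightAct (q : N →ₗ[A.algᵐᵒᵖ] N') (s : A.alg ⊗[k] H) (t : N ⊗[k] H) :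
    (q.restrictScalars k).rTensor H (A.tensorRightAct N s t) =
      A.tensorRightAct N' s ((q.restrictScalars k).rTensor H t) := by
  induction s with
  | zero => simp
  | add x y hx hy => simp only [map_add, LinearMap.add_apply, hx, hy]
  | tmul a b =>
    induction t with
    | zero => simp
    | add x y hx hy => simp only [map_add, hx, hy]
    | tmul c d => simp

theorem IsRightHopfModule.of_surjective {ρ : RightCoaction k H N} (hρ : A.IsRightHopfModule ρ)
    {ρ' : RightCoaction k H N'} (q : N →ₗ[A.algᵐᵒᵖ] N') (hq : Function.Surjective q)
    (h : ∀ n, ρ'.coact (q n) = (q.restrictScalars k).rTensor H (ρ.coact n)) :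
    A.IsRightHopfModule ρ' := by
  rw [isRightHopfModule_iff] at hρ ⊢
  intro a m
  obtain ⟨n, rfl⟩ := hq m
  rw [← map_smul, h, h, hρ, rTensor_tensorRightAct]

theorem IsRightHopfModule.of_injective {ρ : RightCoaction k H N} (hρ : A.IsRightHopfModule ρ)
    {ρ' : RightCoaction k H N'} (i : N' →ₗ[A.algᵐᵒᵖ] N) (hi : Function.Injective i)
    (h : ∀ n, (i.restrictScalars k).rTensor H (ρ'.coact n) = ρ.coact (i n)) :
    A.IsRightHopfModule ρ' := by
  rw [isRightHopfModule_iff] at hρ ⊢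
  intro a m
  apply rTensor_injective (i := i.restrictScalars k) hi
  rw [rTensor_tensorRightAct, h, h, map_smul, hρ]

/-- A Hopf module modulo a Hopf submodule is a Hopf module. -/
theorem IsRightHopfModule.exists_quotient {ρ : RightCoaction k H N} (hρ : A.IsRightHopfModule ρ)
    (B : Submodule A.algᵐᵒᵖ N)
    (hB : ∀ b ∈ B, (B.mkQ.restrictScalars k).rTensor H (ρ.coact b) = 0) :
    ∃ ρ' : RightCoaction k H (N ⧸ B), A.IsRightHopfModule ρ' ∧
      ∀ n, ρ'.coact (B.mkQ n) = (B.mkQ.restrictScalars k).rTensor H (ρ.coact n) := by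
  obtain ⟨d, hd⟩ := exists_comp_eq_of_ker_le (q := B.mkQ.restrictScalars k) B.mkQ_surjective
    (g := (B.mkQ.restrictScalars k).rTensor H ∘ₗ ρ.coact)
    (fun x hx => hB x ((Submodule.Quotient.mk_eq_zero B).1 hx))
  exact ⟨ρ.ofSurjective (B.mkQ.restrictScalars k) B.mkQ_surjective d hd,
    hρ.of_surjective B.mkQ B.mkQ_surjective hd, hd⟩

/-- If all Hopf modules are projective, every morphism `f` of Hopf modules is a regular element in
the sense of von Neumann: `f r f = f` for an `A`-linear map `r`. -/
theorem RightHopfModulesProjective.exists_quasiInverse (hA : A.RightHopfModulesProjective)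
    {N N' : Type u} [AddCommGroup N] [Module k N] [Module A.algᵐᵒᵖ N]
    [IsScalarTower k A.algᵐᵒᵖ N] [AddCommGroup N'] [Module k N'] [Module A.algᵐᵒᵖ N']
    [IsScalarTower k A.algᵐᵒᵖ N'] {ρ : RightCoaction k H N} {ρ' : RightCoaction k H N'}
    (hρ' : A.IsRightHopfModule ρ') (f : N →ₗ[A.algᵐᵒᵖ] N')
    (hf : ∀ n, ρ'.coact (f n) = (f.restrictScalars k).rTensor H (ρ.coact n)) :
    ∃ r : N' →ₗ[A.algᵐᵒᵖ] N, ∀ n, f (r (f n)) = f n := by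
  obtain ⟨ρ'', hρ'', -⟩ := hρ'.exists_quotient (LinearMap.range f) (by
    rintro _ ⟨n, rfl⟩
    rw [hf, ← LinearMap.comp_apply, ← LinearMap.rTensor_comp]
    have : (LinearMap.range f).mkQ.restrictScalars k ∘ₗ f.restrictScalars k = 0 := by
      ext n
      exact (Submodule.Quotient.mk_eq_zero _).2 ⟨n, rfl⟩
    rw [this, LinearMap.rTensor_zero, LinearMap.zero_apply])
  have := hA _ ρ'' hρ''
  have := hA _ ρ' hρ'
  obtain ⟨s, hs⟩ := Module.projective_lifting_property (LinearMap.range f).mkQ LinearMap.id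
    (LinearMap.range f).mkQ_surjective
  -- the projector onto the range of `f` which is defined by the section `s` lifts through `f`
  have hmem : ∀ n', n' - s ((LinearMap.range f).mkQ n') ∈ LinearMap.range f := fun n' => by
    rw [← Submodule.Quotient.mk_eq_zero, ← Submodule.mkQ_apply, map_sub,
      ← LinearMap.comp_apply _ s, hs, LinearMap.id_apply, sub_self]
  obtain ⟨r, hr⟩ := Module.projective_lifting_property f.rangeRestrict
    ((LinearMap.id - s ∘ₗ (LinearMap.range f).mkQ).codRestrict (LinearMap.range f) hmem)
    f.surjective_rangeRestrict
  refine ⟨r, fun n => ?_⟩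
  have h1 := congrArg Subtype.val (LinearMap.congr_fun hr (f n))
  have h2 : (LinearMap.range f).mkQ (f n) = 0 := (Submodule.Quotient.mk_eq_zero _).2 ⟨n, rfl⟩
  simp only [LinearMap.comp_apply, LinearMap.codRestrict_apply, LinearMap.sub_apply,
    LinearMap.id_apply, h2, map_zero, sub_zero] at h1
  exact h1

end RightCoidealSubalgebra

/-! ### The Hopf modules `A`, `H` and `T ⊗ H` -/

namespace RightCoidealSubalgebra

variable {k : Type v} {H : Type u} [Field k] [Ring H] [HopfAlgebra k H]
  (A : RightCoidealSubalgebra k H)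

/-- `H` as a right comodule over itself. -/
noncomputable def comulCoaction (k : Type v) (H : Type u) [Field k] [Ring H] [HopfAlgebra k H] :
    RightCoaction k H H where
  coact := Coalgebra.comul
  coassoc := Coalgebra.coassoc
  counit := by ext; simp

/-- `A` as a right `H`-comodule. -/
noncomputable def selfCoaction : RightCoaction k H A.alg :=
  (comulCoaction k H).ofInjective A.alg.val.toLinearMap Subtype.val_injective A.coaction
    A.incl_coaction

/-- `T ⊗ H` as a right `H`-comodule, through the comultiplication of `H`. -/
noncomputable def tensorCoaction (k : Type v) (H : Type u) [Field k] [Ring H] [HopfAlgebra k H]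
    (T : Type*) [AddCommGroup T] [Module k T] : RightCoaction k H (T ⊗[k] H) where
  coact := (TensorProduct.assoc k T H H).symm.toLinearMap ∘ₗ Coalgebra.comul.lTensor T
  coassoc := by
    refine TensorProduct.ext' fun t h => ?_
    have h1 : ∀ s : H ⊗[k] H, TensorProduct.assoc k (T ⊗[k] H) H H
        (((TensorProduct.assoc k T H H).symm.toLinearMap ∘ₗ Coalgebra.comul.lTensor T).rTensor H
          ((TensorProduct.assoc k T H H).symm (t ⊗ₜ s))) =
        (TensorProduct.assoc k T H (H ⊗[k] H)).symm
          (t ⊗ₜ TensorProduct.assoc k H H H (Coalgebra.comul.rTensor H s)) := by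
      intro s
      induction s with
      | zero => simp
      | add x y hx hy => simp only [map_add, TensorProduct.tmul_add, hx, hy]
      | tmul a b =>
        simp only [TensorProduct.assoc_symm_tmul, LinearMap.rTensor_tmul, LinearMap.comp_apply,
          LinearMap.lTensor_tmul, LinearEquiv.coe_coe]
        generalize Coalgebra.comul (R := k) a = s
        induction s with
        | zero => simp
        | add x y hx hy => simp only [map_add, TensorProduct.tmul_add, TensorProduct.add_tmul,
            hx, hy]
        | tmul c d => simp
    have h2 : ∀ s : H ⊗[k] H, Coalgebra.comul.lTensor (T ⊗[k] H)
          ((TensorProduct.assoc k T H H).symm (t ⊗ₜ s)) =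
        (TensorProduct.assoc k T H (H ⊗[k] H)).symm
          (t ⊗ₜ (Coalgebra.comul (R := k)).lTensor H s) := by
      intro s
      induction s with
      | zero => simp
      | add x y hx hy => simp only [map_add, TensorProduct.tmul_add, hx, hy]
      | tmul a b => simp
    have := h1 (Coalgebra.comul (R := k) h)
    rw [Coalgebra.coassoc_apply, ← h2] at this
    exact this
  counit := by
    refine TensorProduct.ext' fun t h => ?_
    have h1 : ∀ s : H ⊗[k] H, TensorProduct.rid k (T ⊗[k] H)
        (Coalgebra.counit.lTensor (T ⊗[k] H) ((TensorProduct.assoc k T H H).symm (t ⊗ₜ s))) =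
        t ⊗ₜ TensorProduct.rid k H ((Coalgebra.counit (R := k)).lTensor H s) := by
      intro s
      induction s with
      | zero => simp
      | add x y hx hy => simp only [map_add, TensorProduct.tmul_add, hx, hy]
      | tmul a b => simp
    have := h1 (Coalgebra.comul (R := k) h)
    rw [Coalgebra.lTensor_counit_comul] at this
    simpa using this

theorem tensorCoaction_tmul (T : Type*) [AddCommGroup T] [Module k T] (t : T) (h : H) :
    (tensorCoaction k H T).coact (t ⊗ₜ h) =
      (TensorProduct.assoc k T H H).symm (t ⊗ₜ Coalgebra.comul (R := k) h) := rfl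

/-- `H` as a right `A`-module. -/
@[reducible]
def mulModule : Module A.algᵐᵒᵖ H := Module.compHom H A.alg.val.op.toRingHom

/-- The right multiplications of `H` by elements of `A`, acting on `T ⊗ H`. -/
noncomputable def mulRightHom (T : Type*) [AddCommGroup T] [Module k T] :
    A.algᵐᵒᵖ →ₐ[k] Module.End k (T ⊗[k] H) :=
  (Module.End.lTensorAlgHom k H T).comp ((Algebra.lsmul k k H : Hᵐᵒᵖ →ₐ[k] _).comp
    (AlgHom.op A.alg.val))

/-- `T ⊗ H` as a right `A`-module, `A` acting on `H`. -/
@[reducible]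
noncomputable def tensorModule (T : Type*) [AddCommGroup T] [Module k T] :
    Module A.algᵐᵒᵖ (T ⊗[k] H) := Module.compHom (T ⊗[k] H) (A.mulRightHom T).toRingHom

section

attribute [local instance] mulModule tensorModule

theorem mulModule_smul (a : A.alg) (h : H) : MulOpposite.op a • h = h * a := rfl

theorem tensorModule_smul (T : Type*) [AddCommGroup T] [Module k T] (a : A.alg) (x : T ⊗[k] H) :
    MulOpposite.op a • x = (LinearMap.mulRight k (a : H)).lTensor T x := rfl

theorem mulModule_isScalarTower : IsScalarTower k A.algᵐᵒᵖ H :=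
  ⟨fun r a h => by
    obtain ⟨a, rfl⟩ := MulOpposite.op_surjective a
    rw [← MulOpposite.op_smul, mulModule_smul, mulModule_smul]
    simp⟩

theorem tensorModule_isScalarTower (T : Type*) [AddCommGroup T] [Module k T] :
    IsScalarTower k A.algᵐᵒᵖ (T ⊗[k] H) :=
  ⟨fun r a x => by
    change A.mulRightHom T (r • a) x = r • A.mulRightHom T a x
    rw [map_smul, LinearMap.smul_apply]⟩

attribute [local instance] mulModule_isScalarTower tensorModule_isScalarTower

theorem comulCoaction_isRightHopfModule : A.IsRightHopfModule (comulCoaction k H) := by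
  rw [isRightHopfModule_iff]
  intro a h
  change Coalgebra.comul (R := k) (h * a) = A.tensorRightAct H _ (Coalgebra.comul (R := k) h)
  rw [Bialgebra.comul_mul, ← A.incl_coaction]
  generalize Coalgebra.comul (R := k) h = t
  generalize A.coaction a = s
  induction s with
  | zero => simp
  | add x y hx hy => simp only [map_add, mul_add, LinearMap.add_apply, hx, hy]
  | tmul c d =>
    induction t with
    | zero => simp
    | add x y hx hy => simp only [map_add, add_mul, hx, hy]
    | tmul e f => simp [incl, mulModule_smul]

theorem tensorCoaction_isRightHopfModule (T : Type*) [AddCommGroup T] [Module k T] :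
    A.IsRightHopfModule (tensorCoaction k H T) := by
  rw [isRightHopfModule_iff]
  intro a x
  induction x with
  | zero => simp
  | add x y hx hy => simp only [smul_add, map_add, hx, hy]
  | tmul t h =>
    rw [tensorModule_smul, LinearMap.lTensor_tmul, tensorCoaction_tmul, tensorCoaction_tmul,
      LinearMap.mulRight_apply, Bialgebra.comul_mul, ← A.incl_coaction]
    generalize Coalgebra.comul (R := k) h = t
    generalize A.coaction a = s
    induction s with
    | zero => simp
    | add x y hx hy => simp only [map_add, mul_add, LinearMap.add_apply, TensorProduct.tmul_add,
        hx, hy]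
    | tmul c d =>
      induction t with
      | zero => simp
      | add x y hx hy => simp only [map_add, add_mul, TensorProduct.tmul_add, hx, hy]
      | tmul e f => simp [incl, tensorModule_smul]

variable {A}

/-- A retraction `H → A` of right `A`-modules. -/
theorem RightHopfModulesProjective.exists_retraction (hA : A.RightHopfModulesProjective) :
    ∃ p : H →ₗ[k] H, (∀ h, p h ∈ A.alg) ∧ (∀ h, ∀ a ∈ A.alg, p (h * a) = p h * a) ∧
      p 1 = 1 := by
  let f : A.alg →ₗ[A.algᵐᵒᵖ] H :=
    { toFun := fun a => a
      map_add' := fun _ _ => rfl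
      map_smul' := fun _ _ => rfl }
  obtain ⟨r, hr⟩ := hA.exists_quasiInverse (ρ := A.selfCoaction) A.comulCoaction_isRightHopfModule f
    (fun a => (A.incl_coaction a).symm)
  refine ⟨A.alg.val.toLinearMap ∘ₗ r.restrictScalars k, fun h => (r h).2, fun h a ha => ?_, hr 1⟩
  have := r.map_smul (MulOpposite.op ⟨a, ha⟩) h
  exact congrArg Subtype.val this

/-- A dual basis of the projective right `A`-module `H`. -/
theorem RightHopfModulesProjective.exists_dualBasis (hA : A.RightHopfModulesProjective) :
    ∃ p : H → H →ₗ[k] H, (∀ i h, p i h ∈ A.alg) ∧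
      (∀ i h, ∀ a ∈ A.alg, p i (h * a) = p i h * a) ∧
      ∀ F : Finset H, ∃ I : Finset H, ∀ h ∈ F, ∑ i ∈ I, i * p i h = h := by
  have := hA H (comulCoaction k H) A.comulCoaction_isRightHopfModule
  obtain ⟨s, hs⟩ := this.out
  let c : H → (H →₀ A.algᵐᵒᵖ) →ₗ[A.algᵐᵒᵖ] A.algᵐᵒᵖ := fun i => Finsupp.lapply i
  let p : H → H →ₗ[k] H := fun i => A.alg.val.toLinearMap ∘ₗ
    (MulOpposite.opLinearEquiv k (M := A.alg)).symm.toLinearMap ∘ₗ (c i ∘ₗ s).restrictScalars k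
  refine ⟨p, fun i h => Subtype.property _, fun i h a ha => ?_, fun F => ?_⟩
  · have := (c i ∘ₗ s).map_smul (MulOpposite.op ⟨a, ha⟩) h
    exact congrArg (fun x : A.algᵐᵒᵖ => (x.unop : H)) this
  · classical
    refine ⟨F.biUnion fun h => (s h).support, fun h hh => ?_⟩
    have h1 : h = (s h).sum fun i a => a • i := (hs h).symm.trans (by
      simp [Finsupp.linearCombination_apply])
    conv_rhs => rw [h1]
    exact (Finsupp.sum_of_support_subset (s h)
      (Finset.subset_biUnion_of_mem (fun h : H => (s h).support) hh)
      (fun i (a : A.algᵐᵒᵖ) => a • i) fun i _ => zero_smul _ i).symm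

/-- If all Hopf modules are projective, every morphism `f : T ⊗ H → T' ⊗ H` of Hopf modules is
regular in the sense of von Neumann in the category of right `A`-modules. -/
theorem RightHopfModulesProjective.exists_quasiInverse_tensor (hA : A.RightHopfModulesProjective)
    {T T' : Type u} [AddCommGroup T] [Module k T] [AddCommGroup T'] [Module k T']
    (f : T ⊗[k] H →ₗ[k] T' ⊗[k] H)
    (hfA : ∀ a ∈ A.alg, ∀ x, f ((LinearMap.mulRight k a).lTensor T x) =
      (LinearMap.mulRight k a).lTensor T' (f x))
    (hf : ∀ x, (tensorCoaction k H T').coact (f x) = f.rTensor H ((tensorCoaction k H T).coact x)) :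
    ∃ r : T' ⊗[k] H →ₗ[k] T ⊗[k] H, (∀ a ∈ A.alg, ∀ x,
      r ((LinearMap.mulRight k a).lTensor T' x) = (LinearMap.mulRight k a).lTensor T (r x)) ∧
      ∀ x, f (r (f x)) = f x := by
  let f' : T ⊗[k] H →ₗ[A.algᵐᵒᵖ] T' ⊗[k] H :=
    { toFun := f
      map_add' := f.map_add
      map_smul' := fun a x => hfA a.unop a.unop.2 x }
  obtain ⟨r, hr⟩ := hA.exists_quasiInverse (A.tensorCoaction_isRightHopfModule T') f' hf
  exact ⟨r.restrictScalars k, fun a ha x => r.map_smul (MulOpposite.op ⟨a, ha⟩) x, hr⟩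

end

end RightCoidealSubalgebra

namespace RightCoidealSubalgebra

variable {k : Type v} {H : Type u} [Field k] [Ring H] [HopfAlgebra k H]
  {A : RightCoidealSubalgebra k H}

/-! ### The coideal subalgebra is recovered from its factor coalgebra -/

theorem leftCoactH_of_mem {C : ModuleFactorCoalgebra k H} (hC : A.augIdeal ≤ C.ideal) {a : H}
    (ha : a ∈ A.alg) : C.leftCoactH a = C.proj 1 ⊗ₜ a := by
  obtain ⟨t, ht⟩ := A.exists_incl_eq_comul ha
  have h1 : ∀ t, C.proj.rTensor H (A.incl t) = C.proj 1 ⊗ₜ[k] TensorProduct.lid k H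
      ((Coalgebra.counit (R := k)).rTensor H (A.incl t)) := by
    intro t
    induction t with
    | zero => simp
    | add x y hx hy => simp only [map_add, TensorProduct.tmul_add, hx, hy]
    | tmul a b => simp [incl, proj_of_mem hC a.2, TensorProduct.smul_tmul]
  rw [ModuleFactorCoalgebra.leftCoactH, LinearMap.comp_apply, ← ht, h1, ht,
    Coalgebra.rTensor_counit_comul]
  simp

theorem RightHopfModulesProjective.toCoidealSubalgebra_toFactorCoalgebra
    (hA : A.RightHopfModulesProjective) : A.toFactorCoalgebra.toCoidealSubalgebra = A := by
  obtain ⟨p, hp, hpA, hp1⟩ := hA.exists_retraction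
  ext x
  refine ⟨fun hx => ?_, fun hx => leftCoactH_of_mem (C := A.toFactorCoalgebra) le_rfl hx⟩
  replace hx : A.toFactorCoalgebra.leftCoactH x = A.toFactorCoalgebra.proj 1 ⊗ₜ x := hx
  have hΔ : galoisMap (Algebra.lmul k H) (x ⊗ₜ 1) = Coalgebra.comul (R := k) x := by
    have : orbitMap (Algebra.lmul k H) (1 : H) = LinearMap.id := by ext; simp
    rw [galoisMap_tmul, this, LinearMap.lTensor_id, LinearMap.id_apply]
  -- the balanced map `h ⊗ y ↦ p(h) y` has the same value on `x ⊗ 1` and on `1 ⊗ x`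
  have := lift_galoisInv_eq_zero (A := A) (Algebra.lmul k H) (b := LinearMap.mul k H ∘ₗ p)
    (fun h a ha m => by simp [hpA h a ha, mul_assoc])
    (x := galoisMap (Algebra.lmul k H) (x ⊗ₜ 1) - 1 ⊗ₜ x) (by
      rw [map_sub, hΔ]
      exact sub_eq_zero.2 hx)
  rw [map_sub, map_sub, galoisInv_galoisMap, galoisInv_tmul, Bialgebra.comul_one, sub_eq_zero] at this
  have h2 : p x = x := by simpa [Algebra.TensorProduct.one_def, hp1] using this
  exact h2 ▸ hp x

/-! ### Generation of Hopf modules by their invariants -/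

section

variable {M : Type*} [AddCommGroup M] [Module k M] {α : H →ₐ[k] Module.End k M}

theorem diagAction_proj_one {C : ModuleFactorCoalgebra k H} (hC : A.augIdeal ≤ C.ideal) {a : H}
    (ha : a ∈ A.alg) (m : M) :
    diagAction C.action α a (C.proj 1 ⊗ₜ m) = C.proj 1 ⊗ₜ α a m := by
  have := leftCoactH_of_mem hC ha
  rw [ModuleFactorCoalgebra.leftCoactH, LinearMap.comp_apply] at this
  rw [diagAction_tmul, C.orbitMap_action_proj_one, ← LinearMap.lTensor_comp_rTensor,
    LinearMap.comp_apply, this]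
  simp

theorem exists_finset_rTensor_eq (y : H ⊗[k] M) :
    ∃ F : Finset H, ∀ f : H →ₗ[k] H, (∀ h ∈ F, f h = h) → f.rTensor M y = y := by
  classical
  induction y with
  | zero => exact ⟨∅, by simp⟩
  | add x y hx hy =>
    obtain ⟨F, hF⟩ := hx
    obtain ⟨G, hG⟩ := hy
    refine ⟨F ∪ G, fun f hf => ?_⟩
    rw [map_add, hF f fun h hh => hf h (Finset.mem_union_left _ hh),
      hG f fun h hh => hf h (Finset.mem_union_right _ hh)]
  | tmul h m => exact ⟨{h}, fun f hf => by rw [LinearMap.rTensor_tmul, hf h (by simp)]⟩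

/-- For an `A`-linear map `p : H → A` the element `p(h₍₁₎) S(h₍₂₎) m₍₀₎` is invariant; here `h` is a
representative of `m₍₋₁₎`, that is, `x` represents the coaction of `m`. -/
theorem actionMap_rTensor_galoisInv_mem_invariants
    (l : LeftCoaction k A.toFactorCoalgebra.Quot M)
    (hl : A.toFactorCoalgebra.IsCompatible α l.coact) {p : H →ₗ[k] H} (hp : ∀ h, p h ∈ A.alg)
    (hpA : ∀ h, ∀ a ∈ A.alg, p (h * a) = p h * a) {m : M} {x : H ⊗[k] M}
    (hx : A.toFactorCoalgebra.proj.rTensor M x = l.coact m) :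
    actionMap α (p.rTensor M (galoisInv α x)) ∈ A.toFactorCoalgebra.invariants l.coact := by
  let C := A.toFactorCoalgebra
  let δ := diagAction C.action α
  let b : H →ₗ[k] (C.Quot ⊗[k] M) →ₗ[k] (C.Quot ⊗[k] M) := δ.toLinearMap ∘ₗ p
  have hb : ∀ h, ∀ a ∈ A.alg, ∀ m, b (h * a) m = b h (δ a m) := by
    intro h a ha m
    simp [b, hpA h a ha]
  -- two representatives in `H ⊗ C ⊗ M` of `m₍₋₂₎ ⊗ m₍₋₁₎ ⊗ m₍₀₎`
  let x₁ : H ⊗[k] (C.Quot ⊗[k] M) := l.coact.lTensor H x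
  let x₂ : H ⊗[k] (C.Quot ⊗[k] M) := TensorProduct.assoc k H C.Quot M
    ((C.proj.lTensor H ∘ₗ Coalgebra.comul (R := k)).rTensor M x)
  have h2 : ∀ x : H ⊗[k] M, C.proj.rTensor (C.Quot ⊗[k] M) (TensorProduct.assoc k H C.Quot M
      ((C.proj.lTensor H ∘ₗ Coalgebra.comul (R := k)).rTensor M x)) =
      TensorProduct.assoc k C.Quot C.Quot M
        ((Coalgebra.comul (R := k)).rTensor M (C.proj.rTensor M x)) := by
    intro x
    rw [← assoc_rTensor_rTensor, ← LinearMap.comp_apply (LinearMap.rTensor M _)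
      (LinearMap.rTensor M _), ← LinearMap.comp_apply (LinearMap.rTensor M _)
      (LinearMap.rTensor M _), ← LinearMap.rTensor_comp, ← LinearMap.rTensor_comp,
      ← LinearMap.comp_assoc, LinearMap.rTensor_comp_lTensor]
    rfl
  have h12 : C.proj.rTensor (C.Quot ⊗[k] M) (x₁ - x₂) = 0 := by
    rw [map_sub, sub_eq_zero]
    simp only [x₁, x₂]
    rw [h2, rTensor_lTensor_comm, hx, l.coassoc_apply]
  have key := lift_galoisInv_eq_zero δ hb h12
  rw [map_sub, map_sub, sub_eq_zero] at key
  have e1 : TensorProduct.lift b (galoisInv δ x₁) =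
      l.coact (actionMap α (p.rTensor M (galoisInv α x))) := by
    simp only [x₁]
    rw [galoisInv_lTensor α δ hl]
    generalize galoisInv α x = y
    induction y with
    | zero => simp
    | add x y hx hy => simp only [map_add, hx, hy]
    | tmul h m => simp [b, hl _ _, δ, C]
  have e2 : TensorProduct.lift b (galoisInv δ x₂) =
      C.proj 1 ⊗ₜ (actionMap α (p.rTensor M (galoisInv α x))) := by
    have : x₂ = galoisMap δ ((TensorProduct.mk k C.Quot M (C.proj 1)).lTensor H
        (galoisInv α x)) := by
      rw [C.galoisMap_diagAction_proj_one, galoisMap_galoisInv]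
    rw [this, galoisInv_galoisMap]
    generalize galoisInv α x = y
    induction y with
    | zero => simp
    | add x y hx hy => simp only [map_add, TensorProduct.tmul_add, hx, hy]
    | tmul h m =>
      have := diagAction_proj_one (A := A) (C := C) (α := α) le_rfl (hp h) m
      simpa [b] using this
  rw [e1, e2] at key
  exact ModuleFactorCoalgebra.mem_invariants.2 key

/-- Under the projectivity condition on `A`, the objects of `_H^C M` are generated by their
invariants. -/
theorem RightHopfModulesProjective.exists_actionMap_eq (hA : A.RightHopfModulesProjective)
    (l : LeftCoaction k A.toFactorCoalgebra.Quot M)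
    (hl : A.toFactorCoalgebra.IsCompatible α l.coact) (m : M) :
    ∃ w : H ⊗[k] A.toFactorCoalgebra.invariants l.coact,
      actionMap α ((Submodule.subtype _).lTensor H w) = m := by
  obtain ⟨x, hx⟩ := LinearMap.rTensor_surjective M A.toFactorCoalgebra.proj_surjective (l.coact m)
  obtain ⟨p, hp, hpA, hp1⟩ := hA.exists_dualBasis
  obtain ⟨F, hF⟩ := exists_finset_rTensor_eq (galoisInv α x)
  obtain ⟨I, hI⟩ := hp1 F
  have h1 := hF (∑ i ∈ I, LinearMap.mulLeft k i ∘ₗ p i) (fun h hh => by simpa using hI h hh)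
  refine ⟨∑ i ∈ I, i ⊗ₜ ⟨_, actionMap_rTensor_galoisInv_mem_invariants l hl (hp i) (hpA i) hx⟩, ?_⟩
  have h2 : m = actionMap α (galoisInv α x) := by
    rw [actionMap_galoisInv]
    conv_lhs => rw [← l.counit_apply m, ← hx]
    rw [← LinearMap.comp_apply (LinearMap.rTensor M _), ← LinearMap.rTensor_comp]
    rfl
  have h3 : ∀ (i : H) (y : H ⊗[k] M), actionMap α ((LinearMap.mulLeft k i ∘ₗ p i).rTensor M y) =
      α i (actionMap α ((p i).rTensor M y)) := by
    intro i y
    induction y with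
    | zero => simp
    | add x y hx hy => simp only [map_add, hx, hy]
    | tmul h m => simp
  refine Eq.trans ?_ h2.symm
  conv_rhs => rw [← h1]
  have h4 : LinearMap.rTensor M (∑ i ∈ I, LinearMap.mulLeft k i ∘ₗ p i) =
      ∑ i ∈ I, LinearMap.rTensor M (LinearMap.mulLeft k i ∘ₗ p i) := map_sum
        (LinearMap.rTensorHom M) _ _
  rw [h4, LinearMap.sum_apply, map_sum, map_sum, map_sum]
  refine Finset.sum_congr rfl fun i _ => ?_
  rw [h3]
  simp

end

end RightCoidealSubalgebra

/-! ### A cobar differential -/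

section Cobar

variable {k C M T : Type*} [Field k] [AddCommGroup C] [Module k C] [AddCommGroup M] [Module k M]
  [AddCommGroup T] [Module k T]

/-- For linear maps `l : M → C ⊗ M` and `t : T → T ⊗ C`, the difference of the two maps
`T ⊗ M → T ⊗ C ⊗ M`. If `l` and `t` are comodule structures, its kernel is the cotensor product
`T □_C M`; applied to `t = cobar Δ t₀` it is the next differential of the cobar complex. -/
noncomputable def cobar (l : M →ₗ[k] C ⊗[k] M) (t : T →ₗ[k] T ⊗[k] C) :
    T ⊗[k] M →ₗ[k] (T ⊗[k] C) ⊗[k] M :=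
  (TensorProduct.assoc k T C M).symm.toLinearMap ∘ₗ l.lTensor T - t.rTensor M

theorem cobar_tmul (l : M →ₗ[k] C ⊗[k] M) (t : T →ₗ[k] T ⊗[k] C) (x : T) (m : M) :
    cobar l t (x ⊗ₜ m) = (TensorProduct.assoc k T C M).symm (x ⊗ₜ l m) - t x ⊗ₜ m := rfl

theorem cobar_apply (l : M →ₗ[k] C ⊗[k] M) (t : T →ₗ[k] T ⊗[k] C) (x : T ⊗[k] M) :
    cobar l t x = (TensorProduct.assoc k T C M).symm (l.lTensor T x) - t.rTensor M x := rfl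

variable [Coalgebra k C]

/-- The cofree left comodule `C ⊗ M`. -/
noncomputable def cofreeCoaction (k C M : Type*) [Field k] [AddCommGroup C] [Module k C]
    [Coalgebra k C] [AddCommGroup M] [Module k M] : LeftCoaction k C (C ⊗[k] M) where
  coact := (TensorProduct.assoc k C C M).toLinearMap ∘ₗ Coalgebra.comul.rTensor M
  coassoc := by
    refine TensorProduct.ext' fun c m => ?_
    have h1 : ∀ s : C ⊗[k] C, TensorProduct.assoc k C C (C ⊗[k] M)
        ((Coalgebra.comul (R := k)).rTensor (C ⊗[k] M) (TensorProduct.assoc k C C M (s ⊗ₜ m))) =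
        (TensorProduct.assoc k C C M).toLinearMap.lTensor C (TensorProduct.assoc k C (C ⊗[k] C) M
          (TensorProduct.assoc k C C C (Coalgebra.comul.rTensor C s) ⊗ₜ m)) := by
      intro s
      induction s with
      | zero => simp
      | add x y hx hy => simp only [map_add, TensorProduct.add_tmul, hx, hy]
      | tmul a b =>
        simp only [TensorProduct.assoc_tmul, LinearMap.rTensor_tmul]
        generalize Coalgebra.comul (R := k) a = s
        induction s with
        | zero => simp
        | add x y hx hy => simp only [map_add, TensorProduct.add_tmul, hx, hy]
        | tmul c d => simp
    have h2 : ∀ s : C ⊗[k] C, ((TensorProduct.assoc k C C M).toLinearMap ∘ₗ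
        Coalgebra.comul.rTensor M).lTensor C (TensorProduct.assoc k C C M (s ⊗ₜ m)) =
        (TensorProduct.assoc k C C M).toLinearMap.lTensor C (TensorProduct.assoc k C (C ⊗[k] C) M
          ((Coalgebra.comul (R := k)).lTensor C s ⊗ₜ m)) := by
      intro s
      induction s with
      | zero => simp
      | add x y hx hy => simp only [map_add, TensorProduct.add_tmul, hx, hy]
      | tmul a b => simp
    have := h1 (Coalgebra.comul (R := k) c)
    rw [Coalgebra.coassoc_apply, ← h2] at this
    exact this
  counit := by
    refine TensorProduct.ext' fun c m => ?_
    have h1 : ∀ s : C ⊗[k] C, TensorProduct.lid k (C ⊗[k] M)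
        (Coalgebra.counit.rTensor (C ⊗[k] M) (TensorProduct.assoc k C C M (s ⊗ₜ m))) =
        TensorProduct.lid k C ((Coalgebra.counit (R := k)).rTensor C s) ⊗ₜ m := by
      intro s
      induction s with
      | zero => simp
      | add x y hx hy => simp only [map_add, TensorProduct.add_tmul, hx, hy]
      | tmul a b => simp [TensorProduct.smul_tmul']
    have := h1 (Coalgebra.comul (R := k) c)
    rw [Coalgebra.rTensor_counit_comul] at this
    simpa using this

theorem cofreeCoaction_tmul (c : C) (m : M) : (cofreeCoaction k C M).coact (c ⊗ₜ m) =
    TensorProduct.assoc k C C M (Coalgebra.comul (R := k) c ⊗ₜ m) := rfl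

/-- The cobar differential of a cofree comodule `C ⊗ M`. -/
theorem cobar_cofreeCoaction (t : T →ₗ[k] T ⊗[k] C) (x : (T ⊗[k] C) ⊗[k] M) :
    cobar (cofreeCoaction k C M).coact t (TensorProduct.assoc k T C M x) =
      TensorProduct.assoc k (T ⊗[k] C) C M
        ((cobar (Coalgebra.comul (R := k)) t).rTensor M x) := by
  induction x with
  | zero => simp
  | add x y hx hy => simp only [map_add, hx, hy]
  | tmul x m =>
    induction x with
    | zero => simp
    | add x y hx hy => simp only [map_add, TensorProduct.add_tmul, hx, hy]
    | tmul y c =>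
      rw [TensorProduct.assoc_tmul, cobar_tmul, cofreeCoaction_tmul, LinearMap.rTensor_tmul,
        cobar_tmul, TensorProduct.sub_tmul, map_sub]
      congr 1
      · generalize Coalgebra.comul (R := k) c = s
        induction s with
        | zero => simp
        | add x y hx hy => simp only [map_add, TensorProduct.tmul_add, TensorProduct.add_tmul,
            hx, hy]
        | tmul c d => simp
      
end Cobar

namespace RightCoidealSubalgebra

variable {k : Type v} {H : Type u} [Field k] [Ring H] [HopfAlgebra k H]
  {A : RightCoidealSubalgebra k H}

section Expand

variable {M T T' : Type*} [AddCommGroup M] [Module k M] [AddCommGroup T] [Module k T]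
  [AddCommGroup T'] [Module k T'] (α : H →ₐ[k] Module.End k M)

/-- For a space `V` of elements of an `H`-module `M`, the map `(T ⊗ H) ⊗ V → T ⊗ M`,
`(t ⊗ h) ⊗ v ↦ t ⊗ h v`. -/
noncomputable def expand (V : Submodule k M) (T : Type*) [AddCommGroup T] [Module k T] :
    (T ⊗[k] H) ⊗[k] V →ₗ[k] T ⊗[k] M :=
  (actionMap α).lTensor T ∘ₗ (TensorProduct.assoc k T H M).toLinearMap ∘ₗ
    V.subtype.lTensor (T ⊗[k] H)

variable {V : Submodule k M}

theorem expand_tmul (w : T ⊗[k] H) (v : V) :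
    expand α V T (w ⊗ₜ v) = (orbitMap α (v : M)).lTensor T w := by
  induction w with
  | zero => simp
  | add x y hx hy => simp only [map_add, TensorProduct.add_tmul, hx, hy]
  | tmul t h => simp [expand]

variable {α}

theorem expand_surjective (hV : ∀ m, ∃ w : H ⊗[k] V, actionMap α (V.subtype.lTensor H w) = m) :
    Function.Surjective (expand α V T) := by
  intro z
  induction z with
  | zero => exact ⟨0, map_zero _⟩
  | add x y hx hy =>
    obtain ⟨a, rfl⟩ := hx
    obtain ⟨b, rfl⟩ := hy
    exact ⟨a + b, map_add _ _ _⟩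
  | tmul t m =>
    obtain ⟨w, rfl⟩ := hV m
    refine ⟨(TensorProduct.assoc k T H V).symm (t ⊗ₜ w), ?_⟩
    induction w with
    | zero => simp
    | add x y hx hy => simp only [map_add, TensorProduct.tmul_add, hx, hy]
    | tmul h v => simp [expand]

/-- Functoriality of `T ⊗ M` in the `A`-linear maps `T ⊗ H → T' ⊗ H`: an object of `_H^C M` is the
tensor product over `A` of `H` with its space of invariants. -/
theorem exists_extension (l : LeftCoaction k A.toFactorCoalgebra.Quot M)
    (hl : A.toFactorCoalgebra.IsCompatible α l.coact) (φ : T ⊗[k] H →ₗ[k] T' ⊗[k] H)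
    (hφ : ∀ a ∈ A.alg, ∀ x, φ ((LinearMap.mulRight k a).lTensor T x) =
      (LinearMap.mulRight k a).lTensor T' (φ x)) :
    ∃ φM : T ⊗[k] M →ₗ[k] T' ⊗[k] M, ∀ w,
      φM (expand α (A.toFactorCoalgebra.invariants l.coact) T w) =
        expand α (A.toFactorCoalgebra.invariants l.coact) T' (φ.rTensor _ w) := by
  let C := A.toFactorCoalgebra
  obtain ⟨s, hs⟩ := C.proj.exists_rightInverse_of_surjective
    (LinearMap.range_eq_top.2 C.proj_surjective)
  let ψ : T ⊗[k] (H ⊗[k] M) →ₗ[k] T' ⊗[k] M :=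
    (actionMap α).lTensor T' ∘ₗ (TensorProduct.assoc k T' H M).toLinearMap ∘ₗ
      φ.rTensor M ∘ₗ (TensorProduct.assoc k T H M).symm.toLinearMap
  let b : T → H →ₗ[k] M →ₗ[k] T' ⊗[k] M := fun t =>
    ((LinearMap.lTensorHom T') ∘ₗ α.toLinearMap.flip).flip ∘ₗ φ ∘ₗ TensorProduct.mk k T H t
  have hb : ∀ t h m, b t h m = (orbitMap α m).lTensor T' (φ (t ⊗ₜ h)) := fun t h m => rfl
  have hψ : ∀ t y, ψ (t ⊗ₜ y) = TensorProduct.lift (b t) y := by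
    intro t y
    induction y with
    | zero => simp
    | add x y hx hy => simp only [map_add, TensorProduct.tmul_add, hx, hy]
    | tmul h m =>
      simp only [ψ, LinearMap.comp_apply, LinearEquiv.coe_coe, TensorProduct.assoc_symm_tmul,
        LinearMap.rTensor_tmul, TensorProduct.lift.tmul, hb]
      generalize φ (t ⊗ₜ h) = z
      induction z with
      | zero => simp
      | add x y hx hy => simp only [map_add, TensorProduct.add_tmul, hx, hy]
      | tmul x g => simp
  refine ⟨ψ ∘ₗ (galoisInv α ∘ₗ s.rTensor M ∘ₗ l.coact).lTensor T, fun w => ?_⟩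
  induction w with
  | zero => simp
  | add x y hx hy => simp only [map_add, hx, hy]
  | tmul w v =>
    rw [expand_tmul, LinearMap.rTensor_tmul, expand_tmul]
    induction w with
    | zero => simp
    | add x y hx hy => simp only [map_add, hx, hy]
    | tmul t h =>
      simp only [LinearMap.lTensor_tmul, LinearMap.comp_apply, orbitMap_apply]
      rw [hψ, hl.coact_apply h v.2]
      have h1 : C.proj.rTensor M (s.rTensor M (C.proj.rTensor M (galoisMap α (h ⊗ₜ (v : M)))) -
          galoisMap α (h ⊗ₜ (v : M))) = 0 := by
        rw [map_sub, ← LinearMap.comp_apply (LinearMap.rTensor M _), ← LinearMap.rTensor_comp, hs,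
          LinearMap.rTensor_id, LinearMap.id_apply, sub_self]
      have h2 := lift_galoisInv_eq_zero α (b := b t) (fun h a ha m => by
        have := hφ a ha (t ⊗ₜ h)
        rw [LinearMap.lTensor_tmul, LinearMap.mulRight_apply] at this
        rw [hb, hb, this, ← LinearMap.comp_apply, ← LinearMap.lTensor_comp]
        congr 2
        ext; simp) h1
      rw [map_sub, map_sub, sub_eq_zero, galoisInv_galoisMap] at h2
      exact h2

theorem cobar_expand {C : ModuleFactorCoalgebra k H} (l : LeftCoaction k C.Quot M)
    (hl : C.IsCompatible α l.coact) (t : T →ₗ[k] T ⊗[k] C.Quot)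
    (w : (T ⊗[k] H) ⊗[k] C.invariants l.coact) :
    cobar l.coact t (expand α _ T w) =
      expand α _ (T ⊗[k] C.Quot) ((cobar C.leftCoactH t).rTensor _ w) := by
  induction w with
  | zero => simp
  | add x y hx hy => simp only [map_add, hx, hy]
  | tmul w v =>
    rw [expand_tmul, LinearMap.rTensor_tmul, expand_tmul]
    induction w with
    | zero => simp
    | add x y hx hy => simp only [map_add, hx, hy]
    | tmul x h =>
      rw [LinearMap.lTensor_tmul, cobar_tmul, cobar_tmul, orbitMap_apply, hl.coact_apply h v.2,
        map_sub, LinearMap.lTensor_tmul, orbitMap_apply, galoisMap_tmul]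
      congr 1
      simp only [ModuleFactorCoalgebra.leftCoactH, LinearMap.comp_apply]
      generalize Coalgebra.comul (R := k) h = s
      induction s with
      | zero => simp
      | add x y hx hy => simp only [map_add, TensorProduct.tmul_add, hx, hy]
      | tmul a b => simp

end Expand

end RightCoidealSubalgebra

namespace ModuleFactorCoalgebra

variable {k : Type v} {H : Type u} [Field k] [Ring H] [HopfAlgebra k H]
  (C : ModuleFactorCoalgebra k H)

/-- `H` as a left `C`-comodule. -/
noncomputable def coactionH : LeftCoaction k C.Quot H where
  coact := C.leftCoactH
  coassoc := by
    ext x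
    have h1 : ∀ s : H ⊗[k] H, TensorProduct.assoc k C.Quot C.Quot H
        (Coalgebra.comul.rTensor H (C.proj.rTensor H s)) =
        TensorProduct.map C.proj (C.proj.rTensor H)
          (TensorProduct.assoc k H H H ((Coalgebra.comul (R := k)).rTensor H s)) := by
      intro s
      induction s with
      | zero => simp
      | add x y hx hy => simp only [map_add, hx, hy]
      | tmul a b =>
        simp only [LinearMap.rTensor_tmul, comul_proj]
        generalize Coalgebra.comul (R := k) a = s
        induction s with
        | zero => simp
        | add x y hx hy => simp only [map_add, TensorProduct.add_tmul, hx, hy]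
        | tmul c d => simp
    have h2 : ∀ s : H ⊗[k] H, C.leftCoactH.lTensor C.Quot (C.proj.rTensor H s) =
        TensorProduct.map C.proj (C.proj.rTensor H) ((Coalgebra.comul (R := k)).lTensor H s) := by
      intro s
      induction s with
      | zero => simp
      | add x y hx hy => simp only [map_add, hx, hy]
      | tmul a b => simp [leftCoactH]
    have := h1 (Coalgebra.comul (R := k) x)
    rw [Coalgebra.coassoc_apply, ← h2] at this
    exact this
  counit := by
    ext x
    change TensorProduct.lid k H ((Coalgebra.counit (R := k)).rTensor H
      (C.proj.rTensor H (Coalgebra.comul (R := k) x))) = x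
    rw [← LinearMap.comp_apply (LinearMap.rTensor H _), ← LinearMap.rTensor_comp]
    change TensorProduct.lid k H ((Coalgebra.counit (R := k)).rTensor H
      (Coalgebra.comul (R := k) x)) = x
    simp

theorem leftCoactH_isCompatible : C.IsCompatible (Algebra.lmul k H) C.leftCoactH := by
  intro g h
  change C.leftCoactH (g * h) = _
  simp only [leftCoactH, LinearMap.comp_apply, Bialgebra.comul_mul]
  generalize Coalgebra.comul (R := k) h = t
  induction t with
  | zero => simp
  | add x y hx hy => simp only [mul_add, map_add, hx, hy]
  | tmul c d =>
    rw [LinearMap.rTensor_tmul, diagAction_tmul]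
    generalize Coalgebra.comul (R := k) g = s
    induction s with
    | zero => simp
    | add x y hx hy => simp only [add_mul, map_add, hx, hy]
    | tmul a b => simp

/-- The cofree comodule `C ⊗ M` with the diagonal action of `H` is an object of `_H^C M`. -/
theorem cofreeCoaction_isCompatible {M : Type*} [AddCommGroup M] [Module k M]
    (α : H →ₐ[k] Module.End k M) :
    C.IsCompatible (diagAction C.action α) (cofreeCoaction k C.Quot M).coact := by
  intro g x
  induction x with
  | zero => simp
  | add x y hx hy => simp only [map_add, hx, hy]
  | tmul c m =>
    obtain ⟨h, rfl⟩ := C.proj_surjective c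
    have h1 : ∀ s : H ⊗[k] H, (cofreeCoaction k C.Quot M).coact
        (TensorProduct.map (orbitMap C.action (C.proj h)) (orbitMap α m) s) =
        TensorProduct.assoc k _ _ _ (TensorProduct.map (TensorProduct.map C.proj C.proj)
          (orbitMap α m) ((LinearMap.mulRight k (Coalgebra.comul (R := k) h) ∘ₗ
            Coalgebra.comul (R := k)).rTensor H s)) := by
      intro s
      induction s with
      | zero => simp
      | add x y hx hy => simp only [map_add, hx, hy]
      | tmul a b => simp [cofreeCoaction_tmul, comul_proj]
    have h2 : ∀ c d : H, ∀ s : H ⊗[k] H,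
        TensorProduct.assoc k _ _ _ (TensorProduct.map (TensorProduct.map C.proj C.proj)
          (orbitMap α m) ((LinearMap.mulRight k (c ⊗ₜ[k] d) ∘ₗ
            Coalgebra.comul (R := k)).rTensor H s)) =
        TensorProduct.map (orbitMap C.action (C.proj c)) (TensorProduct.map
          (orbitMap C.action (C.proj d)) (orbitMap α m))
          (TensorProduct.assoc k H H H (Coalgebra.comul.rTensor H s)) := by
      intro c d s
      induction s with
      | zero => simp
      | add x y hx hy => simp only [map_add, hx, hy]
      | tmul a b =>
        simp only [LinearMap.rTensor_tmul, LinearMap.comp_apply]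
        generalize Coalgebra.comul (R := k) a = s
        induction s with
        | zero => simp
        | add x y hx hy => simp only [map_add, TensorProduct.add_tmul, hx, hy]
        | tmul e f => simp
    have h3 : ∀ t : H ⊗[k] H, TensorProduct.assoc k _ _ _
        (TensorProduct.map (TensorProduct.map C.proj C.proj)
          (orbitMap α m) ((LinearMap.mulRight k t ∘ₗ
            Coalgebra.comul (R := k)).rTensor H (Coalgebra.comul (R := k) g))) =
        diagAction C.action (diagAction C.action α) g
          (TensorProduct.assoc k _ _ _ (TensorProduct.map C.proj C.proj t ⊗ₜ m)) := by
      intro t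
      induction t with
      | zero =>
        rw [show LinearMap.mulRight k (0 : H ⊗[k] H) = 0 by ext; simp]
        simp
      | add x y hx hy =>
        rw [show LinearMap.mulRight k (x + y) = LinearMap.mulRight k x + LinearMap.mulRight k y by
          ext; simp [mul_add], LinearMap.add_comp, LinearMap.rTensor_add, LinearMap.add_apply,
          map_add, map_add, hx, hy, map_add, TensorProduct.add_tmul, map_add, map_add]
      | tmul c d =>
        rw [h2, Coalgebra.coassoc_apply, TensorProduct.map_tmul, TensorProduct.assoc_tmul,
          diagAction_tmul, orbitMap_diagAction, ← LinearMap.comp_apply, LinearMap.lTensor,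
          ← TensorProduct.map_comp, LinearMap.comp_id]
    rw [diagAction_tmul, h1, h3, cofreeCoaction_tmul, comul_proj]

end ModuleFactorCoalgebra

/-! ### Exactness of the cobar complexes of Hopf modules -/

namespace RightCoidealSubalgebra

variable {k : Type v} {H : Type u} [Field k] [Ring H] [HopfAlgebra k H]
  {A : RightCoidealSubalgebra k H}

theorem leftCoactH_mul_of_mem {C : ModuleFactorCoalgebra k H} (hC : A.augIdeal ≤ C.ideal) {a : H}
    (ha : a ∈ A.alg) (h : H) :
    C.leftCoactH (h * a) = (LinearMap.mulRight k a).lTensor _ (C.leftCoactH h) := by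
  have h1 : orbitMap (Algebra.lmul k H) a = LinearMap.mulRight k a := by ext; simp
  have := C.leftCoactH_isCompatible.coact_apply h
    (ModuleFactorCoalgebra.mem_invariants.2 (leftCoactH_of_mem hC ha))
  rw [galoisMap_tmul, h1, rTensor_lTensor_comm] at this
  exact this

variable {T : Type*} [AddCommGroup T] [Module k T]
  (t : T →ₗ[k] T ⊗[k] A.toFactorCoalgebra.Quot)

theorem cobar_mulRight {a : H} (ha : a ∈ A.alg) (x : T ⊗[k] H) :
    cobar A.toFactorCoalgebra.leftCoactH t ((LinearMap.mulRight k a).lTensor T x) =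
      (LinearMap.mulRight k a).lTensor _ (cobar A.toFactorCoalgebra.leftCoactH t x) := by
  induction x with
  | zero => simp
  | add x y hx hy => simp only [map_add, hx, hy]
  | tmul x h =>
    rw [LinearMap.lTensor_tmul, cobar_tmul, cobar_tmul, LinearMap.mulRight_apply,
      leftCoactH_mul_of_mem le_rfl ha, map_sub]
    congr 1
    generalize A.toFactorCoalgebra.leftCoactH h = s
    induction s with
    | zero => simp
    | add x y hx hy => simp only [map_add, TensorProduct.tmul_add, hx, hy]
    | tmul c d => simp

theorem tensorCoaction_cobar (x : T ⊗[k] H) :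
    (tensorCoaction k H _).coact (cobar A.toFactorCoalgebra.leftCoactH t x) =
      (cobar A.toFactorCoalgebra.leftCoactH t).rTensor H ((tensorCoaction k H T).coact x) := by
  induction x with
  | zero => simp
  | add x y hx hy => simp only [map_add, hx, hy]
  | tmul x h =>
    let C := A.toFactorCoalgebra
    have h1 : ∀ s : H ⊗[k] H, (cobar C.leftCoactH t).rTensor H
        ((TensorProduct.assoc k T H H).symm (x ⊗ₜ s)) =
        (TensorProduct.assoc k _ H H).symm ((TensorProduct.assoc k T C.Quot (H ⊗[k] H)).symm
          (x ⊗ₜ C.proj.rTensor (H ⊗[k] H) (TensorProduct.assoc k H H H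
            (Coalgebra.comul.rTensor H s)))) -
        (TensorProduct.assoc k _ H H).symm (t x ⊗ₜ s) := by
      intro s
      induction s with
      | zero => simp
      | add x y hx hy =>
        simp only [map_add, TensorProduct.tmul_add, hx, hy]
        abel
      | tmul a b =>
        simp only [TensorProduct.assoc_symm_tmul, LinearMap.rTensor_tmul, cobar_tmul,
          TensorProduct.sub_tmul]
        congr 1
        simp only [ModuleFactorCoalgebra.leftCoactH, LinearMap.comp_apply]
        generalize Coalgebra.comul (R := k) a = s
        induction s with
        | zero => simp
        | add x y hx hy => simp only [map_add, TensorProduct.tmul_add, TensorProduct.add_tmul,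
            hx, hy]
        | tmul c d => simp
    have h2 : ∀ s : H ⊗[k] H, (tensorCoaction k H (T ⊗[k] C.Quot)).coact
        ((TensorProduct.assoc k T C.Quot H).symm (x ⊗ₜ C.proj.rTensor H s)) =
        (TensorProduct.assoc k _ H H).symm ((TensorProduct.assoc k T C.Quot (H ⊗[k] H)).symm
          (x ⊗ₜ C.proj.rTensor (H ⊗[k] H) (Coalgebra.comul.lTensor H s))) := by
      intro s
      induction s with
      | zero => simp
      | add x y hx hy => simp only [map_add, TensorProduct.tmul_add, hx, hy]
      | tmul a b => simp [tensorCoaction_tmul]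
    have h3 := h1 (Coalgebra.comul (R := k) h)
    rw [Coalgebra.coassoc_apply, ← h2] at h3
    rw [tensorCoaction_tmul, h3, cobar_tmul, map_sub]
    congr 1

variable {M : Type*} [AddCommGroup M] [Module k M] {α : H →ₐ[k] Module.End k M}

/-- Exactness of the cobar complex for `M = H`. The Hopf module `T ⊗ C ⊗ H` is the sum, as an
`A`-module, of the image of the differential and of the image of an `A`-linear projector `e` which
vanishes on it; after tensoring with `H` over `A` the complex becomes a cobar complex of the cofree
comodule `C ⊗ H`, and this shows that `e` annihilates the cocycles. -/
theorem RightHopfModulesProjective.exists_cobar_eq_leftCoactH (hA : A.RightHopfModulesProjective)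
    {T : Type u} [AddCommGroup T] [Module k T] (t : T →ₗ[k] T ⊗[k] A.toFactorCoalgebra.Quot)
    {z : (T ⊗[k] A.toFactorCoalgebra.Quot) ⊗[k] H}
    (hz : cobar A.toFactorCoalgebra.leftCoactH (cobar (Coalgebra.comul (R := k)) t) z = 0) :
    ∃ y, cobar A.toFactorCoalgebra.leftCoactH t y = z := by
  let C := A.toFactorCoalgebra
  let d := cobar C.leftCoactH t
  obtain ⟨r, hrA, hr⟩ := hA.exists_quasiInverse_tensor d (fun a ha x => cobar_mulRight t ha x)
    (tensorCoaction_cobar t)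
  let e : (T ⊗[k] C.Quot) ⊗[k] H →ₗ[k] (T ⊗[k] C.Quot) ⊗[k] H := LinearMap.id - d ∘ₗ r
  have heA : ∀ a ∈ A.alg, ∀ x, e ((LinearMap.mulRight k a).lTensor _ x) =
      (LinearMap.mulRight k a).lTensor _ (e x) := by
    intro a ha x
    simp only [e, LinearMap.sub_apply, LinearMap.comp_apply, LinearMap.id_apply, hrA a ha, map_sub]
    rw [cobar_mulRight t ha]
  have hed : e ∘ₗ d = 0 := by
    refine LinearMap.ext fun x => ?_
    simp [e, hr]
  let δ := diagAction C.action (Algebra.lmul k H)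
  let l := cofreeCoaction k C.Quot H
  have hl : C.IsCompatible δ l.coact := C.cofreeCoaction_isCompatible _
  obtain ⟨w, hw⟩ := expand_surjective (T := T) (hA.exists_actionMap_eq l hl)
    (TensorProduct.assoc k T C.Quot H z)
  obtain ⟨eM, heM⟩ := exists_extension l hl e heA
  have h1 : cobar l.coact t (TensorProduct.assoc k T C.Quot H z) =
      C.leftCoactH.lTensor (T ⊗[k] C.Quot) z := by
    rw [cobar_cofreeCoaction]
    rw [cobar_apply, sub_eq_zero] at hz
    rw [← hz, LinearEquiv.apply_symm_apply]
  have hv : (C.proj 1 ⊗ₜ[k] (1 : H)) ∈ C.invariants l.coact := by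
    rw [ModuleFactorCoalgebra.mem_invariants, cofreeCoaction_tmul, C.comul_proj,
      Bialgebra.comul_one]
    simp [Algebra.TensorProduct.one_def]
  have h2 : ∀ x, expand δ (C.invariants l.coact) (T ⊗[k] C.Quot) (x ⊗ₜ ⟨_, hv⟩) =
      C.leftCoactH.lTensor _ x := by
    intro x
    have : orbitMap δ (C.proj 1 ⊗ₜ[k] (1 : H)) = C.leftCoactH := by
      have h1 : orbitMap (Algebra.lmul k H) (1 : H) = LinearMap.id := by ext; simp
      rw [orbitMap_diagAction, C.orbitMap_action_proj_one, h1]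
      rfl
    rw [expand_tmul, this]
  have h3 : C.leftCoactH.lTensor (T ⊗[k] C.Quot) (e z) = 0 := by
    rw [← h2, ← LinearMap.rTensor_tmul, ← heM, h2, ← h1, ← hw, cobar_expand l hl, heM,
      ← LinearMap.comp_apply (e.rTensor _), ← LinearMap.rTensor_comp, hed, LinearMap.rTensor_zero,
      LinearMap.zero_apply, map_zero]
  have h4 : e z = 0 := lTensor_injective C.coactionH.coact_injective (by rw [map_zero]; exact h3)
  refine ⟨r z, ?_⟩
  have : z - d (r z) = 0 := h4
  exact (sub_eq_zero.1 this).symm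

/-- Exactness of the cobar complex for all objects `M` of `_H^C M`. -/
theorem RightHopfModulesProjective.exists_cobar_eq (hA : A.RightHopfModulesProjective)
    (l : LeftCoaction k A.toFactorCoalgebra.Quot M)
    (hl : A.toFactorCoalgebra.IsCompatible α l.coact)
    {T : Type u} [AddCommGroup T] [Module k T] (t : T →ₗ[k] T ⊗[k] A.toFactorCoalgebra.Quot)
    {z : (T ⊗[k] A.toFactorCoalgebra.Quot) ⊗[k] M}
    (hz : cobar l.coact (cobar (Coalgebra.comul (R := k)) t) z = 0) :
    ∃ y, cobar l.coact t y = z := by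
  let t' := cobar (Coalgebra.comul (R := k)) t
  let d := cobar A.toFactorCoalgebra.leftCoactH t'
  obtain ⟨r, hrA, hr⟩ := hA.exists_quasiInverse_tensor d (fun a ha x => cobar_mulRight t' ha x)
    (tensorCoaction_cobar t')
  obtain ⟨w, rfl⟩ := expand_surjective (hA.exists_actionMap_eq l hl) z
  obtain ⟨rM, hrM⟩ := exists_extension l hl r hrA
  obtain ⟨e, he⟩ : ∃ e : (T ⊗[k] A.toFactorCoalgebra.Quot) ⊗[k] H →ₗ[k]
      (T ⊗[k] A.toFactorCoalgebra.Quot) ⊗[k] H, ∀ x, e x = x - r (d x) :=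
    ⟨LinearMap.id - r ∘ₗ d, fun _ => rfl⟩
  have h1 : ∀ w : ((T ⊗[k] A.toFactorCoalgebra.Quot) ⊗[k] H) ⊗[k]
      A.toFactorCoalgebra.invariants l.coact,
      expand α (A.toFactorCoalgebra.invariants l.coact) _ (e.rTensor _ w) ∈
        LinearMap.range (cobar l.coact t) := by
    intro w
    induction w with
    | zero => simp
    | add x y hx hy =>
      rw [map_add, map_add]
      exact add_mem hx hy
    | tmul x v =>
      obtain ⟨y, hy⟩ := hA.exists_cobar_eq_leftCoactH t (z := e x) (by
        change d _ = 0
        rw [he, map_sub, hr, sub_self])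
      refine ⟨expand α _ T (y ⊗ₜ v), ?_⟩
      rw [cobar_expand l hl, LinearMap.rTensor_tmul, LinearMap.rTensor_tmul, hy]
  have h2 : ∀ w : ((T ⊗[k] A.toFactorCoalgebra.Quot) ⊗[k] H) ⊗[k]
      A.toFactorCoalgebra.invariants l.coact,
      expand α (A.toFactorCoalgebra.invariants l.coact) _ (e.rTensor _ w) =
        expand α _ _ w - expand α _ _ (r.rTensor _ (d.rTensor _ w)) := by
    intro w
    induction w with
    | zero => simp
    | add x y hx hy =>
      simp only [map_add, hx, hy]
      abel
    | tmul x v => rw [LinearMap.rTensor_tmul, LinearMap.rTensor_tmul, LinearMap.rTensor_tmul, he,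
        TensorProduct.sub_tmul, map_sub]
  rw [cobar_expand l hl] at hz
  have h3 := h1 w
  rw [h2, ← hrM, hz, map_zero, sub_zero] at h3
  exact h3

end RightCoidealSubalgebra

/-! ### Local finiteness of comodules -/

section LocallyFinite

variable {k : Type*} [Field k] {C M : Type*} [AddCommGroup C] [Module k C] [AddCommGroup M]
  [Module k M]

theorem tensor_eq_zero_of_rTensor {t : C ⊗[k] M}
    (h : ∀ ξ : C →ₗ[k] k, TensorProduct.lid k M (ξ.rTensor M t) = 0) : t = 0 := by
  classical
  let b := Module.Basis.ofVectorSpace k C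
  apply (TensorProduct.equivFinsuppOfBasisLeft (N := M) b).injective
  have key : ∀ i, ∀ t : C ⊗[k] M, TensorProduct.equivFinsuppOfBasisLeft b t i =
      TensorProduct.lid k M ((b.coord i).rTensor M t) := by
    intro i t
    induction t with
    | zero => simp
    | add x y hx hy => simp only [map_add, Finsupp.add_apply, hx, hy]
    | tmul c m => simp
  ext i
  rw [key, h, map_zero, Finsupp.zero_apply]

theorem mem_range_lTensor_of_rTensor_mem (W : Submodule k M) {t : C ⊗[k] M}
    (h : ∀ ξ : C →ₗ[k] k, TensorProduct.lid k M (ξ.rTensor M t) ∈ W) :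
    t ∈ LinearMap.range (W.subtype.lTensor C) := by
  refine mem_range_lTensor_subtype W (tensor_eq_zero_of_rTensor fun ξ => ?_)
  have : ∀ t : C ⊗[k] M, TensorProduct.lid k (M ⧸ W) (ξ.rTensor _ (W.mkQ.lTensor C t)) =
      W.mkQ (TensorProduct.lid k M (ξ.rTensor M t)) := by
    intro t
    induction t with
    | zero => simp
    | add x y hx hy => simp only [map_add, hx, hy]
    | tmul c m => simp
  rw [this]
  exact (Submodule.Quotient.mk_eq_zero W).2 (h ξ)

/-- The common part of the local finiteness of left and right comodules: the element `m` is
contained in a finite-dimensional subspace `W` with `l(W) ⊆ C ⊗ W`. -/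
theorem exists_finite_of_linear (l : M →ₗ[k] C ⊗[k] M)
    (hl : ∀ ξ : C →ₗ[k] k, ∃ η : C →ₗ[k] C, ∀ m,
      l (TensorProduct.lid k M (ξ.rTensor M (l m))) = η.rTensor M (l m)) (m : M)
    (hm : ∃ ε : C →ₗ[k] k, TensorProduct.lid k M (ε.rTensor M (l m)) = m) :
    ∃ W : Submodule k M, Module.Finite k W ∧ m ∈ W ∧
      ∀ w ∈ W, l w ∈ LinearMap.range (W.subtype.lTensor C) := by
  let Φ : (C →ₗ[k] k) →ₗ[k] M := (TensorProduct.lid k M).toLinearMap ∘ₗ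
    (LinearMap.applyₗ (l m)) ∘ₗ (LinearMap.rTensorHom M)
  have hΦ : ∀ ξ, Φ ξ = TensorProduct.lid k M (ξ.rTensor M (l m)) := fun ξ => rfl
  have hfin : ∀ t : C ⊗[k] M, ∃ W₀ : Submodule k M, Module.Finite k W₀ ∧
      ∀ ξ : C →ₗ[k] k, TensorProduct.lid k M (ξ.rTensor M t) ∈ W₀ := by
    intro t
    induction t with
    | zero => exact ⟨⊥, inferInstance, by simp⟩
    | add x y hx hy =>
      obtain ⟨W₁, _, h1⟩ := hx
      obtain ⟨W₂, _, h2⟩ := hy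
      refine ⟨W₁ ⊔ W₂, inferInstance, fun ξ => ?_⟩
      rw [map_add, map_add]
      exact add_mem (Submodule.mem_sup_left (h1 ξ)) (Submodule.mem_sup_right (h2 ξ))
    | tmul c m =>
      refine ⟨Submodule.span k {m}, inferInstance, fun ξ => ?_⟩
      rw [LinearMap.rTensor_tmul, TensorProduct.lid_tmul]
      exact Submodule.smul_mem _ _ (Submodule.mem_span_singleton_self m)
  obtain ⟨W₀, _, hW₀⟩ := hfin (l m)
  refine ⟨LinearMap.range Φ, ?_, ?_, ?_⟩
  · exact Module.Finite.of_injective (Submodule.inclusion (p := LinearMap.range Φ) (p' := W₀) (by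
      rintro _ ⟨ξ, rfl⟩
      exact hW₀ ξ)) (Submodule.inclusion_injective _)
  · obtain ⟨ε, hε⟩ := hm
    exact ⟨ε, hε⟩
  · rintro _ ⟨ξ, rfl⟩
    refine mem_range_lTensor_of_rTensor_mem _ fun ζ => ?_
    obtain ⟨η, hη⟩ := hl ξ
    refine ⟨ζ ∘ₗ η, ?_⟩
    rw [hΦ, hΦ, hη, LinearMap.rTensor_comp, LinearMap.comp_apply]

variable [Coalgebra k C]

theorem LeftCoaction.exists_finite (l : LeftCoaction k C M) (m : M) :
    ∃ W : Submodule k M, Module.Finite k W ∧ m ∈ W ∧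
      ∀ w ∈ W, l.coact w ∈ LinearMap.range (W.subtype.lTensor C) := by
  refine exists_finite_of_linear l.coact (fun ξ => ?_) m ⟨Coalgebra.counit, l.counit_apply m⟩
  refine ⟨(TensorProduct.lid k C).toLinearMap ∘ₗ ξ.rTensor C ∘ₗ Coalgebra.comul, fun m => ?_⟩
  have h1 : ∀ t : C ⊗[k] M, l.coact (TensorProduct.lid k M (ξ.rTensor M t)) =
      TensorProduct.lid k _ (ξ.rTensor _ (l.coact.lTensor C t)) := by
    intro t
    induction t with
    | zero => simp
    | add x y hx hy => simp only [map_add, hx, hy]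
    | tmul c m => simp
  rw [h1, ← l.coassoc_apply]
  generalize l.coact m = t
  induction t with
  | zero => simp
  | add x y hx hy => simp only [map_add, hx, hy]
  | tmul c m =>
    simp only [LinearMap.rTensor_tmul, LinearMap.comp_apply]
    generalize Coalgebra.comul (R := k) c = s
    induction s with
    | zero => simp
    | add x y hx hy => simp only [map_add, TensorProduct.add_tmul, hx, hy]
    | tmul a b => simp [TensorProduct.smul_tmul']

theorem RightCoaction.exists_finite (ρ : RightCoaction k C M) (m : M) :
    ∃ W : Submodule k M, Module.Finite k W ∧ m ∈ W ∧
      ∀ w ∈ W, ρ.coact w ∈ LinearMap.range (W.subtype.rTensor C) := by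
  have hlid : ∀ (ξ : C →ₗ[k] k) (t : M ⊗[k] C), TensorProduct.lid k M
      (ξ.rTensor M (TensorProduct.comm k M C t)) = TensorProduct.rid k M (ξ.lTensor M t) := by
    intro ξ t
    induction t with
    | zero => simp
    | add x y hx hy => simp only [map_add, hx, hy]
    | tmul c m => simp
  have hη : ∀ ξ : C →ₗ[k] k, ∃ η : C →ₗ[k] C, ∀ m,
      ((TensorProduct.comm k M C).toLinearMap ∘ₗ ρ.coact) (TensorProduct.lid k M (ξ.rTensor M
        (((TensorProduct.comm k M C).toLinearMap ∘ₗ ρ.coact) m))) =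
      η.rTensor M (((TensorProduct.comm k M C).toLinearMap ∘ₗ ρ.coact) m) := by
    intro ξ
    refine ⟨(TensorProduct.rid k C).toLinearMap ∘ₗ ξ.lTensor C ∘ₗ Coalgebra.comul, fun m => ?_⟩
    simp only [LinearMap.comp_apply, LinearEquiv.coe_coe, hlid]
    have h1 : ∀ t : M ⊗[k] C, ρ.coact (TensorProduct.rid k M (ξ.lTensor M t)) =
        TensorProduct.rid k _ (ξ.lTensor _ (ρ.coact.rTensor C t)) := by
      intro t
      induction t with
      | zero => simp
      | add x y hx hy => simp only [map_add, hx, hy]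
      | tmul c m => simp
    have h2 : ∀ t : (M ⊗[k] C) ⊗[k] C, TensorProduct.rid k _ (ξ.lTensor _ t) =
        ((TensorProduct.rid k C).toLinearMap ∘ₗ ξ.lTensor C).lTensor M
          (TensorProduct.assoc k M C C t) := by
      intro t
      induction t with
      | zero => simp
      | add x y hx hy => simp only [map_add, hx, hy]
      | tmul x d =>
        induction x with
        | zero => simp
        | add x y hx hy => simp only [map_add, TensorProduct.add_tmul, hx, hy]
        | tmul a b => simp
    rw [h1, h2, ρ.coassoc_apply]
    generalize ρ.coact m = t
    induction t with
    | zero => simp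
    | add x y hx hy => simp only [map_add, hx, hy]
    | tmul m c => simp
  obtain ⟨W, h1, h2, h3⟩ := exists_finite_of_linear _ hη m
    ⟨Coalgebra.counit, (hlid _ _).trans (ρ.counit_apply m)⟩
  refine ⟨W, h1, h2, fun w hw => ?_⟩
  obtain ⟨t, ht⟩ := h3 w hw
  refine ⟨TensorProduct.comm k C W t, ?_⟩
  apply (TensorProduct.comm k M C).injective
  refine Eq.trans ?_ ht
  clear ht
  induction t with
  | zero => simp
  | add x y hx hy => simp only [map_add, hx, hy]
  | tmul c m => simp

end LocallyFinite

/-! ### A criterion of injectivity of comodules -/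

section Injective

variable {k : Type v} [Field k] {C : Type u} [AddCommGroup C] [Module k C] [Coalgebra k C]

/-- A cocycle on the comodule `Y` with values in the cobar complex of `M`. -/
def LeftCoaction.IsCocycle {Y M : Type*} [AddCommGroup Y] [Module k Y] [AddCommGroup M] [Module k M]
    (lY : LeftCoaction k C Y) (l : LeftCoaction k C M) (δ : Y →ₗ[k] C ⊗[k] M) : Prop :=
  ∀ y, δ.lTensor C (lY.coact y) - (cofreeCoaction k C M).coact (δ y) +
    l.coact.lTensor C (δ y) = 0

theorem LeftCoaction.isCocycle_coboundary {Y M : Type*} [AddCommGroup Y] [Module k Y]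
    [AddCommGroup M] [Module k M] (lY : LeftCoaction k C Y) (l : LeftCoaction k C M)
    (g : Y →ₗ[k] M) : lY.IsCocycle l (l.coact ∘ₗ g - g.lTensor C ∘ₗ lY.coact) := by
  intro y
  have h1 : (cofreeCoaction k C M).coact (g.lTensor C (lY.coact y)) =
      (g.lTensor C).lTensor C (lY.coact.lTensor C (lY.coact y)) := by
    rw [← lY.coassoc_apply, ← assoc_lTensor, ← rTensor_lTensor_comm]
    rfl
  have h2 : (cofreeCoaction k C M).coact (l.coact (g y)) =
      l.coact.lTensor C (l.coact (g y)) := l.coassoc_apply _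
  rw [LinearMap.lTensor_sub, LinearMap.lTensor_comp, LinearMap.lTensor_comp]
  simp only [LinearMap.sub_apply, LinearMap.comp_apply, map_sub, h1, h2]
  abel

/-- Extension of a colinear map from a subcomodule `Z` to a larger subcomodule containing a given
element, provided that the cocycles on finite-dimensional comodules are coboundaries. -/
theorem LeftCoaction.exists_colinear_extension {M Y : Type u} [AddCommGroup M] [Module k M]
    [AddCommGroup Y] [Module k Y] (l : LeftCoaction k C M) (lY : LeftCoaction k C Y)
    (hM : ∀ (F : Type u) [AddCommGroup F] [Module k F] [Module.Finite k F]
      (lF : LeftCoaction k C F) (δ : F →ₗ[k] C ⊗[k] M), lF.IsCocycle l δ →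
        ∃ u : F →ₗ[k] M, ∀ y, δ y = l.coact (u y) - u.lTensor C (lF.coact y))
    {Z : Submodule k Y} {g : Z →ₗ[k] M}
    (hg : ∀ z : Z, ∃ s, Z.subtype.lTensor C s = lY.coact z ∧ g.lTensor C s = l.coact (g z))
    (y₀ : Y) : ∃ (Z' : Submodule k Y) (g' : Z' →ₗ[k] M), y₀ ∈ Z' ∧
      (∀ z : Z', ∃ s, Z'.subtype.lTensor C s = lY.coact z ∧ g'.lTensor C s = l.coact (g' z)) ∧
      ∃ h : Z ≤ Z', ∀ z, g' (Submodule.inclusion h z) = g z := by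
  obtain ⟨g₁, hg₁⟩ := g.exists_extend
  -- the quotient comodule `Y / Z`
  obtain ⟨d, hd⟩ := exists_comp_eq_of_ker_le (q := Z.mkQ) Z.mkQ_surjective
    (g := Z.mkQ.lTensor C ∘ₗ lY.coact) (fun y hy => by
      obtain ⟨s, hs, -⟩ := hg ⟨y, (Submodule.Quotient.mk_eq_zero Z).1 hy⟩
      have h0 : Z.mkQ ∘ₗ Z.subtype = 0 := by ext z; simp
      rw [LinearMap.comp_apply, ← hs, ← LinearMap.comp_apply, ← LinearMap.lTensor_comp, h0,
        LinearMap.lTensor_zero, LinearMap.zero_apply])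
  let lQ : LeftCoaction k C (Y ⧸ Z) := lY.ofSurjective Z.mkQ Z.mkQ_surjective d hd
  obtain ⟨W, hWfin, hyW, hW⟩ := lQ.exists_finite (Z.mkQ y₀)
  -- the coaction of the finite-dimensional subcomodule `W`
  obtain ⟨dW, hdW⟩ : ∃ dW : W →ₗ[k] C ⊗[k] W,
      ∀ w, W.subtype.lTensor C (dW w) = lQ.coact w := by
    refine ⟨(LinearEquiv.ofInjective (W.subtype.lTensor C)
      (lTensor_injective W.injective_subtype)).symm.toLinearMap ∘ₗ
        (lQ.coact ∘ₗ W.subtype).codRestrict _ (fun w => hW w w.2), fun w => ?_⟩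
    have h := LinearEquiv.apply_symm_apply (LinearEquiv.ofInjective (W.subtype.lTensor C)
      (lTensor_injective W.injective_subtype))
      ((lQ.coact ∘ₗ W.subtype).codRestrict _ (fun w => hW w w.2) w)
    exact congrArg Subtype.val h
  let lW : LeftCoaction k C W := lQ.ofInjective W.subtype W.injective_subtype dW hdW
  -- the defect of colinearity of `g₁` is a cocycle that vanishes on `Z`
  let δ : Y →ₗ[k] C ⊗[k] M := l.coact ∘ₗ g₁ - g₁.lTensor C ∘ₗ lY.coact
  have hδ := lY.isCocycle_coboundary l g₁
  obtain ⟨δQ, hδQ⟩ := exists_comp_eq_of_ker_le (q := Z.mkQ) Z.mkQ_surjective (g := δ)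
    (fun y hy => by
      obtain ⟨s, hs, hs'⟩ := hg ⟨y, (Submodule.Quotient.mk_eq_zero Z).1 hy⟩
      have h1 : g₁ y = g ⟨y, (Submodule.Quotient.mk_eq_zero Z).1 hy⟩ := 
        LinearMap.congr_fun hg₁ ⟨y, (Submodule.Quotient.mk_eq_zero Z).1 hy⟩
      change l.coact (g₁ y) - g₁.lTensor C (lY.coact y) = 0
      rw [h1, ← hs', ← hs, ← LinearMap.comp_apply (g₁.lTensor C), ← LinearMap.lTensor_comp, hg₁,
        sub_self])
  have hcocQ : lQ.IsCocycle l δQ := by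
    intro x
    obtain ⟨y, rfl⟩ := Z.mkQ_surjective x
    have h1 : δQ ∘ₗ Z.mkQ = δ := LinearMap.ext hδQ
    change δQ.lTensor C (d (Z.mkQ y)) - _ + _ = 0
    rw [hd, LinearMap.comp_apply, ← LinearMap.comp_apply (δQ.lTensor C), ← LinearMap.lTensor_comp,
      h1, hδQ]
    exact hδ y
  obtain ⟨u, hu⟩ := hM W lW (δQ ∘ₗ W.subtype) (fun w => by
    have := hcocQ w
    rw [← hdW, ← LinearMap.comp_apply (δQ.lTensor C), ← LinearMap.lTensor_comp] at this
    exact this)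
  obtain ⟨u₁, hu₁⟩ := u.exists_extend
  let g₂ : Y →ₗ[k] M := g₁ - u₁ ∘ₗ Z.mkQ
  let Z' : Submodule k Y := W.comap Z.mkQ
  refine ⟨Z', g₂ ∘ₗ Z'.subtype, hyW, fun z => ?_, ?_, ?_⟩
  · have hz : Z.mkQ (z : Y) ∈ W := z.2
    have h1 : lY.coact z ∈ LinearMap.range (Z'.subtype.lTensor C) := by
      refine mem_range_lTensor_subtype _ ?_
      obtain ⟨j, hj⟩ := exists_comp_eq_of_ker_le (q := Z'.mkQ) Z'.mkQ_surjective
        (g := W.mkQ ∘ₗ Z.mkQ) (fun y hy =>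
          (Submodule.Quotient.mk_eq_zero W).2 ((Submodule.Quotient.mk_eq_zero Z').1 hy))
      have hj' : j ∘ₗ Z'.mkQ = W.mkQ ∘ₗ Z.mkQ := LinearMap.ext hj
      have hjinj : Function.Injective j := by
        rw [injective_iff_map_eq_zero]
        intro x hx
        obtain ⟨y, rfl⟩ := Z'.mkQ_surjective x
        rw [hj] at hx
        exact (Submodule.Quotient.mk_eq_zero Z').2 ((Submodule.Quotient.mk_eq_zero W).1 hx)
      apply lTensor_injective hjinj
      rw [map_zero, ← LinearMap.comp_apply (j.lTensor C), ← LinearMap.lTensor_comp, hj',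
        LinearMap.lTensor_comp, LinearMap.comp_apply]
      have h2 : Z.mkQ.lTensor C (lY.coact z) = W.subtype.lTensor C (dW ⟨_, hz⟩) := by
        rw [hdW]
        exact (hd z).symm
      have h0 : W.mkQ ∘ₗ W.subtype = 0 := by ext z; simp
      rw [h2, ← LinearMap.comp_apply (W.mkQ.lTensor C), ← LinearMap.lTensor_comp, h0,
        LinearMap.lTensor_zero, LinearMap.zero_apply]
    obtain ⟨s, hs⟩ := h1
    refine ⟨s, hs, ?_⟩
    rw [LinearMap.lTensor_comp, LinearMap.comp_apply, hs]
    have h3 := hu ⟨_, hz⟩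
    have h4 : u ⟨_, hz⟩ = u₁ (Z.mkQ z) := (LinearMap.congr_fun hu₁ ⟨_, hz⟩).symm
    have h5 : u.lTensor C (dW ⟨_, hz⟩) = (u₁ ∘ₗ Z.mkQ).lTensor C (lY.coact z) := by
      rw [← hu₁, LinearMap.lTensor_comp, LinearMap.lTensor_comp, LinearMap.comp_apply,
        LinearMap.comp_apply, hdW]
      congr 1
      exact hd z
    have h6 : δ z = l.coact (u₁ (Z.mkQ z)) - (u₁ ∘ₗ Z.mkQ).lTensor C (lY.coact z) := by
      rw [← hδQ, ← h4, ← h5]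
      exact h3
    have h7 : δ z = l.coact (g₁ z) - g₁.lTensor C (lY.coact z) := rfl
    rw [h7] at h6
    change (g₁ - u₁ ∘ₗ Z.mkQ).lTensor C (lY.coact z) = l.coact (g₁ z - u₁ (Z.mkQ z))
    rw [LinearMap.lTensor_sub, LinearMap.sub_apply, map_sub]
    rw [sub_eq_sub_iff_add_eq_add] at h6 ⊢
    rw [add_comm, ← h6, add_comm]
  · intro z hz
    change Z.mkQ z ∈ W
    rw [show Z.mkQ z = 0 from (Submodule.Quotient.mk_eq_zero Z).2 hz]
    exact zero_mem W
  · intro z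
    have h0 : Z.mkQ (z : Y) = 0 := (Submodule.Quotient.mk_eq_zero Z).2 z.2
    change g₁ z - u₁ (Z.mkQ z) = g z
    rw [h0, map_zero, sub_zero]
    exact LinearMap.congr_fun hg₁ z

/-- A comodule is injective if the cocycles on finite-dimensional comodules with values in its cobar
complex are coboundaries. -/
theorem LeftCoaction.isInjective_of_cocycles {M : Type u} [AddCommGroup M] [Module k M]
    (l : LeftCoaction k C M)
    (hM : ∀ (F : Type u) [AddCommGroup F] [Module k F] [Module.Finite k F]
      (lF : LeftCoaction k C F) (δ : F →ₗ[k] C ⊗[k] M), lF.IsCocycle l δ →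
        ∃ u : F →ₗ[k] M, ∀ y, δ y = l.coact (u y) - u.lTensor C (lF.coact y)) :
    l.IsInjective := by
  intro X Y _ _ _ _ lX lY i f hi hinj hf
  let S : Set (Y →ₗ.[k] M) := {p | ∀ z : p.domain, ∃ s,
    p.domain.subtype.lTensor C s = lY.coact z ∧ p.toFun.lTensor C s = l.coact (p z)}
  let e := LinearEquiv.ofInjective i hinj
  let p₀ : Y →ₗ.[k] M := ⟨LinearMap.range i, f ∘ₗ e.symm.toLinearMap⟩
  have he : (LinearMap.range i).subtype ∘ₗ e.toLinearMap = i := LinearMap.ext fun x => rfl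
  have he' : (f ∘ₗ e.symm.toLinearMap) ∘ₗ e.toLinearMap = f := by
    ext x
    simp
  have hp₀ : p₀ ∈ S := by
    intro z
    obtain ⟨x, rfl⟩ := e.surjective z
    refine ⟨e.toLinearMap.lTensor C (lX.coact x), ?_, ?_⟩
    · have := LinearMap.congr_fun hi x
      rw [← LinearMap.comp_apply, ← LinearMap.lTensor_comp]
      change ((LinearMap.range i).subtype ∘ₗ e.toLinearMap).lTensor C _ = _
      rw [he]
      exact this.symm
    · have := LinearMap.congr_fun hf x
      rw [← LinearMap.comp_apply, ← LinearMap.lTensor_comp]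
      change ((f ∘ₗ e.symm.toLinearMap) ∘ₗ e.toLinearMap).lTensor C _ =
        l.coact (((f ∘ₗ e.symm.toLinearMap) ∘ₗ e.toLinearMap) x)
      rw [he']
      exact this.symm
  obtain ⟨p, hp₀p, hp⟩ := zorn_le_nonempty₀ S (fun c hcS hc q hq => by
    have hdir : DirectedOn (· ≤ ·) c := hc.directedOn
    refine ⟨LinearPMap.sSup c hdir, ?_, fun z hz => LinearPMap.le_sSup hdir hz⟩
    rintro ⟨z, hz⟩
    obtain ⟨r, hr, hzr⟩ := (LinearPMap.mem_domain_sSup_iff ⟨q, hq⟩ hdir).1 hz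
    obtain ⟨s, hs, hs'⟩ := hcS hr ⟨z, hzr⟩
    have hle := LinearPMap.le_sSup hdir hr
    refine ⟨(Submodule.inclusion hle.1).lTensor C s, ?_, ?_⟩
    · rw [← LinearMap.comp_apply, ← LinearMap.lTensor_comp, Submodule.subtype_comp_inclusion]
      exact hs
    · have h1 : (LinearPMap.sSup c hdir).toFun ∘ₗ Submodule.inclusion hle.1 = r.toFun := by
        ext x
        exact LinearPMap.sSup_apply hdir hr x
      rw [← LinearMap.comp_apply, ← LinearMap.lTensor_comp, h1, hs']
      exact congrArg l.coact (LinearPMap.sSup_apply hdir hr ⟨z, hzr⟩).symm) p₀ hp₀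
  have htop : ∀ y, y ∈ p.domain := by
    intro y
    obtain ⟨Z', g', hy, hg', hle, hext⟩ := l.exists_colinear_extension lY hM hp.prop y
    have h1 : p ≤ ⟨Z', g'⟩ := ⟨hle, fun x x' hxx' => by
      rw [LinearPMap.mk_apply]
      refine (hext x).symm.trans (congrArg g' (Subtype.ext ?_))
      exact hxx'⟩
    have hmem : (⟨Z', g'⟩ : Y →ₗ.[k] M) ∈ S := hg'
    exact (hp.le_of_ge hmem h1).1 hy
  let g : Y →ₗ[k] M := p.toFun ∘ₗ LinearMap.id.codRestrict p.domain htop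
  have hgsub : g ∘ₗ p.domain.subtype = p.toFun := LinearMap.ext fun x => rfl
  refine ⟨g, LinearMap.ext fun y => ?_, LinearMap.ext fun x => ?_⟩
  · obtain ⟨s, hs, hs'⟩ := hp.prop ⟨y, htop y⟩
    change l.coact (p ⟨y, htop y⟩) = g.lTensor C (lY.coact y)
    rw [← hs', ← hs, ← LinearMap.comp_apply (g.lTensor C), ← LinearMap.lTensor_comp, hgsub]
  · have h1 := hp₀p.2 (x := ⟨i x, x, rfl⟩) (y := ⟨i x, htop _⟩) rfl
    refine h1.symm.trans ?_
    change f (e.symm (e x)) = f x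
    rw [e.symm_apply_apply]

end Injective

/-! ### Injectivity of the Hopf modules over the factor coalgebra -/

section Sharp

variable {k F P Q ι C : Type*} [Field k] [AddCommGroup F] [Module k F] [AddCommGroup P] [Module k P]
  [AddCommGroup Q] [Module k Q] [AddCommGroup C] [Module k C] [Fintype ι]

/-- The tensor of a linear map on a space with the finite basis `b`, where the space is identified
with its dual by means of the basis. -/
noncomputable def basisTensor (b : Module.Basis ι k F) : (F →ₗ[k] P) →ₗ[k] F ⊗[k] P :=
  ∑ j, TensorProduct.mk k F P (b j) ∘ₗ LinearMap.applyₗ (b j)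

variable (b : Module.Basis ι k F)

theorem basisTensor_apply (f : F →ₗ[k] P) : basisTensor b f = ∑ j, b j ⊗ₜ f (b j) := by
  simp [basisTensor]

theorem lTensor_basisTensor (g : P →ₗ[k] Q) (f : F →ₗ[k] P) :
    g.lTensor F (basisTensor b f) = basisTensor b (g ∘ₗ f) := by
  simp [basisTensor_apply]

theorem basisTensor_surjective : Function.Surjective (basisTensor (P := P) b) := by
  classical
  intro y
  induction y with
  | zero => exact ⟨0, map_zero _⟩
  | add x y hx hy =>
    obtain ⟨f, rfl⟩ := hx
    obtain ⟨g, rfl⟩ := hy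
    exact ⟨f + g, map_add _ _ _⟩
  | tmul x p =>
    refine ⟨b.constr k fun j => b.coord j x • p, ?_⟩
    rw [basisTensor_apply]
    conv_rhs => rw [← b.sum_repr x, TensorProduct.sum_tmul]
    refine Finset.sum_congr rfl fun j _ => ?_
    rw [b.constr_basis, TensorProduct.tmul_smul, TensorProduct.smul_tmul', b.coord_apply]

theorem basisTensor_injective : Function.Injective (basisTensor (P := P) b) := by
  classical
  rw [injective_iff_map_eq_zero]
  intro f hf
  refine b.ext fun j => ?_
  have h1 := congrArg (fun t => TensorProduct.lid k P ((b.coord j).rTensor P t)) hf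
  simpa [basisTensor_apply, Finsupp.single_apply] using h1

/-- The transpose of a linear map `d : F → C ⊗ F` with respect to the basis `b`. -/
noncomputable def basisTranspose (d : F →ₗ[k] C ⊗[k] F) : F →ₗ[k] F ⊗[k] C :=
  b.constr k fun i => basisTensor b (TensorProduct.rid k C ∘ₗ (b.coord i).lTensor C ∘ₗ d)

theorem rTensor_basisTranspose (d : F →ₗ[k] C ⊗[k] F) (f : F →ₗ[k] P) :
    (basisTranspose b d).rTensor P (basisTensor b f) =
      (TensorProduct.assoc k F C P).symm (basisTensor b (f.lTensor C ∘ₗ d)) := by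
  have h1 : ∀ t : C ⊗[k] F, ∑ i, TensorProduct.rid k C ((b.coord i).lTensor C t) ⊗ₜ[k] f (b i) =
      f.lTensor C t := by
    intro t
    induction t with
    | zero => simp
    | add x y hx hy => simp only [map_add, TensorProduct.add_tmul, Finset.sum_add_distrib, hx, hy]
    | tmul c x =>
      simp only [LinearMap.lTensor_tmul, TensorProduct.rid_tmul, b.coord_apply,
        TensorProduct.smul_tmul, ← TensorProduct.tmul_sum, ← map_smul, ← map_sum, b.sum_repr]
  rw [basisTensor_apply, basisTensor_apply, map_sum, map_sum]
  simp only [LinearMap.rTensor_tmul, basisTranspose, b.constr_basis, basisTensor_apply,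
    TensorProduct.sum_tmul]
  rw [Finset.sum_comm]
  refine Finset.sum_congr rfl fun j _ => ?_
  rw [LinearMap.comp_apply (f.lTensor C), ← h1, TensorProduct.tmul_sum, map_sum]
  rfl

theorem cobar_basisTensor (l : P →ₗ[k] C ⊗[k] P) (d : F →ₗ[k] C ⊗[k] F) (f : F →ₗ[k] P) :
    cobar l (basisTranspose b d) (basisTensor b f) =
      (TensorProduct.assoc k F C P).symm (basisTensor b (l ∘ₗ f - f.lTensor C ∘ₗ d)) := by
  rw [cobar_apply, lTensor_basisTensor, rTensor_basisTranspose, map_sub, map_sub]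

end Sharp

section Compatible

variable {k : Type v} {H : Type u} [Field k] [Ring H] [HopfAlgebra k H]

namespace ModuleFactorCoalgebra

variable {C : ModuleFactorCoalgebra k H}

theorem isLeftHopfModule_iff {M : Type*} [AddCommGroup M] [Module k M] [Module H M]
    [IsScalarTower k H M] {l : LeftCoaction k C.Quot M} :
    C.IsLeftHopfModule l ↔ C.IsCompatible (Algebra.lsmul k k M) l.coact := by
  have h : ∀ (g : H) (m : M), TensorProduct.map (leftAct k H C.Quot) (leftAct k H M)
      (TensorProduct.tensorTensorTensorComm k H H C.Quot M
        (TensorProduct.map Coalgebra.comul l.coact (g ⊗ₜ m))) =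
      diagAction C.action (Algebra.lsmul k k M) g (l.coact m) := by
    intro g m
    rw [TensorProduct.map_tmul]
    generalize l.coact m = t
    induction t with
    | zero => simp
    | add x y hx hy => simp only [map_add, TensorProduct.tmul_add, hx, hy]
    | tmul c d =>
      rw [diagAction_tmul]
      generalize Coalgebra.comul (R := k) g = s
      induction s with
      | zero => simp
      | add x y hx hy => simp only [map_add, TensorProduct.add_tmul, hx, hy]
      | tmul a b => simp [leftAct_tmul, action]
  constructor
  · intro H g m
    rw [← h]
    exact LinearMap.congr_fun H (g ⊗ₜ m)
  · intro H
    refine TensorProduct.ext' fun g m => ?_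
    simp only [LinearMap.comp_apply, LinearEquiv.coe_coe, h, leftAct_tmul]
    exact H g m

end ModuleFactorCoalgebra

namespace RightCoidealSubalgebra

variable {A : RightCoidealSubalgebra k H}

theorem RightHopfModulesProjective.leftHopfModulesInjective (hA : A.RightHopfModulesProjective) :
    A.toFactorCoalgebra.LeftHopfModulesInjective := by
  intro M _ _ _ _ l hl
  rw [ModuleFactorCoalgebra.isLeftHopfModule_iff] at hl
  refine l.isInjective_of_cocycles fun F _ _ _ lF δ hδ => ?_
  let b := Module.finBasis k F
  obtain ⟨y, hy⟩ := hA.exists_cobar_eq l hl (basisTranspose b lF.coact)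
    (z := (TensorProduct.assoc k F _ M).symm (basisTensor b δ)) (by
      apply (TensorProduct.assoc k _ _ M).injective
      have h1 := cobar_cofreeCoaction (basisTranspose b lF.coact)
        ((TensorProduct.assoc k F _ M).symm (basisTensor b δ))
      rw [LinearEquiv.apply_symm_apply, cobar_basisTensor] at h1
      rw [cobar_apply, map_sub, LinearEquiv.apply_symm_apply, ← h1, map_zero, sub_eq_zero]
      apply (TensorProduct.assoc k F _ _).injective
      rw [assoc_lTensor, LinearEquiv.apply_symm_apply, LinearEquiv.apply_symm_apply,
        lTensor_basisTensor]
      congr 1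
      refine LinearMap.ext fun x => ?_
      have := hδ x
      simp only [LinearMap.comp_apply, LinearMap.sub_apply]
      rw [sub_add_eq_add_sub, sub_eq_zero] at this
      rw [← this, add_sub_cancel_left])
  obtain ⟨u, rfl⟩ := basisTensor_surjective b y
  rw [cobar_basisTensor] at hy
  have := basisTensor_injective b ((TensorProduct.assoc k F _ M).symm.injective hy)
  exact ⟨u, fun y => (LinearMap.congr_fun this y).symm⟩

end RightCoidealSubalgebra

end Compatible

/-! ### Convolution with the antipode -/

section Convolution

variable {k : Type v} {H : Type u} [Field k] [Ring H] [HopfAlgebra k H] {M : Type*}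
  [AddCommGroup M] [Module k M] (α : H →ₐ[k] Module.End k M)

/-- The map `h ↦ S(h₍₁₎) g(h₍₂₎)`, the convolution product of the antipode with `g : H → M`. -/
noncomputable def antipodeConv (g : H →ₗ[k] M) : H →ₗ[k] M :=
  actionMap α ∘ₗ (HopfAlgebra.antipode k).rTensor M ∘ₗ g.lTensor H ∘ₗ Coalgebra.comul

theorem antipodeConv_apply (g : H →ₗ[k] M) (h : H) : antipodeConv α g h =
    actionMap α ((HopfAlgebra.antipode k).rTensor M (g.lTensor H (Coalgebra.comul (R := k) h))) :=
  rfl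

theorem galoisInv_lTensor_comul (g : H →ₗ[k] M) (h : H) :
    galoisInv α (g.lTensor H (Coalgebra.comul (R := k) h)) =
      (antipodeConv α g).lTensor H (Coalgebra.comul (R := k) h) := by
  have h1 : ∀ t : H ⊗[k] H, galoisInv α (g.lTensor H t) =
      (actionMap α ∘ₗ (HopfAlgebra.antipode k).rTensor M ∘ₗ g.lTensor H).lTensor H
        (TensorProduct.assoc k H H H (Coalgebra.comul.rTensor H t)) := by
    intro t
    induction t with
    | zero => simp
    | add x y hx hy => simp only [map_add, hx, hy]
    | tmul a b =>
      rw [LinearMap.lTensor_tmul, galoisInv_tmul, LinearMap.rTensor_tmul]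
      generalize Coalgebra.comul (R := k) a = s
      induction s with
      | zero => simp
      | add x y hx hy => simp only [map_add, TensorProduct.add_tmul, hx, hy]
      | tmul c d => simp
  rw [h1, Coalgebra.coassoc_apply, ← LinearMap.comp_apply, ← LinearMap.lTensor_comp]
  rfl

/-- `h₍₁₎ S(h₍₂₎) g(h₍₃₎) = g(h)`. -/
theorem actionMap_antipodeConv (g : H →ₗ[k] M) (h : H) :
    actionMap α ((antipodeConv α g).lTensor H (Coalgebra.comul (R := k) h)) = g h := by
  rw [← galoisInv_lTensor_comul, actionMap_galoisInv, rTensor_lTensor_comm,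
    Coalgebra.rTensor_counit_comul]
  simp

/-- If `g(h a) = ε(a) g(h)` for all `h`, then `a₍₁₎ S(h₍₁₎ a₍₂₎) g(h₍₂₎ a₍₃₎)` equals
`ε(a) S(h₍₁₎) g(h₍₂₎)`. -/
theorem actionMap_antipodeConv_mulLeft {g : H →ₗ[k] M} {a : H}
    (ha : ∀ h, g (h * a) = Coalgebra.counit (R := k) a • g h) (h : H) :
    actionMap α ((antipodeConv α g ∘ₗ LinearMap.mulLeft k h).lTensor H
      (Coalgebra.comul (R := k) a)) = Coalgebra.counit (R := k) a • antipodeConv α g h := by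
  have h1 : ∀ p q : H, ∀ t : H ⊗[k] H, actionMap α ((actionMap α ∘ₗ
      (HopfAlgebra.antipode k).rTensor M ∘ₗ g.lTensor H ∘ₗ LinearMap.mulLeft k (p ⊗ₜ[k] q) ∘ₗ
        Coalgebra.comul).lTensor H t) =
      actionMap α ((α (HopfAlgebra.antipode k p) ∘ₗ g ∘ₗ LinearMap.mulLeft k q).lTensor H
        ((LinearMap.mul' k H ∘ₗ (HopfAlgebra.antipode k).lTensor H).rTensor H
          ((TensorProduct.assoc k H H H).symm (Coalgebra.comul.lTensor H t)))) := by
    intro p q t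
    induction t with
    | zero => simp
    | add x y hx hy => simp only [map_add, hx, hy]
    | tmul a b =>
      simp only [LinearMap.lTensor_tmul, LinearMap.comp_apply]
      generalize Coalgebra.comul (R := k) b = s
      induction s with
      | zero => simp
      | add x y hx hy => simp only [map_add, TensorProduct.tmul_add, hx, hy]
      | tmul c d => simp [HopfAlgebra.antipode_mul_antidistrib]
  have h2 : ∀ s : H ⊗[k] H, actionMap α ((actionMap α ∘ₗ
      (HopfAlgebra.antipode k).rTensor M ∘ₗ g.lTensor H ∘ₗ LinearMap.mulLeft k s ∘ₗ
        Coalgebra.comul).lTensor H (Coalgebra.comul (R := k) a)) =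
      Coalgebra.counit (R := k) a •
        actionMap α ((HopfAlgebra.antipode k).rTensor M (g.lTensor H s)) := by
    intro s
    induction s with
    | zero => simp
    | add x y hx hy =>
      have : LinearMap.mulLeft k (x + y) = LinearMap.mulLeft k x + LinearMap.mulLeft k y := by
        ext; simp [add_mul]
      simp only [this, LinearMap.add_comp, LinearMap.comp_add, LinearMap.lTensor_add,
        LinearMap.add_apply, map_add, smul_add, hx, hy]
    | tmul p q =>
      rw [h1, Coalgebra.coassoc_symm_apply, ← LinearMap.comp_apply (LinearMap.rTensor _ _),
        ← LinearMap.rTensor_comp, LinearMap.comp_assoc, HopfAlgebra.mul_antipode_lTensor_comul,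
        LinearMap.rTensor_comp, LinearMap.comp_apply, Coalgebra.rTensor_counit_comul]
      simp [ha]
  have h3 : antipodeConv α g ∘ₗ LinearMap.mulLeft k h = actionMap α ∘ₗ
      (HopfAlgebra.antipode k).rTensor M ∘ₗ g.lTensor H ∘ₗ
        LinearMap.mulLeft k (Coalgebra.comul (R := k) h) ∘ₗ Coalgebra.comul :=
    LinearMap.ext fun b => by
      simp only [LinearMap.comp_apply, antipodeConv_apply, LinearMap.mulLeft_apply,
        Bialgebra.comul_mul]
  rw [h3, h2]
  rfl

/-- A map on `H ⊗ M` is a family of maps on `H`; `h ⊗ m ↦ S(h₍₁₎) f(h₍₂₎ ⊗ m)` is the family of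
convolution products of the antipode with these maps. -/
noncomputable def antipodeConvTensor {N : Type*} [AddCommGroup N] [Module k N]
    (f : H ⊗[k] N →ₗ[k] M) : H ⊗[k] N →ₗ[k] M :=
  actionMap α ∘ₗ (HopfAlgebra.antipode k).rTensor M ∘ₗ f.lTensor H ∘ₗ
    (TensorProduct.assoc k H H N).toLinearMap ∘ₗ Coalgebra.comul.rTensor N

theorem antipodeConvTensor_tmul {N : Type*} [AddCommGroup N] [Module k N]
    (f : H ⊗[k] N →ₗ[k] M) (h : H) (n : N) : antipodeConvTensor α f (h ⊗ₜ n) =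
      antipodeConv α (f ∘ₗ (TensorProduct.mk k H N).flip n) h := by
  simp only [antipodeConvTensor, antipodeConv_apply, LinearMap.comp_apply, LinearMap.rTensor_tmul]
  generalize Coalgebra.comul (R := k) h = t
  induction t with
  | zero => simp
  | add x y hx hy => simp only [map_add, TensorProduct.add_tmul, hx, hy]
  | tmul a b => simp

end Convolution

/-! ### Consequences of the injectivity of the Hopf modules over a factor coalgebra -/

theorem LeftCoaction.IsInjective.exists_retraction {k : Type v} {C M : Type u} [Field k]
    [AddCommGroup C] [Module k C] [Coalgebra k C] [AddCommGroup M] [Module k M]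
    {l : LeftCoaction k C M} (hl : l.IsInjective) : ∃ r : C ⊗[k] M →ₗ[k] M,
      (cofreeCoaction k C M).Colinear l r ∧ ∀ m, r (l.coact m) = m := by
  obtain ⟨r, hr, hr'⟩ := hl M (C ⊗[k] M) l (cofreeCoaction k C M) l.coact LinearMap.id l.coassoc
    l.coact_injective (by ext m; simp)
  exact ⟨r, hr, LinearMap.congr_fun hr'⟩

namespace ModuleFactorCoalgebra

variable {k : Type v} {H : Type u} [Field k] [Ring H] [HopfAlgebra k H]
  {C : ModuleFactorCoalgebra k H} {M : Type u} [AddCommGroup M] [Module k M]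
  {α : H →ₐ[k] Module.End k M}

theorem LeftHopfModulesInjective.isInjective (hC : C.LeftHopfModulesInjective)
    {l : LeftCoaction k C.Quot M} (hl : C.IsCompatible α l.coact) : l.IsInjective := by
  let _ : Module H M := Module.compHom M α.toRingHom
  have : IsScalarTower k H M := ⟨fun r h m => by
    change α (r • h) m = r • α h m
    rw [map_smul, LinearMap.smul_apply]⟩
  refine hC M l (isLeftHopfModule_iff.2 ?_)
  have : Algebra.lsmul k k M = α := rfl
  rw [this]
  exact hl

/-- If `φ : C → M` is colinear, then `S(h₍₁₎) φ(π(h₍₂₎))` is an invariant. -/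
theorem antipodeConv_mem_invariants {l : M →ₗ[k] C.Quot ⊗[k] M} (hl : C.IsCompatible α l)
    {φ : C.Quot →ₗ[k] M} (hφ : ∀ c, l (φ c) = φ.lTensor C.Quot (Coalgebra.comul (R := k) c))
    (h : H) : antipodeConv α (φ ∘ₗ C.proj) h ∈ C.invariants l := by
  obtain ⟨w, hw⟩ := galoisInv_mem_invariants hl
    (x := (φ ∘ₗ C.proj).lTensor H (Coalgebra.comul (R := k) h)) (by
      have h1 : ∀ t : H ⊗[k] H, l.lTensor H ((φ ∘ₗ C.proj).lTensor H t) =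
          (TensorProduct.map C.proj (φ ∘ₗ C.proj)).lTensor H (Coalgebra.comul.lTensor H t) := by
        intro t
        induction t with
        | zero => simp
        | add x y hx hy => simp only [map_add, hx, hy]
        | tmul a b =>
          simp only [LinearMap.lTensor_tmul, LinearMap.comp_apply, hφ, comul_proj]
          rw [← LinearMap.comp_apply, LinearMap.lTensor_comp_map]
      have h2 : ∀ t : H ⊗[k] H, TensorProduct.assoc k H C.Quot M
          ((C.proj.lTensor H ∘ₗ Coalgebra.comul (R := k)).rTensor M
            ((φ ∘ₗ C.proj).lTensor H t)) =
          (TensorProduct.map C.proj (φ ∘ₗ C.proj)).lTensor H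
            (TensorProduct.assoc k H H H (Coalgebra.comul.rTensor H t)) := by
        intro t
        induction t with
        | zero => simp
        | add x y hx hy => simp only [map_add, hx, hy]
        | tmul a b =>
          simp only [LinearMap.lTensor_tmul, LinearMap.comp_apply, LinearMap.rTensor_tmul]
          generalize Coalgebra.comul (R := k) a = s
          induction s with
          | zero => simp
          | add x y hx hy => simp only [map_add, TensorProduct.add_tmul, hx, hy]
          | tmul c d => simp
      rw [h1, h2, Coalgebra.coassoc_apply])
  rw [galoisInv_lTensor_comul] at hw
  have h3 := congrArg (fun x => TensorProduct.lid k M ((Coalgebra.counit (R := k)).rTensor M x)) hw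
  rw [rTensor_lTensor_comm, rTensor_lTensor_comm, Coalgebra.rTensor_counit_comul,
    LinearMap.lTensor_tmul, TensorProduct.lid_tmul, one_smul] at h3
  rw [← h3]
  generalize (Coalgebra.counit (R := k)).rTensor _ w = t
  clear h3 hw
  induction t with
  | zero => simp
  | add x y hx hy =>
    rw [map_add, map_add]
    exact add_mem hx hy
  | tmul r v =>
    rw [LinearMap.lTensor_tmul, TensorProduct.lid_tmul]
    exact Submodule.smul_mem _ _ v.2

theorem colinear_cofree_apply {l : LeftCoaction k C.Quot M} {r : C.Quot ⊗[k] M →ₗ[k] M}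
    (hr : (cofreeCoaction k C.Quot M).Colinear l r) (m : M) (c : C.Quot) :
    l.coact ((r ∘ₗ (TensorProduct.mk k C.Quot M).flip m) c) =
      (r ∘ₗ (TensorProduct.mk k C.Quot M).flip m).lTensor C.Quot (Coalgebra.comul (R := k) c) := by
  refine (LinearMap.congr_fun hr (c ⊗ₜ m)).trans ?_
  rw [LinearMap.comp_apply, cofreeCoaction_tmul]
  generalize Coalgebra.comul (R := k) c = s
  induction s with
  | zero => simp
  | add x y hx hy => simp only [map_add, TensorProduct.add_tmul, hx, hy]
  | tmul a b => simp

variable (C) in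
/-- The map `h ⊗ m ↦ S(h₍₁₎) r(π(h₍₂₎) ⊗ m)` attached to `r : C ⊗ M → M`. -/
noncomputable def integral (α : H →ₐ[k] Module.End k M) (r : C.Quot ⊗[k] M →ₗ[k] M) :
    H ⊗[k] M →ₗ[k] M :=
  antipodeConvTensor α (r ∘ₗ C.proj.rTensor M)

theorem integral_tmul (r : C.Quot ⊗[k] M →ₗ[k] M) (h : H) (m : M) :
    C.integral α r (h ⊗ₜ m) =
      antipodeConv α ((r ∘ₗ (TensorProduct.mk k C.Quot M).flip m) ∘ₗ C.proj) h :=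
  antipodeConvTensor_tmul _ _ _ _

theorem integral_mem_invariants {l : LeftCoaction k C.Quot M} (hl : C.IsCompatible α l.coact)
    {r : C.Quot ⊗[k] M →ₗ[k] M} (hr : (cofreeCoaction k C.Quot M).Colinear l r) (x : H ⊗[k] M) :
    C.integral α r x ∈ C.invariants l.coact := by
  induction x with
  | zero => simp
  | add x y hx hy =>
    rw [map_add]
    exact add_mem hx hy
  | tmul h m =>
    rw [integral_tmul]
    exact antipodeConv_mem_invariants hl (colinear_cofree_apply hr m) h

/-- If all objects of `_H^C M` are injective comodules, they are generated by their invariants. -/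
theorem LeftHopfModulesInjective.exists_actionMap_eq (hC : C.LeftHopfModulesInjective)
    {l : LeftCoaction k C.Quot M} (hl : C.IsCompatible α l.coact) (m : M) :
    ∃ w, actionMap α ((C.invariants l.coact).subtype.lTensor H w) = m := by
  obtain ⟨r, hr, hr'⟩ := (hC.isInjective hl).exists_retraction
  have h1 : ∀ t : C.Quot ⊗[k] M, ∃ w,
      actionMap α ((C.invariants l.coact).subtype.lTensor H w) = r t := by
    intro t
    induction t with
    | zero => exact ⟨0, by simp⟩
    | add x y hx hy =>
      obtain ⟨v, hv⟩ := hx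
      obtain ⟨w, hw⟩ := hy
      exact ⟨v + w, by rw [map_add, map_add, map_add, hv, hw]⟩
    | tmul c m =>
      obtain ⟨h, rfl⟩ := C.proj_surjective c
      refine ⟨((antipodeConv α ((r ∘ₗ (TensorProduct.mk k C.Quot M).flip m) ∘ₗ
        C.proj)).codRestrict (C.invariants l.coact) fun h =>
          antipodeConv_mem_invariants hl (colinear_cofree_apply hr m) h).lTensor H
            (Coalgebra.comul (R := k) h), ?_⟩
      rw [← LinearMap.comp_apply (LinearMap.lTensor _ _), ← LinearMap.lTensor_comp,
        LinearMap.subtype_comp_codRestrict,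
        actionMap_antipodeConv]
      rfl
  obtain ⟨w, hw⟩ := h1 (l.coact m)
  exact ⟨w, hw.trans (hr' m)⟩

/-- A subspace that is stable under the action and the coaction is an object of `_H^C M`. -/
theorem IsCompatible.exists_restrict {l : LeftCoaction k C.Quot M} (hl : C.IsCompatible α l.coact)
    (K : Submodule k M) (hK : ∀ h, ∀ m ∈ K, α h m ∈ K)
    (hK' : ∀ m ∈ K, l.coact m ∈ LinearMap.range (K.subtype.lTensor C.Quot)) :
    ∃ (β : H →ₐ[k] Module.End k K) (lK : LeftCoaction k C.Quot K), C.IsCompatible β lK.coact ∧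
      (∀ h (m : K), (β h m : M) = α h m) ∧
        ∀ m : K, K.subtype.lTensor C.Quot (lK.coact m) = l.coact m := by
  let β : H →ₐ[k] Module.End k K := AlgHom.ofLinearMap
    { toFun := fun h => (α h).restrict (hK h)
      map_add' := fun g h => by ext; simp
      map_smul' := fun r h => by ext; simp }
    (by ext; simp) (fun g h => by ext; simp)
  obtain ⟨d, hd⟩ : ∃ d : K →ₗ[k] C.Quot ⊗[k] K,
      ∀ m : K, K.subtype.lTensor C.Quot (d m) = l.coact m := by
    refine ⟨(LinearEquiv.ofInjective (K.subtype.lTensor C.Quot)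
      (lTensor_injective K.injective_subtype)).symm.toLinearMap ∘ₗ
        (l.coact ∘ₗ K.subtype).codRestrict _ (fun w => hK' w w.2), fun w => ?_⟩
    have h := LinearEquiv.apply_symm_apply (LinearEquiv.ofInjective (K.subtype.lTensor C.Quot)
      (lTensor_injective K.injective_subtype))
      ((l.coact ∘ₗ K.subtype).codRestrict _ (fun w => hK' w w.2) w)
    exact congrArg Subtype.val h
  refine ⟨β, l.ofInjective K.subtype K.injective_subtype d hd, fun h m => ?_, fun _ _ => rfl, hd⟩
  apply lTensor_injective K.injective_subtype
  change K.subtype.lTensor C.Quot (d (β h m)) = K.subtype.lTensor C.Quot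
    (diagAction C.action β h (d m))
  rw [hd]
  change l.coact (α h m) = _
  rw [hl, ← hd]
  generalize d m = t
  induction t with
  | zero => simp
  | add x y hx hy => simp only [map_add, hx, hy]
  | tmul c m =>
    rw [LinearMap.lTensor_tmul, diagAction_tmul, diagAction_tmul,
      ← LinearMap.comp_apply (LinearMap.lTensor _ _), LinearMap.lTensor_comp_map]
    rfl

/-- If all objects of `_H^C M` are injective comodules, the kernel of `H → C` is generated by
invariant elements, on which the counit vanishes. -/
theorem LeftHopfModulesInjective.toFactorCoalgebra_toCoidealSubalgebra
    (hC : C.LeftHopfModulesInjective) : C.toCoidealSubalgebra.toFactorCoalgebra = C := by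
  refine ModuleFactorCoalgebra.ext (le_antisymm (Ideal.span_le.2 ?_) fun x hx => ?_)
  · rintro a ⟨ha, ha0⟩
    have h1 : C.leftCoactH a = C.proj 1 ⊗ₜ a := ha
    have h2 : ∀ t : H ⊗[k] H, TensorProduct.rid k _ ((Coalgebra.counit (R := k)).lTensor C.Quot
        (C.proj.rTensor H t)) =
        C.proj (TensorProduct.rid k H ((Coalgebra.counit (R := k)).lTensor H t)) := by
      intro t
      induction t with
      | zero => simp
      | add x y hx hy => simp only [map_add, hx, hy]
      | tmul a b => simp
    have h3 := h2 (Coalgebra.comul (R := k) a)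
    rw [Coalgebra.lTensor_counit_comul] at h3
    change TensorProduct.rid k _ ((Coalgebra.counit (R := k)).lTensor C.Quot (C.leftCoactH a)) = _
      at h3
    rw [h1, LinearMap.lTensor_tmul, ha0, TensorProduct.tmul_zero, map_zero, TensorProduct.rid_tmul,
      one_smul] at h3
    exact (C.proj_eq_zero_iff a).1 h3.symm
  · let K := C.ideal.restrictScalars k
    obtain ⟨β, lK, hlK, hβ, hlK'⟩ := IsCompatible.exists_restrict (l := C.coactionH)
      C.leftCoactH_isCompatible K (fun h m hm => C.ideal.mul_mem_left h hm) (fun m hm => by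
        have hex : LinearMap.ker C.proj = K := by
          ext y
          exact C.proj_eq_zero_iff y
        rw [← hex]
        refine mem_range_lTensor_ker _ ?_
        change C.proj.lTensor _ (C.proj.rTensor H (Coalgebra.comul (R := k) m)) = 0
        rw [← LinearMap.comp_apply, LinearMap.lTensor_comp_rTensor, ← comul_proj,
          (C.proj_eq_zero_iff m).2 hm, map_zero])
    obtain ⟨w, hw⟩ := hC.exists_actionMap_eq hlK ⟨x, hx⟩
    have h1 : ∀ w, ((actionMap β ((C.invariants lK.coact).subtype.lTensor H w) : K) : H) ∈
        C.toCoidealSubalgebra.augIdeal := by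
      intro w
      induction w with
      | zero => simp
      | add x y hx hy =>
        rw [map_add, map_add]
        exact add_mem hx hy
      | tmul h v =>
        have h2 : C.leftCoactH (v : K) = C.proj 1 ⊗ₜ ((v : K) : H) := by
          have h3 := mem_invariants.1 v.2
          have h4 := hlK' v
          rw [h3] at h4
          exact h4.symm
        have h5 : Coalgebra.counit (R := k) ((v : K) : H) = 0 := by
          rw [← C.counit_proj, (C.proj_eq_zero_iff _).2 (v : K).2, map_zero]
        rw [LinearMap.lTensor_tmul]
        change ((β h (v : K) : K) : H) ∈ _
        rw [hβ]
        exact Ideal.mul_mem_left _ h (Ideal.subset_span ⟨h2, h5⟩)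
    have h2 := h1 w
    rw [hw] at h2
    exact h2

end ModuleFactorCoalgebra

/-! ### Finite products of comodules -/

section Pi

variable {k : Type*} [Field k] {ι P Q : Type*} [Fintype ι] [DecidableEq ι] [AddCommGroup P]
  [Module k P] [AddCommGroup Q] [Module k Q]

theorem sum_lTensor_single_proj (t : P ⊗[k] (ι → Q)) :
    ∑ i, (LinearMap.single k (fun _ : ι => Q) i).lTensor P
      ((LinearMap.proj (R := k) (φ := fun _ : ι => Q) i).lTensor P t) = t := by
  induction t with
  | zero => simp
  | add x y hx hy => simp only [map_add, Finset.sum_add_distrib, hx, hy]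
  | tmul p x =>
    simp only [LinearMap.lTensor_tmul, ← TensorProduct.tmul_sum, LinearMap.proj_apply,
      LinearMap.coe_single, Finset.univ_sum_single]

theorem lTensor_proj_sum_single (x : ι → P ⊗[k] Q) (i : ι) :
    (LinearMap.proj (R := k) (φ := fun _ : ι => Q) i).lTensor P
      (∑ j, (LinearMap.single k (fun _ : ι => Q) j).lTensor P (x j)) = x i := by
  rw [map_sum, Finset.sum_eq_single i]
  · rw [← LinearMap.comp_apply, ← LinearMap.lTensor_comp, LinearMap.proj_comp_single_same,
      LinearMap.lTensor_id, LinearMap.id_apply]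
  · intro j _ hj
    rw [← LinearMap.comp_apply, ← LinearMap.lTensor_comp,
      LinearMap.proj_comp_single_ne _ _ _ _ hj.symm, LinearMap.lTensor_zero, LinearMap.zero_apply]
  · simp

theorem ext_lTensor_proj {s t : P ⊗[k] (ι → Q)}
    (h : ∀ i, (LinearMap.proj (R := k) (φ := fun _ : ι => Q) i).lTensor P s =
      (LinearMap.proj (R := k) (φ := fun _ : ι => Q) i).lTensor P t) : s = t := by
  rw [← sum_lTensor_single_proj s, ← sum_lTensor_single_proj t]
  simp only [h]

variable {C : Type*} [AddCommGroup C] [Module k C]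

theorem ext_lTensor_lTensor_proj {s t : P ⊗[k] (C ⊗[k] (ι → Q))}
    (h : ∀ i, ((LinearMap.proj (R := k) (φ := fun _ : ι => Q) i).lTensor C).lTensor P s =
      ((LinearMap.proj (R := k) (φ := fun _ : ι => Q) i).lTensor C).lTensor P t) : s = t := by
  apply (TensorProduct.assoc k P C (ι → Q)).symm.injective
  refine ext_lTensor_proj fun i => ?_
  apply (TensorProduct.assoc k P C Q).injective
  rw [assoc_lTensor, assoc_lTensor, LinearEquiv.apply_symm_apply, LinearEquiv.apply_symm_apply, h]

variable [Coalgebra k C]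

theorem LeftCoaction.exists_pi (l : LeftCoaction k C Q) (ι : Type*) [Fintype ι] [DecidableEq ι] :
    ∃ lE : LeftCoaction k C (ι → Q), ∀ x i,
      (LinearMap.proj (R := k) (φ := fun _ : ι => Q) i).lTensor C (lE.coact x) = l.coact (x i) := by
  obtain ⟨d, hd⟩ : ∃ d : (ι → Q) →ₗ[k] C ⊗[k] (ι → Q), ∀ x i,
      (LinearMap.proj (R := k) (φ := fun _ : ι => Q) i).lTensor C (d x) = l.coact (x i) := by
    refine ⟨∑ j, (LinearMap.single k (fun _ : ι => Q) j).lTensor C ∘ₗ l.coact ∘ₗ LinearMap.proj j,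
      fun x i => ?_⟩
    rw [LinearMap.sum_apply]
    exact lTensor_proj_sum_single (fun j => l.coact (x j)) i
  refine ⟨⟨d, ?_, ?_⟩, hd⟩
  · refine LinearMap.ext fun x => ext_lTensor_lTensor_proj fun i => ?_
    have h1 : (LinearMap.proj (R := k) (φ := fun _ : ι => Q) i).lTensor C ∘ₗ d =
        l.coact ∘ₗ LinearMap.proj i := LinearMap.ext fun x => hd x i
    simp only [LinearMap.comp_apply, LinearEquiv.coe_coe]
    rw [← assoc_lTensor, ← rTensor_lTensor_comm, hd, l.coassoc_apply,
      ← LinearMap.comp_apply (LinearMap.lTensor _ _) (LinearMap.lTensor _ _),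
      ← LinearMap.lTensor_comp, h1, LinearMap.lTensor_comp, LinearMap.comp_apply, hd]
  · refine LinearMap.ext fun x => funext fun i => ?_
    have h1 : ∀ t : C ⊗[k] (ι → Q), TensorProduct.lid k (ι → Q)
        ((Coalgebra.counit (R := k)).rTensor _ t) i = TensorProduct.lid k Q
          ((Coalgebra.counit (R := k)).rTensor Q (LinearMap.lTensor C
            (LinearMap.proj (R := k) (φ := fun _ : ι => Q) i) t)) := by
      intro t
      induction t with
      | zero => simp
      | add x y hx hy => simp only [map_add, Pi.add_apply, hx, hy]
      | tmul c x => simp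
    refine (h1 (d x)).trans ?_
    rw [hd, l.counit_apply]
    rfl

end Pi

/-! ### Reduction of Hopf modules modulo the augmentation ideal -/

namespace RightCoidealSubalgebra

variable {k : Type v} {H : Type u} [Field k] [Ring H] [HopfAlgebra k H]
  {A : RightCoidealSubalgebra k H} {N : Type*} [AddCommGroup N] [Module k N] [Module A.algᵐᵒᵖ N]

variable (A N) in
/-- The subspace `N A⁺` of a right `A`-module `N`. -/
def augSubmodule : Submodule k N :=
  Submodule.span k {x | ∃ (a : A.alg) (n : N), Coalgebra.counit (R := k) (a : H) = 0 ∧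
    x = MulOpposite.op a • n}

/-- A map that transforms the action of `A` into the trivial action vanishes on `N A⁺`. -/
theorem eq_zero_of_mem_augSubmodule {P : Type*} [AddCommGroup P] [Module k P] {g : N →ₗ[k] P}
    (hg : ∀ (a : A.alg) (n : N), g (MulOpposite.op a • n) = Coalgebra.counit (R := k) (a : H) • g n)
    {n : N} (hn : n ∈ A.augSubmodule N) : g n = 0 := by
  refine Submodule.span_induction (p := fun n _ => g n = 0) ?_ (map_zero g)
    (fun x y _ _ hx hy => by rw [map_add, hx, hy, add_zero])
    (fun r x _ hx => by rw [map_smul, hx, smul_zero]) hn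
  rintro _ ⟨a, n, ha, rfl⟩
  rw [hg, ha, zero_smul]

variable [IsScalarTower k A.algᵐᵒᵖ N]

theorem mkQ_augSubmodule_smul (a : A.alg) (n : N) :
    (A.augSubmodule N).mkQ (MulOpposite.op a • n) =
      Coalgebra.counit (R := k) (a : H) • (A.augSubmodule N).mkQ n := by
  rw [← map_smul, ← sub_eq_zero, ← map_sub]
  refine (Submodule.Quotient.mk_eq_zero _).2 (Submodule.subset_span
    ⟨a - algebraMap k A.alg (Coalgebra.counit (R := k) (a : H)), n, ?_, ?_⟩)
  · simp
  · rw [MulOpposite.op_sub, sub_smul]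
    congr 1
    rw [show MulOpposite.op (algebraMap k A.alg (Coalgebra.counit (R := k) (a : H))) =
      algebraMap k A.algᵐᵒᵖ (Coalgebra.counit (R := k) (a : H)) from rfl, algebraMap_smul]

/-- The map `N → N/NA⁺ ⊗ H` induced by the coaction. -/
noncomputable def reducedCoaction (A : RightCoidealSubalgebra k H) [Module A.algᵐᵒᵖ N]
    (ρ : RightCoaction k H N) :
    N →ₗ[k] (N ⧸ A.augSubmodule N) ⊗[k] H :=
  (A.augSubmodule N).mkQ.rTensor H ∘ₗ ρ.coact

variable {ρ : RightCoaction k H N}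

theorem reducedCoaction_smul (hρ : A.IsRightHopfModule ρ) (a : A.alg) (n : N) :
    A.reducedCoaction ρ (MulOpposite.op a • n) =
      (LinearMap.mulRight k (a : H)).lTensor _ (A.reducedCoaction ρ n) := by
  have h1 : ∀ (s : A.alg ⊗[k] H) (t : N ⊗[k] H),
      (A.augSubmodule N).mkQ.rTensor H (A.tensorRightAct N s t) =
        (LinearMap.mulRight k (TensorProduct.lid k H ((Coalgebra.counit (R := k)).rTensor H
          (A.incl s)))).lTensor _ ((A.augSubmodule N).mkQ.rTensor H t) := by
    intro s t
    induction t with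
    | zero => simp
    | add x y hx hy => simp only [map_add, hx, hy]
    | tmul n h =>
      induction s with
      | zero => simp
      | add x y hx hy =>
        rw [map_add, LinearMap.add_apply, map_add, hx, hy]
        simp only [map_add, LinearMap.rTensor_tmul, LinearMap.lTensor_tmul,
          LinearMap.mulRight_apply, mul_add, TensorProduct.tmul_add]
      | tmul a g =>
        simp only [tensorRightAct_tmul, LinearMap.rTensor_tmul, LinearMap.lTensor_tmul,
          mkQ_augSubmodule_smul, incl, LinearMap.mulRight_apply]
        simp [TensorProduct.smul_tmul]
  rw [reducedCoaction, LinearMap.comp_apply, isRightHopfModule_iff.1 hρ, h1, A.incl_coaction,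
    Coalgebra.rTensor_counit_comul]
  simp

theorem rightAct_lTensor_coact_smul (hρ : A.IsRightHopfModule ρ) {θ : H →ₗ[k] A.alg} {a : A.alg}
    (hθ : ∀ y, LinearMap.mul' k A.alg ((θ ∘ₗ LinearMap.mulLeft k y).lTensor A.alg (A.coaction a)) =
      Coalgebra.counit (R := k) (a : H) • θ y) (n : N) :
    rightAct k A.alg N (θ.lTensor N (ρ.coact (MulOpposite.op a • n))) =
      Coalgebra.counit (R := k) (a : H) • rightAct k A.alg N (θ.lTensor N (ρ.coact n)) := by
  have h1 : ∀ t : N ⊗[k] H, rightAct k A.alg N (θ.lTensor N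
      (A.tensorRightAct N (A.coaction a) t)) =
      Coalgebra.counit (R := k) (a : H) • rightAct k A.alg N (θ.lTensor N t) := by
    intro t
    induction t with
    | zero => simp
    | add x y hx hy => simp only [map_add, smul_add, hx, hy]
    | tmul n y =>
      have h2 : ∀ s : A.alg ⊗[k] H, rightAct k A.alg N (θ.lTensor N
          (A.tensorRightAct N s (n ⊗ₜ y))) = rightAct k A.alg N (n ⊗ₜ
            LinearMap.mul' k A.alg ((θ ∘ₗ LinearMap.mulLeft k y).lTensor A.alg s)) := by
        intro s
        induction s with
        | zero => simp
        | add x y hx hy =>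
          simp only [map_add, LinearMap.add_apply, TensorProduct.tmul_add, hx, hy]
        | tmul b g => simp [rightAct_tmul, mul_smul]
      rw [h2, hθ, TensorProduct.tmul_smul, map_smul, LinearMap.lTensor_tmul]
  rw [isRightHopfModule_iff.1 hρ, h1]

/-- The reduced coaction of `n₍₀₎ θ(n₍₁₎)` is `n₍₀₎ ⊗ n₍₁₎ θ(n₍₂₎)`. -/
theorem reducedCoaction_rightAct (hρ : A.IsRightHopfModule ρ) {θ : H →ₗ[k] A.alg} {g : H →ₗ[k] H}
    (hg : ∀ y, LinearMap.mul' k H ((A.alg.val.toLinearMap ∘ₗ θ).lTensor H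
      (Coalgebra.comul (R := k) y)) = g y) (n : N) :
    A.reducedCoaction ρ (rightAct k A.alg N (θ.lTensor N (ρ.coact n))) =
      g.lTensor _ (A.reducedCoaction ρ n) := by
  have h1 : ∀ x : N ⊗[k] H, A.reducedCoaction ρ (rightAct k A.alg N (θ.lTensor N x)) =
      (LinearMap.mul' k H ∘ₗ (A.alg.val.toLinearMap ∘ₗ θ).lTensor H).lTensor _
        ((A.augSubmodule N).mkQ.rTensor _
          (TensorProduct.assoc k N H H (ρ.coact.rTensor H x))) := by
    intro x
    induction x with
    | zero => simp
    | add x y hx hy => simp only [map_add, hx, hy]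
    | tmul n y =>
      rw [LinearMap.lTensor_tmul, rightAct_tmul, reducedCoaction_smul hρ, reducedCoaction,
        LinearMap.comp_apply, LinearMap.rTensor_tmul]
      generalize ρ.coact n = t
      induction t with
      | zero => simp
      | add x y hx hy => simp only [map_add, TensorProduct.add_tmul, hx, hy]
      | tmul a b => simp
  have h2 : g = LinearMap.mul' k H ∘ₗ (A.alg.val.toLinearMap ∘ₗ θ).lTensor H ∘ₗ
      Coalgebra.comul := LinearMap.ext fun y => (hg y).symm
  rw [h1, ρ.coassoc_apply, rTensor_lTensor_comm,
    ← LinearMap.comp_apply (LinearMap.lTensor _ _) (LinearMap.lTensor _ _),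
    ← LinearMap.lTensor_comp, LinearMap.comp_assoc, ← h2]
  rfl

variable {C : ModuleFactorCoalgebra k H}

theorem proj_mul_of_mem (hC : A.augIdeal ≤ C.ideal) {a : H} (ha : a ∈ A.alg) (h : H) :
    C.proj (h * a) = Coalgebra.counit (R := k) a • C.proj h := by
  rw [C.proj_mul, proj_of_mem hC ha, smul_comm, ← C.proj_mul, mul_one]

/-- For a Hopf module `N`, the quotient `X = N/NA⁺` has a coaction of `C`, and the reduced coaction
has values in the cotensor product of `X` and `H`. -/
theorem exists_coaction_quotient (hC : A.augIdeal ≤ C.ideal) (hρ : A.IsRightHopfModule ρ) :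
    ∃ d : (N ⧸ A.augSubmodule N) →ₗ[k] (N ⧸ A.augSubmodule N) ⊗[k] C.Quot,
      (∀ n, d ((A.augSubmodule N).mkQ n) = C.proj.lTensor _ (A.reducedCoaction ρ n)) ∧
      ∀ n, TensorProduct.assoc k _ _ _ (d.rTensor H (A.reducedCoaction ρ n)) =
        C.leftCoactH.lTensor _ (A.reducedCoaction ρ n) := by
  obtain ⟨d, hd⟩ := exists_comp_eq_of_ker_le (q := (A.augSubmodule N).mkQ)
    (A.augSubmodule N).mkQ_surjective (g := C.proj.lTensor _ ∘ₗ A.reducedCoaction ρ)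
    (fun n hn => eq_zero_of_mem_augSubmodule (fun a n => by
      have h1 : C.proj ∘ₗ LinearMap.mulRight k (a : H) =
          Coalgebra.counit (R := k) (a : H) • C.proj :=
        LinearMap.ext fun y => proj_mul_of_mem hC a.2 y
      rw [LinearMap.comp_apply, reducedCoaction_smul hρ, ← LinearMap.comp_apply,
        ← LinearMap.lTensor_comp, h1, LinearMap.lTensor_smul]
      rfl) ((Submodule.Quotient.mk_eq_zero _).1 hn))
  refine ⟨d, hd, fun n => ?_⟩
  have h1 : d ∘ₗ (A.augSubmodule N).mkQ = C.proj.lTensor _ ∘ₗ (A.augSubmodule N).mkQ.rTensor H ∘ₗ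
      ρ.coact := LinearMap.ext hd
  rw [reducedCoaction, LinearMap.comp_apply, ← LinearMap.comp_apply (d.rTensor H),
    ← LinearMap.rTensor_comp, h1, LinearMap.rTensor_comp, LinearMap.rTensor_comp,
    LinearMap.comp_apply, LinearMap.comp_apply, assoc_rTensor_lTensor, assoc_rTensor_rTensor,
    ρ.coassoc_apply, rTensor_lTensor_comm, ← LinearMap.comp_apply (LinearMap.lTensor _ _),
    ← LinearMap.lTensor_comp]
  rfl

/-- If `C` satisfies the injectivity condition, the reduced coaction of a Hopf module over the
algebra of invariants is injective: `n` is recovered from it as `n₍₀₎ S(n₍₁₎) r(π(n₍₂₎) ⊗ n₍₃₎)`,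
where `r : C ⊗ H → H` is a colinear retraction of the coaction. -/
theorem reducedCoaction_injective (hinj : C.LeftHopfModulesInjective) (hC : A.augIdeal ≤ C.ideal)
    (hCA : ∀ h, C.leftCoactH h = C.proj 1 ⊗ₜ[k] h → h ∈ A.alg) (hρ : A.IsRightHopfModule ρ) :
    Function.Injective (A.reducedCoaction ρ) := by
  obtain ⟨r, hr, hr'⟩ :=
    (hinj.isInjective (l := C.coactionH) C.leftCoactH_isCompatible).exists_retraction
  obtain ⟨Θ, hΘ⟩ : ∃ Θ : H ⊗[k] H →ₗ[k] A.alg, ∀ x,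
      (Θ x : H) = C.integral (Algebra.lmul k H) r x :=
    ⟨(C.integral (Algebra.lmul k H) r).codRestrict (Subalgebra.toSubmodule A.alg) fun x =>
      hCA _ (ModuleFactorCoalgebra.mem_invariants.1
        (ModuleFactorCoalgebra.integral_mem_invariants C.leftCoactH_isCompatible hr x)),
      fun x => rfl⟩
  let G : N ⊗[k] H →ₗ[k] N := rightAct k A.alg N ∘ₗ Θ.lTensor N ∘ₗ
    (TensorProduct.assoc k N H H).toLinearMap ∘ₗ ρ.coact.rTensor H
  have hG : ∀ n h, G (n ⊗ₜ h) = rightAct k A.alg N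
      ((Θ ∘ₗ (TensorProduct.mk k H H).flip h).lTensor N (ρ.coact n)) := by
    intro n h
    simp only [G, LinearMap.comp_apply, LinearMap.rTensor_tmul]
    generalize ρ.coact n = t
    induction t with
    | zero => simp
    | add x y hx hy => simp only [map_add, TensorProduct.add_tmul, hx, hy]
    | tmul a b => simp
  have hG0 : ∀ (a : A.alg) (n : N) (h : H), G ((MulOpposite.op a • n) ⊗ₜ h) =
      Coalgebra.counit (R := k) (a : H) • G (n ⊗ₜ h) := by
    intro a n h
    rw [hG, hG, rightAct_lTensor_coact_smul hρ]
    intro y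
    apply Subtype.val_injective
    have h1 : ∀ t : A.alg ⊗[k] H, ((LinearMap.mul' k A.alg
        ((((Θ ∘ₗ (TensorProduct.mk k H H).flip h)) ∘ₗ LinearMap.mulLeft k y).lTensor A.alg t) :
          A.alg) : H) = actionMap (Algebra.lmul k H) ((antipodeConv (Algebra.lmul k H)
            ((r ∘ₗ (TensorProduct.mk k C.Quot H).flip h) ∘ₗ C.proj) ∘ₗ
              LinearMap.mulLeft k y).lTensor H (A.incl t)) := by
      intro t
      induction t with
      | zero => simp
      | add x y hx hy => simp only [map_add, Subalgebra.coe_add, hx, hy]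
      | tmul b g => simp [incl, hΘ, ModuleFactorCoalgebra.integral_tmul]
    rw [h1, A.incl_coaction, actionMap_antipodeConv_mulLeft]
    · simp [hΘ, ModuleFactorCoalgebra.integral_tmul]
    · intro x
      rw [LinearMap.comp_apply, proj_mul_of_mem hC a.2, map_smul]
      rfl
  have hG1 : ∀ n, G (ρ.coact n) = n := by
    intro n
    have h1 : Θ ∘ₗ Coalgebra.comul = Algebra.linearMap k A.alg ∘ₗ Coalgebra.counit := by
      refine LinearMap.ext fun y => Subtype.val_injective ?_
      have h2 : (r ∘ₗ C.proj.rTensor H) ∘ₗ Coalgebra.comul = LinearMap.id :=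
        LinearMap.ext hr'
      simp only [LinearMap.comp_apply, hΘ, ModuleFactorCoalgebra.integral, antipodeConvTensor,
        LinearEquiv.coe_coe]
      rw [Coalgebra.coassoc_apply, ← LinearMap.comp_apply (LinearMap.lTensor _ _),
        ← LinearMap.lTensor_comp, h2, LinearMap.lTensor_id, LinearMap.id_apply]
      exact HopfAlgebra.mul_antipode_rTensor_comul_apply y
    simp only [G, LinearMap.comp_apply, LinearEquiv.coe_coe]
    rw [ρ.coassoc_apply, ← LinearMap.comp_apply (LinearMap.lTensor _ _),
      ← LinearMap.lTensor_comp, h1]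
    conv_rhs => rw [← ρ.counit_apply n]
    generalize ρ.coact n = t
    induction t with
    | zero => simp
    | add x y hx hy => simp only [map_add, hx, hy]
    | tmul a b =>
      simp only [LinearMap.lTensor_tmul, rightAct_tmul, LinearMap.comp_apply,
        Algebra.linearMap_apply, TensorProduct.rid_tmul]
      change algebraMap k A.algᵐᵒᵖ (Coalgebra.counit b) • a = _
      rw [algebraMap_smul]
  rw [injective_iff_map_eq_zero]
  intro n hn
  obtain ⟨x, hx⟩ : ρ.coact n ∈ LinearMap.range ((A.augSubmodule N).subtype.rTensor H) :=
    mem_range_rTensor_subtype _ hn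
  rw [← hG1 n, ← hx]
  clear hx
  induction x with
  | zero => simp
  | add x y hx hy => rw [map_add, map_add, hx, hy, add_zero]
  | tmul b h =>
    exact eq_zero_of_mem_augSubmodule (g := G ∘ₗ (TensorProduct.mk k N H).flip h)
      (fun a n => hG0 a n h) b.2

end RightCoidealSubalgebra

/-! ### Projectivity of the Hopf modules over the algebra of invariants -/

namespace RightCoidealSubalgebra

variable {k : Type v} {H : Type u} [Field k] [Ring H] [HopfAlgebra k H]
  {A : RightCoidealSubalgebra k H} {N : Type*} [AddCommGroup N] [Module k N] [Module A.algᵐᵒᵖ N]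
  [IsScalarTower k A.algᵐᵒᵖ N] {ρ : RightCoaction k H N} {C : ModuleFactorCoalgebra k H}

/-- The space of all `x ∈ Hⁿ` that satisfy the equations `∑ xᵢ aᵢ = 0` with `(aᵢ)` in a given
set. -/
def solutions (A : RightCoidealSubalgebra k H) {ι : Type*} [Fintype ι] (R : Set (ι → A.algᵐᵒᵖ)) :
    Submodule k (ι → H) where
  carrier := {x | ∀ c ∈ R, ∑ i, x i * (c i).unop = 0}
  add_mem' {x y} hx hy c hc := by
    simp only [Pi.add_apply, add_mul, Finset.sum_add_distrib, hx c hc, hy c hc, add_zero]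
  zero_mem' c hc := by simp
  smul_mem' r x hx c hc := by
    simp only [Pi.smul_apply, smul_mul_assoc, ← Finset.smul_sum, hx c hc, smul_zero]

theorem mem_range_lTensor_solutions {ι : Type*} [Fintype ι] [DecidableEq ι]
    {R : Set (ι → A.algᵐᵒᵖ)} {X : Type*} [AddCommGroup X] [Module k X] {z : X ⊗[k] (ι → H)}
    (hz : ∀ c ∈ R, ∑ i, (LinearMap.mulRight k ((c i).unop : H)).lTensor X
      ((LinearMap.proj (R := k) (φ := fun _ : ι => H) i).lTensor X z) = 0) :
    z ∈ LinearMap.range ((A.solutions R).subtype.lTensor X) := by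
  refine mem_range_lTensor_of_rTensor_mem _ fun ξ c hc => ?_
  have h1 : ∀ t : X ⊗[k] (ι → H), ∑ i, TensorProduct.lid k _ (ξ.rTensor _ t) i * ((c i).unop : H) =
      TensorProduct.lid k _ (ξ.rTensor _ (∑ i, (LinearMap.mulRight k ((c i).unop : H)).lTensor X
        ((LinearMap.proj (R := k) (φ := fun _ : ι => H) i).lTensor X t))) := by
    intro t
    induction t with
    | zero => simp
    | add x y hx hy =>
      simp only [map_add, Pi.add_apply, add_mul, Finset.sum_add_distrib, hx, hy]
    | tmul a x => simp
  rw [h1, hz c hc, map_zero, map_zero]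

theorem _root_.ModuleFactorCoalgebra.exists_pi_isCompatible (C : ModuleFactorCoalgebra k H)
    (ι : Type) [Fintype ι] [DecidableEq ι] : ∃ l : LeftCoaction k C.Quot (ι → H),
      C.IsCompatible (Algebra.lsmul k k (ι → H) (A := H)) l.coact ∧
      ∀ x i, (LinearMap.proj (R := k) (φ := fun _ : ι => H) i).lTensor _ (l.coact x) =
        C.leftCoactH (x i) := by
  obtain ⟨l, hl⟩ := C.coactionH.exists_pi ι
  refine ⟨l, fun h x => ext_lTensor_proj fun i => ?_, hl⟩
  have h1 : ∀ t : C.Quot ⊗[k] (ι → H),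
      (LinearMap.proj (R := k) (φ := fun _ : ι => H) i).lTensor _
        (diagAction C.action (Algebra.lsmul k k (ι → H) (A := H)) h t) =
      diagAction C.action (Algebra.lmul k H) h
        ((LinearMap.proj (R := k) (φ := fun _ : ι => H) i).lTensor _ t) := by
    intro t
    induction t with
    | zero => simp
    | add x y hx hy => simp only [map_add, hx, hy]
    | tmul c x =>
      rw [LinearMap.lTensor_tmul, diagAction_tmul, diagAction_tmul,
        ← LinearMap.comp_apply (LinearMap.lTensor _ _), LinearMap.lTensor_comp_map]
      rfl
  rw [hl, h1, hl]
  exact C.leftCoactH_isCompatible h (x i)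

/-- The solutions of a system of equations with coefficients in `A` form an object of `_H^C M`. -/
theorem exists_coaction_solutions (hC : A.augIdeal ≤ C.ideal) {ι : Type} [Fintype ι]
    [DecidableEq ι] (R : Set (ι → A.algᵐᵒᵖ)) :
    ∃ (β : H →ₐ[k] Module.End k (A.solutions R)) (l : LeftCoaction k C.Quot (A.solutions R)),
      C.IsCompatible β l.coact ∧
      (∀ h (x : A.solutions R) i, (β h x : ι → H) i = h * (x : ι → H) i) ∧
      ∀ (x : A.solutions R) i, (LinearMap.proj (R := k) (φ := fun _ : ι => H) i).lTensor _
        ((A.solutions R).subtype.lTensor _ (l.coact x)) = C.leftCoactH ((x : ι → H) i) := by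
  obtain ⟨lE, hcomp, hlE⟩ := C.exists_pi_isCompatible ι
  have hstable : ∀ h, ∀ x ∈ A.solutions R,
      Algebra.lsmul k k (ι → H) (A := H) h x ∈ A.solutions R := by
    intro h x hx c hc
    have h1 := hx c hc
    have h2 : ∑ i, h * x i * ((c i).unop : H) = 0 := by
      simp only [mul_assoc, ← Finset.mul_sum, h1, mul_zero]
    exact h2
  have hcoact : ∀ x ∈ A.solutions R,
      lE.coact x ∈ LinearMap.range ((A.solutions R).subtype.lTensor C.Quot) := by
    intro x hx
    refine mem_range_lTensor_solutions fun c hc => ?_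
    have h1 : ∀ i, (LinearMap.mulRight k ((c i).unop : H)).lTensor C.Quot
        ((LinearMap.proj (R := k) (φ := fun _ : ι => H) i).lTensor C.Quot (lE.coact x)) =
          C.leftCoactH (x i * (c i).unop) := fun i =>
      (congrArg _ (hlE x i)).trans (leftCoactH_mul_of_mem hC (c i).unop.2 (x i)).symm
    refine (Finset.sum_congr rfl fun i _ => h1 i).trans ?_
    rw [← map_sum, hx c hc, map_zero]
  obtain ⟨β, l, h1, h2, h3⟩ := hcomp.exists_restrict (A.solutions R) hstable hcoact
  refine ⟨β, l, h1, fun h x i => congrFun (h2 h x) i, fun x i => ?_⟩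
  rw [h3, hlE]

/-- A Hopf module that is finitely generated over the algebra of invariants is projective. With
generators `nᵢ`, the reduced coactions of the `nᵢ` form a solution of the equations `∑ xᵢ aᵢ = 0`
that the `nᵢ` satisfy, and since the solutions in `H` form an object of `_H^C M`, they are generated
by the solutions in `A`. This gives `nᵢ = ∑ n'ⱼ vⱼᵢ`, where the `vⱼ` are solutions in `A`; these
solutions define linear functions on the module. -/
theorem projective_of_finite (hinj : C.LeftHopfModulesInjective) (hC : A.augIdeal ≤ C.ideal)
    (hCA : ∀ h, C.leftCoactH h = C.proj 1 ⊗ₜ[k] h → h ∈ A.alg) (hρ : A.IsRightHopfModule ρ)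
    [Module.Finite A.algᵐᵒᵖ N] : Module.Projective A.algᵐᵒᵖ N := by
  classical
  obtain ⟨p, f, hf⟩ := Module.Finite.exists_fin' A.algᵐᵒᵖ N
  let n : Fin p → N := fun i => f (Pi.single i 1)
  have hfn : ∀ c, f c = ∑ i, c i • n i := by
    intro c
    conv_lhs => rw [pi_eq_sum_univ' c, map_sum]
    refine Finset.sum_congr rfl fun i _ => ?_
    rw [map_smul]
  let R : Set (Fin p → A.algᵐᵒᵖ) := LinearMap.ker f
  obtain ⟨β, l, hl, hβ, hlp⟩ := exists_coaction_solutions hC R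
  obtain ⟨r, hr, hr'⟩ := (hinj.isInjective hl).exists_retraction
  obtain ⟨d, hd, hd'⟩ := exists_coaction_quotient hC hρ
  -- the reduced coactions of the generators, as an element of `X ⊗ M`
  obtain ⟨z, hz⟩ : ∃ z : (N ⧸ A.augSubmodule N) ⊗[k] A.solutions R, ∀ i,
      (LinearMap.proj (R := k) (φ := fun _ : Fin p => H) i).lTensor _
        ((A.solutions R).subtype.lTensor _ z) = A.reducedCoaction ρ (n i) := by
    obtain ⟨z, hz⟩ : ∑ j, (LinearMap.single k (fun _ : Fin p => H) j).lTensor _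
        (A.reducedCoaction ρ (n j)) ∈ LinearMap.range ((A.solutions R).subtype.lTensor _) := by
      refine mem_range_lTensor_solutions fun c hc => ?_
      simp only [lTensor_proj_sum_single (fun j => A.reducedCoaction ρ (n j))]
      have h1 : ∀ i, (LinearMap.mulRight k ((c i).unop : H)).lTensor _
          (A.reducedCoaction ρ (n i)) = A.reducedCoaction ρ (c i • n i) := fun i =>
        (reducedCoaction_smul hρ (c i).unop (n i)).symm
      simp only [h1]
      rw [← map_sum, ← hfn, (hc : f c = 0), map_zero]
    refine ⟨z, fun i => ?_⟩
    rw [hz]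
    exact lTensor_proj_sum_single (fun j => A.reducedCoaction ρ (n j)) i
  have hzcot : TensorProduct.assoc k _ _ _ (d.rTensor _ z) = l.coact.lTensor _ z := by
    apply lTensor_injective (lTensor_injective (A.solutions R).injective_subtype)
    refine ext_lTensor_lTensor_proj fun i => ?_
    have h1 : (LinearMap.proj (R := k) (φ := fun _ : Fin p => H) i).lTensor C.Quot ∘ₗ
        (A.solutions R).subtype.lTensor C.Quot ∘ₗ l.coact =
        C.leftCoactH ∘ₗ LinearMap.proj i ∘ₗ (A.solutions R).subtype :=
      LinearMap.ext fun x => hlp x i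
    rw [← assoc_lTensor, ← assoc_lTensor, ← rTensor_lTensor_comm, ← rTensor_lTensor_comm, hz, hd',
      ← LinearMap.comp_apply (LinearMap.lTensor _ _) (LinearMap.lTensor _ _) z,
      ← LinearMap.lTensor_comp,
      ← LinearMap.comp_apply (LinearMap.lTensor _ _) (LinearMap.lTensor _ _) z,
      ← LinearMap.lTensor_comp, h1, LinearMap.lTensor_comp, LinearMap.lTensor_comp,
      LinearMap.comp_apply, LinearMap.comp_apply, hz]
  obtain ⟨y, hy⟩ := LinearMap.rTensor_surjective (A.solutions R)
    (A.augSubmodule N).mkQ_surjective z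
  -- the `i`-th coordinates of the invariant solutions
  obtain ⟨ev, hev⟩ : ∃ ev : Fin p → C.invariants l.coact →ₗ[k] A.alg, ∀ i v,
      (ev i v : H) = ((v : A.solutions R) : Fin p → H) i := by
    refine ⟨fun i => (LinearMap.proj i ∘ₗ (A.solutions R).subtype ∘ₗ
      (C.invariants l.coact).subtype).codRestrict (Subalgebra.toSubmodule A.alg) fun v =>
        hCA _ ?_, fun i v => rfl⟩
    have h1 := hlp v i
    rw [ModuleFactorCoalgebra.mem_invariants.1 v.2] at h1
    exact h1.symm
  let Θ : H ⊗[k] A.solutions R →ₗ[k] C.invariants l.coact :=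
    (C.integral β r).codRestrict _ (ModuleFactorCoalgebra.integral_mem_invariants hl hr)
  let W : N ⊗[k] A.solutions R →ₗ[k] N ⊗[k] C.invariants l.coact :=
    Θ.lTensor N ∘ₗ (TensorProduct.assoc k N H _).toLinearMap ∘ₗ ρ.coact.rTensor _
  have hW : ∀ i y, A.reducedCoaction ρ (rightAct k A.alg N ((ev i).lTensor N (W y))) =
      (LinearMap.proj i ∘ₗ (A.solutions R).subtype ∘ₗ r).lTensor _ (TensorProduct.assoc k _ _ _
        (d.rTensor _ ((A.augSubmodule N).mkQ.rTensor _ y))) := by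
    intro i y
    induction y with
    | zero => simp
    | add x y hx hy => simp only [map_add, hx, hy]
    | tmul m x =>
      have h1 : (ev i).lTensor N (W (m ⊗ₜ x)) = (ev i ∘ₗ Θ ∘ₗ
          (TensorProduct.mk k H _).flip x).lTensor N (ρ.coact m) := by
        simp only [W, LinearMap.comp_apply, LinearMap.rTensor_tmul]
        generalize ρ.coact m = t
        induction t with
        | zero => simp
        | add x y hx hy => simp only [map_add, TensorProduct.add_tmul, hx, hy]
        | tmul a b => simp
      have h2 : ∀ h, ((ev i (Θ (h ⊗ₜ x)) : A.alg) : H) = antipodeConv (Algebra.lmul k H)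
          (LinearMap.proj i ∘ₗ (A.solutions R).subtype ∘ₗ
            (r ∘ₗ (TensorProduct.mk k C.Quot _).flip x) ∘ₗ C.proj) h := by
        intro h
        rw [hev]
        change ((C.integral β r (h ⊗ₜ x) : A.solutions R) : Fin p → H) i = _
        rw [ModuleFactorCoalgebra.integral_tmul, antipodeConv_apply, antipodeConv_apply]
        generalize Coalgebra.comul (R := k) h = s
        induction s with
        | zero => simp
        | add x y hx hy => simp only [map_add, Submodule.coe_add, Pi.add_apply, hx, hy]
        | tmul a b => simp [hβ]
      rw [h1, reducedCoaction_rightAct hρ (g := LinearMap.proj i ∘ₗ (A.solutions R).subtype ∘ₗ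
            (r ∘ₗ (TensorProduct.mk k C.Quot _).flip x) ∘ₗ C.proj)]
      · rw [LinearMap.rTensor_tmul, LinearMap.rTensor_tmul, hd]
        generalize A.reducedCoaction ρ m = t
        induction t with
        | zero => simp
        | add x y hx hy => simp only [map_add, TensorProduct.add_tmul, hx, hy]
        | tmul a b => simp
      · intro h
        rw [← actionMap_antipodeConv (Algebra.lmul k H) (LinearMap.proj i ∘ₗ
          (A.solutions R).subtype ∘ₗ (r ∘ₗ (TensorProduct.mk k C.Quot _).flip x) ∘ₗ C.proj) h]
        have h3 : A.alg.val.toLinearMap ∘ₗ (ev i ∘ₗ Θ ∘ₗ (TensorProduct.mk k H _).flip x) =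
            antipodeConv (Algebra.lmul k H) (LinearMap.proj i ∘ₗ (A.solutions R).subtype ∘ₗ
              (r ∘ₗ (TensorProduct.mk k C.Quot _).flip x) ∘ₗ C.proj) := LinearMap.ext h2
        rw [h3]
        rfl
  have hWy : ∀ i, rightAct k A.alg N ((ev i).lTensor N (W y)) = n i := by
    intro i
    apply reducedCoaction_injective hinj hC hCA hρ
    have h1 : r ∘ₗ l.coact = LinearMap.id := LinearMap.ext hr'
    rw [hW, hy, hzcot, ← LinearMap.comp_apply, ← LinearMap.lTensor_comp, LinearMap.comp_assoc,
      LinearMap.comp_assoc, h1, LinearMap.comp_id, LinearMap.lTensor_comp, LinearMap.comp_apply, hz]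
  -- the linear function on `N` which is defined by an invariant solution
  obtain ⟨φ, hφ⟩ : ∃ φ : C.invariants l.coact → N →ₗ[A.algᵐᵒᵖ] A.algᵐᵒᵖ, ∀ v i,
      φ v (n i) = MulOpposite.op (ev i v) := by
    have h1 : ∀ v : C.invariants l.coact, ∃ φ : N →ₗ[A.algᵐᵒᵖ] A.algᵐᵒᵖ, ∀ i,
        φ (n i) = MulOpposite.op (ev i v) := by
      intro v
      let g : (Fin p → A.algᵐᵒᵖ) →ₗ[A.algᵐᵒᵖ] A.algᵐᵒᵖ :=
        Fintype.linearCombination A.algᵐᵒᵖ fun i => MulOpposite.op (ev i v)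
      have hg : LinearMap.ker f ≤ LinearMap.ker g := by
        intro c hc
        rw [LinearMap.mem_ker, Fintype.linearCombination_apply]
        apply MulOpposite.unop_injective
        apply Subtype.val_injective
        have h2 := (v : A.solutions R).2 c hc
        simp only [← hev] at h2
        rw [MulOpposite.unop_zero]
        refine Eq.trans ?_ h2
        rw [Finset.unop_sum]
        simp
      obtain ⟨φ, hφ⟩ : ∃ φ : N →ₗ[A.algᵐᵒᵖ] A.algᵐᵒᵖ, ∀ c, φ (f c) = g c := by
        refine ⟨(LinearMap.ker f).liftQ g hg ∘ₗ
          (f.quotKerEquivOfSurjective hf).symm.toLinearMap, fun c => ?_⟩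
        have h3 : (f.quotKerEquivOfSurjective hf).symm (f c) = (LinearMap.ker f).mkQ c := by
          rw [LinearEquiv.symm_apply_eq]
          rfl
        rw [LinearMap.comp_apply, LinearEquiv.coe_coe, h3, Submodule.mkQ_apply,
          Submodule.liftQ_apply]
      refine ⟨φ, fun i => ?_⟩
      rw [hφ, Fintype.linearCombination_apply_single, one_smul]
    choose φ hφ using h1
    exact ⟨φ, hφ⟩
  obtain ⟨s, hs⟩ := TensorProduct.exists_finset (W y)
  let g : N →ₗ[A.algᵐᵒᵖ] (s → A.algᵐᵒᵖ) := LinearMap.pi fun j => φ j.1.2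
  let h : (s → A.algᵐᵒᵖ) →ₗ[A.algᵐᵒᵖ] N := Fintype.linearCombination A.algᵐᵒᵖ fun j => j.1.1
  refine Module.Projective.of_split g h (LinearMap.ext fun x => ?_)
  obtain ⟨c, rfl⟩ := hf x
  have hgh : ∀ i, h (g (n i)) = n i := by
    intro i
    conv_rhs => rw [← hWy i, hs, map_sum, map_sum]
    rw [Fintype.linearCombination_apply, ← Finset.sum_coe_sort s]
    refine Finset.sum_congr rfl fun j _ => ?_
    rw [LinearMap.lTensor_tmul, rightAct_tmul, ← hφ]
    rfl
  rw [hfn]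
  simp only [LinearMap.comp_apply, map_sum, map_smul, hgh, LinearMap.id_apply]

end RightCoidealSubalgebra

/-! ### Hopf submodules and projectivity in general -/

namespace RightCoidealSubalgebra

variable {k : Type v} {H : Type u} [Field k] [Ring H] [HopfAlgebra k H]
  {A : RightCoidealSubalgebra k H} {N : Type*} [AddCommGroup N] [Module k N] [Module A.algᵐᵒᵖ N]
  [IsScalarTower k A.algᵐᵒᵖ N] {ρ : RightCoaction k H N} {C : ModuleFactorCoalgebra k H}

/-- An `A`-submodule `D` of a Hopf module that is a subcomodule, `ρ(D) ⊆ D ⊗ H`. -/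
def IsHopfSubmodule (ρ : RightCoaction k H N) (D : Submodule A.algᵐᵒᵖ N) : Prop :=
  ∀ x ∈ D, ρ.coact x ∈ LinearMap.range ((D.subtype.restrictScalars k).rTensor H)

theorem range_rTensor_mono {D D' : Submodule A.algᵐᵒᵖ N} (h : D ≤ D') :
    LinearMap.range ((D.subtype.restrictScalars k).rTensor H) ≤
      LinearMap.range ((D'.subtype.restrictScalars k).rTensor H) := by
  rintro _ ⟨t, rfl⟩
  refine ⟨((Submodule.inclusion h).restrictScalars k).rTensor H t, ?_⟩
  rw [← LinearMap.comp_apply, ← LinearMap.rTensor_comp]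
  rfl

theorem IsHopfSubmodule.sup {D E : Submodule A.algᵐᵒᵖ N} (hD : IsHopfSubmodule ρ D)
    (hE : IsHopfSubmodule ρ E) : IsHopfSubmodule ρ (D ⊔ E) := by
  intro x hx
  obtain ⟨y, hy, z, hz, rfl⟩ := Submodule.mem_sup.1 hx
  rw [map_add]
  exact add_mem (range_rTensor_mono le_sup_left (hD y hy))
    (range_rTensor_mono le_sup_right (hE z hz))

theorem IsRightHopfModule.isHopfSubmodule_span (hρ : A.IsRightHopfModule ρ) {W : Submodule k N}
    (hW : ∀ w ∈ W, ρ.coact w ∈ LinearMap.range (W.subtype.rTensor H)) :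
    IsHopfSubmodule ρ (Submodule.span A.algᵐᵒᵖ (W : Set N)) := by
  intro x hx
  refine Submodule.span_induction (p := fun x _ => ρ.coact x ∈ LinearMap.range
    (((Submodule.span A.algᵐᵒᵖ (W : Set N)).subtype.restrictScalars k).rTensor H))
    (fun w hw => ?_) (by simp) (fun x y _ _ hx hy => by rw [map_add]; exact add_mem hx hy)
    (fun a x _ hx => ?_) hx
  · obtain ⟨t, ht⟩ := hW w hw
    let i : W →ₗ[k] Submodule.span A.algᵐᵒᵖ (W : Set N) :=
      { toFun := fun w => ⟨w, Submodule.subset_span w.2⟩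
        map_add' := fun _ _ => rfl
        map_smul' := fun _ _ => rfl }
    refine ⟨i.rTensor H t, ?_⟩
    rw [← ht, ← LinearMap.comp_apply, ← LinearMap.rTensor_comp]
    rfl
  · obtain ⟨t, ht⟩ := hx
    refine ⟨A.tensorRightAct _ (A.coaction a.unop) t, ?_⟩
    rw [rTensor_tensorRightAct, ht]
    exact (isRightHopfModule_iff.1 hρ a.unop x).symm

theorem IsRightHopfModule.exists_restrict (hρ : A.IsRightHopfModule ρ)
    {D : Submodule A.algᵐᵒᵖ N} (hD : IsHopfSubmodule ρ D) :
    ∃ ρD : RightCoaction k H D, A.IsRightHopfModule ρD ∧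
      ∀ x : D, (D.subtype.restrictScalars k).rTensor H (ρD.coact x) = ρ.coact x := by
  have hinj : Function.Injective (D.subtype.restrictScalars k) := Subtype.val_injective
  obtain ⟨d, hd⟩ : ∃ d : D →ₗ[k] D ⊗[k] H, ∀ x : D,
      (D.subtype.restrictScalars k).rTensor H (d x) = ρ.coact x := by
    refine ⟨(LinearEquiv.ofInjective _ (rTensor_injective (P := H) hinj)).symm.toLinearMap ∘ₗ
      (ρ.coact ∘ₗ D.subtype.restrictScalars k).codRestrict _ (fun x => hD x x.2), fun x => ?_⟩
    have h := LinearEquiv.apply_symm_apply (LinearEquiv.ofInjective _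
      (rTensor_injective (P := H) hinj))
      ((ρ.coact ∘ₗ D.subtype.restrictScalars k).codRestrict _ (fun x => hD x x.2) x)
    exact congrArg Subtype.val h
  exact ⟨ρ.ofInjective _ hinj d hd, hρ.of_injective D.subtype hinj hd, hd⟩

/-- Extension of a partial section of a surjection from a Hopf submodule to a larger one. -/
theorem exists_section_extension (hinj : C.LeftHopfModulesInjective) (hC : A.augIdeal ≤ C.ideal)
    (hCA : ∀ h, C.leftCoactH h = C.proj 1 ⊗ₜ[k] h → h ∈ A.alg) (hρ : A.IsRightHopfModule ρ)
    {P : Type*} [AddCommGroup P] [Module A.algᵐᵒᵖ P] {π : P →ₗ[A.algᵐᵒᵖ] N}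
    (hπ : Function.Surjective π) {D : Submodule A.algᵐᵒᵖ N} (hD : IsHopfSubmodule ρ D)
    {s : D →ₗ[A.algᵐᵒᵖ] P} (hs : ∀ x, π (s x) = x) (x₀ : N) :
    ∃ (D' : Submodule A.algᵐᵒᵖ N) (s' : D' →ₗ[A.algᵐᵒᵖ] P), x₀ ∈ D' ∧ IsHopfSubmodule ρ D' ∧
      (∀ x, π (s' x) = x) ∧ ∃ h : D ≤ D', ∀ x, s' (Submodule.inclusion h x) = s x := by
  obtain ⟨W, _, hx₀, hW⟩ := ρ.exists_finite x₀
  let E := Submodule.span A.algᵐᵒᵖ (W : Set N)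
  have hD' := hD.sup (hρ.isHopfSubmodule_span hW)
  have hle : D ≤ D ⊔ E := le_sup_left
  obtain ⟨ρ', hρ', hρ''⟩ := hρ.exists_restrict hD'
  let B : Submodule A.algᵐᵒᵖ (D ⊔ E : Submodule A.algᵐᵒᵖ N) := D.comap (D ⊔ E).subtype
  obtain ⟨ρQ, hρQ, -⟩ := hρ'.exists_quotient B (by
    intro b hb
    obtain ⟨t, ht⟩ := hD b hb
    have h1 : ρ'.coact b = ((Submodule.inclusion hle).restrictScalars k).rTensor H t := by
      apply rTensor_injective (i := (D ⊔ E).subtype.restrictScalars k) Subtype.val_injective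
      rw [hρ'', ← ht, ← LinearMap.comp_apply, ← LinearMap.rTensor_comp]
      rfl
    have h2 : B.mkQ.restrictScalars k ∘ₗ (Submodule.inclusion hle).restrictScalars k = 0 :=
      LinearMap.ext fun x => (Submodule.Quotient.mk_eq_zero B).2 x.2
    rw [h1, ← LinearMap.comp_apply, ← LinearMap.rTensor_comp, h2, LinearMap.rTensor_zero,
      LinearMap.zero_apply])
  have hfin : Module.Finite A.algᵐᵒᵖ (_ ⧸ B) := by
    have hE : Module.Finite A.algᵐᵒᵖ E :=
      Module.Finite.iff_fg.2 (Submodule.FG.span (Module.Finite.iff_fg.1 ‹Module.Finite k W›))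
    refine Module.Finite.of_surjective (B.mkQ ∘ₗ Submodule.inclusion (le_sup_right : E ≤ D ⊔ E))
      fun q => ?_
    obtain ⟨⟨x, hx⟩, rfl⟩ := B.mkQ_surjective q
    obtain ⟨y, hy, z, hz, rfl⟩ := Submodule.mem_sup.1 hx
    refine ⟨⟨z, hz⟩, ?_⟩
    rw [LinearMap.comp_apply, ← sub_eq_zero, ← map_sub]
    refine (Submodule.Quotient.mk_eq_zero B).2 ?_
    change z - (y + z) ∈ D
    rw [sub_add_cancel_right]
    exact neg_mem hy
  have := projective_of_finite hinj hC hCA hρQ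
  obtain ⟨σ, hσ⟩ := Module.projective_lifting_property B.mkQ LinearMap.id B.mkQ_surjective
  obtain ⟨u, hu⟩ := Module.projective_lifting_property π ((D ⊔ E).subtype ∘ₗ σ) hπ
  have hmem : ∀ x : (D ⊔ E : Submodule A.algᵐᵒᵖ N), (x : N) - σ (B.mkQ x) ∈ D := by
    intro x
    refine (Submodule.Quotient.mk_eq_zero B (x := x - σ (B.mkQ x))).1 ?_
    change B.mkQ (x - σ (B.mkQ x)) = 0
    rw [map_sub, ← LinearMap.comp_apply _ σ, hσ, LinearMap.id_apply, sub_self]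
  let s' : (D ⊔ E : Submodule A.algᵐᵒᵖ N) →ₗ[A.algᵐᵒᵖ] P :=
    s ∘ₗ ((D ⊔ E).subtype - (D ⊔ E).subtype ∘ₗ σ ∘ₗ B.mkQ).codRestrict D hmem + u ∘ₗ B.mkQ
  have hs' : ∀ x, s' x = s ⟨_, hmem x⟩ + u (B.mkQ x) := fun x => rfl
  refine ⟨D ⊔ E, s', Submodule.mem_sup_right (Submodule.subset_span hx₀), hD', fun x => ?_, hle,
    fun x => ?_⟩
  · have h1 := LinearMap.congr_fun hu (B.mkQ x)
    rw [LinearMap.comp_apply] at h1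
    rw [hs', map_add, hs, h1]
    exact sub_add_cancel _ _
  · have h0 : B.mkQ (Submodule.inclusion hle x) = 0 := (Submodule.Quotient.mk_eq_zero B).2 x.2
    have h2 : u (B.mkQ (Submodule.inclusion hle x)) = 0 := by rw [h0, map_zero]
    rw [hs', h2, add_zero]
    congr 1
    apply Subtype.val_injective
    change (x : N) - σ (B.mkQ (Submodule.inclusion hle x)) = x
    rw [h0, map_zero, Submodule.coe_zero, sub_zero]

theorem projective_of_leftHopfModulesInjective (hinj : C.LeftHopfModulesInjective)
    (hC : A.augIdeal ≤ C.ideal) (hCA : ∀ h, C.leftCoactH h = C.proj 1 ⊗ₜ[k] h → h ∈ A.alg)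
    (hρ : A.IsRightHopfModule ρ) : Module.Projective A.algᵐᵒᵖ N := by
  let π := Finsupp.linearCombination A.algᵐᵒᵖ (id : N → N)
  have hπ : Function.Surjective π := Finsupp.linearCombination_id_surjective _ _
  let S : Set (N →ₗ.[A.algᵐᵒᵖ] (N →₀ A.algᵐᵒᵖ)) :=
    {p | IsHopfSubmodule ρ p.domain ∧ ∀ x, π (p x) = x}
  have h0 : (⊥ : N →ₗ.[A.algᵐᵒᵖ] (N →₀ A.algᵐᵒᵖ)) ∈ S := by
    refine ⟨fun x hx => ?_, fun x => ?_⟩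
    · rw [(Submodule.mem_bot _).1 hx, map_zero]
      exact zero_mem _
    · have hx : x = 0 := Subtype.ext ((Submodule.mem_bot _).1 x.2)
      rw [hx, LinearPMap.map_zero, map_zero, Submodule.coe_zero]
  obtain ⟨p, -, hp⟩ := zorn_le_nonempty₀ S (fun c hcS hc q hq => by
    have hdir : DirectedOn (· ≤ ·) c := hc.directedOn
    refine ⟨LinearPMap.sSup c hdir, ⟨fun x hx => ?_, ?_⟩, fun z hz => LinearPMap.le_sSup hdir hz⟩
    · obtain ⟨r, hr, hxr⟩ := (LinearPMap.mem_domain_sSup_iff ⟨q, hq⟩ hdir).1 hx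
      exact range_rTensor_mono (LinearPMap.le_sSup hdir hr).1 ((hcS hr).1 x hxr)
    · rintro ⟨x, hx⟩
      obtain ⟨r, hr, hxr⟩ := (LinearPMap.mem_domain_sSup_iff ⟨q, hq⟩ hdir).1 hx
      rw [← (hcS hr).2 ⟨x, hxr⟩]
      exact congrArg π (LinearPMap.sSup_apply hdir hr ⟨x, hxr⟩)) _ h0
  have htop : ∀ x, x ∈ p.domain := by
    intro x
    obtain ⟨D', s', hx, hD', hs', hle, hext⟩ :=
      exists_section_extension hinj hC hCA hρ hπ hp.prop.1 (s := p.toFun) hp.prop.2 x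
    have h1 : p ≤ ⟨D', s'⟩ := ⟨hle, fun y y' hyy' => by
      rw [LinearPMap.mk_apply]
      refine (hext y).symm.trans (congrArg s' (Subtype.ext ?_))
      exact hyy'⟩
    have hmem : (⟨D', s'⟩ : N →ₗ.[A.algᵐᵒᵖ] (N →₀ A.algᵐᵒᵖ)) ∈ S := ⟨hD', hs'⟩
    exact (hp.le_of_ge hmem h1).1 hx
  exact Module.projective_def.2 ⟨p.toFun ∘ₗ LinearMap.id.codRestrict p.domain htop,
    fun x => hp.prop.2 ⟨x, htop x⟩⟩

end RightCoidealSubalgebra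

namespace ModuleFactorCoalgebra

variable {k : Type v} {H : Type u} [Field k] [Ring H] [HopfAlgebra k H]
  {C : ModuleFactorCoalgebra k H}

theorem LeftHopfModulesInjective.rightHopfModulesProjective (hC : C.LeftHopfModulesInjective) :
    C.toCoidealSubalgebra.RightHopfModulesProjective := by
  intro N _ _ _ _ ρ hρ
  refine RightCoidealSubalgebra.projective_of_leftHopfModulesInjective hC ?_ (fun h hh => hh) hρ
  have := congrArg ModuleFactorCoalgebra.ideal hC.toFactorCoalgebra_toCoidealSubalgebra
  exact this.le

end ModuleFactorCoalgebra

/-! ### The co-opposite Hopf algebra -/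

section Antipode

variable {k : Type v} {H : Type u} [Field k] [Ring H] [HopfAlgebra k H]

variable (k H) in
/-- The map `h ↦ S(h₍₂₎) ⊗ S(h₍₁₎)`. -/
noncomputable def antipodeTensorComm : H →ₗ[k] H ⊗[k] H :=
  (TensorProduct.comm k H H).toLinearMap ∘ₗ
    TensorProduct.map (HopfAlgebra.antipode k) (HopfAlgebra.antipode k) ∘ₗ Coalgebra.comul

/-- `(p ⊗ q₍₁₎) (S(q₍₃₎) ⊗ S(q₍₂₎)) = p S(q) ⊗ 1`. -/
theorem mul_antipodeTensorComm (p q : H) :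
    LinearMap.mul' k (H ⊗[k] H) ((antipodeTensorComm k H).lTensor (H ⊗[k] H)
      ((TensorProduct.assoc k H H H).symm (p ⊗ₜ Coalgebra.comul (R := k) q))) =
        (p * HopfAlgebra.antipode k q) ⊗ₜ[k] 1 := by
  have h1 : ∀ s : H ⊗[k] H, LinearMap.mul' k (H ⊗[k] H)
      ((antipodeTensorComm k H).lTensor (H ⊗[k] H)
        ((TensorProduct.assoc k H H H).symm (p ⊗ₜ s))) =
      TensorProduct.comm k H H ((LinearMap.mulLeft k p ∘ₗ HopfAlgebra.antipode k).lTensor H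
        ((LinearMap.mul' k H ∘ₗ (HopfAlgebra.antipode k).lTensor H).rTensor H
        ((TensorProduct.assoc k H H H).symm (Coalgebra.comul.lTensor H s)))) := by
    intro s
    induction s with
    | zero => simp
    | add x y hx hy => simp only [map_add, TensorProduct.tmul_add, hx, hy]
    | tmul a b =>
      simp only [TensorProduct.assoc_symm_tmul, LinearMap.lTensor_tmul, antipodeTensorComm,
        LinearMap.comp_apply]
      generalize Coalgebra.comul (R := k) b = t
      induction t with
      | zero => simp
      | add x y hx hy => simp only [map_add, TensorProduct.tmul_add, hx, hy]
      | tmul c d => simp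
  rw [h1, Coalgebra.coassoc_symm_apply, ← LinearMap.comp_apply (LinearMap.rTensor _ _),
    ← LinearMap.rTensor_comp, LinearMap.comp_assoc, HopfAlgebra.mul_antipode_lTensor_comul,
    LinearMap.rTensor_comp, LinearMap.comp_apply, Coalgebra.rTensor_counit_comul]
  simp

/-- The antipode is an antihomomorphism of coalgebras: `Δ ∘ S` and `h ↦ S(h₍₂₎) ⊗ S(h₍₁₎)` are both
the inverse of `Δ` with respect to the convolution product. -/
theorem comul_antipode (h : H) : Coalgebra.comul (R := k) (HopfAlgebra.antipode k h) =
    TensorProduct.comm k H H (TensorProduct.map (HopfAlgebra.antipode k) (HopfAlgebra.antipode k)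
      (Coalgebra.comul (R := k) h)) := by
  have h1 : WithConv.toConv (Coalgebra.comul (R := k) ∘ₗ HopfAlgebra.antipode k (A := H)) *
      WithConv.toConv (Coalgebra.comul (R := k) (A := H)) = 1 := by
    have key : ∀ t : H ⊗[k] H, LinearMap.mul' k (H ⊗[k] H)
        (TensorProduct.map (Coalgebra.comul ∘ₗ HopfAlgebra.antipode k) Coalgebra.comul t) =
        Coalgebra.comul (R := k) (LinearMap.mul' k H ((HopfAlgebra.antipode k).rTensor H t)) := by
      intro t
      induction t with
      | zero => simp
      | add x y hx hy => simp only [map_add, hx, hy]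
      | tmul a b => simp
    ext g
    rw [LinearMap.convMul_apply, LinearMap.convOne_apply]
    refine (key _).trans ?_
    rw [HopfAlgebra.mul_antipode_rTensor_comul_apply, Bialgebra.comul_algebraMap]
  have h2 : WithConv.toConv (Coalgebra.comul (R := k) (A := H)) *
      WithConv.toConv (antipodeTensorComm k H) = 1 := by
    have key : ∀ t : H ⊗[k] H, LinearMap.mul' k (H ⊗[k] H)
        ((antipodeTensorComm k H).lTensor (H ⊗[k] H)
          ((TensorProduct.assoc k H H H).symm (Coalgebra.comul.lTensor H t))) =
        LinearMap.mul' k H ((HopfAlgebra.antipode k).lTensor H t) ⊗ₜ 1 := by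
      intro t
      induction t with
      | zero => simp
      | add x y hx hy => simp only [map_add, TensorProduct.add_tmul, hx, hy]
      | tmul a b =>
        rw [LinearMap.lTensor_tmul, mul_antipodeTensorComm]
        simp
    ext g
    rw [LinearMap.convMul_apply, LinearMap.convOne_apply]
    have h3 : TensorProduct.map (Coalgebra.comul (R := k)) (antipodeTensorComm k H)
        (Coalgebra.comul (R := k) g) = (antipodeTensorComm k H).lTensor (H ⊗[k] H)
          ((TensorProduct.assoc k H H H).symm (Coalgebra.comul.lTensor H
            (Coalgebra.comul (R := k) g))) := by
      rw [Coalgebra.coassoc_symm_apply, ← LinearMap.comp_apply (LinearMap.lTensor _ _),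
        LinearMap.lTensor_comp_rTensor]
    refine (congrArg _ h3).trans ?_
    rw [key, HopfAlgebra.mul_antipode_lTensor_comul_apply, Algebra.TensorProduct.algebraMap_apply]
  have h3 := left_inv_eq_right_inv h1 h2
  exact LinearMap.congr_fun (WithConv.toConv_injective h3) h

end Antipode

/-- Two Hopf algebras `H` and `K` such that `K` is isomorphic to the co-opposite of `H` through `e`.
Then `K` is also isomorphic to the opposite of `H` through the map `j`, which is the composite of
`e` with the antipode of `K`. The relation between `H` and `K` is symmetric. -/
structure CoopTwist (k : Type*) (H K : Type*) [Field k] [Ring H] [HopfAlgebra k H] [Ring K]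
    [HopfAlgebra k K] where
  /-- The anti-isomorphism of coalgebras. -/
  e : H ≃ₐ[k] K
  /-- The anti-isomorphism of algebras. -/
  j : H ≃ₗ[k] K
  counit_e : ∀ h, Coalgebra.counit (R := k) (e h) = Coalgebra.counit (R := k) h
  comul_e : ∀ h, Coalgebra.comul (R := k) (e h) = TensorProduct.comm k K K
    (TensorProduct.map e.toLinearMap e.toLinearMap (Coalgebra.comul (R := k) h))
  counit_j : ∀ h, Coalgebra.counit (R := k) (j h) = Coalgebra.counit (R := k) h
  comul_j : ∀ h, Coalgebra.comul (R := k) (j h) =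
    TensorProduct.map j.toLinearMap j.toLinearMap (Coalgebra.comul (R := k) h)
  j_one : j 1 = 1
  j_mul : ∀ g h, j (g * h) = j h * j g
  j_mul_e : ∀ h, LinearMap.mul' k K (TensorProduct.map j.toLinearMap e.toLinearMap
    (TensorProduct.comm k H H (Coalgebra.comul (R := k) h))) =
      algebraMap k K (Coalgebra.counit (R := k) h)
  e_mul_j : ∀ h, LinearMap.mul' k K (TensorProduct.map e.toLinearMap j.toLinearMap
    (TensorProduct.comm k H H (Coalgebra.comul (R := k) h))) =
      algebraMap k K (Coalgebra.counit (R := k) h)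

section Coop

variable {k : Type v} {H : Type u} [Field k] [Ring H] [HopfAlgebra k H]

/-- The co-opposite Hopf algebra of `H`, as a ring. -/
def Coop (H : Type u) : Type u := H

instance : Ring (Coop H) := inferInstanceAs (Ring H)

/-- The coalgebra structure of `H` with the opposite comultiplication. -/
@[reducible]
noncomputable def coopCoalgebra (k : Type v) (H : Type u) [Field k] [Ring H] [HopfAlgebra k H] :
    Coalgebra k H where
  comul := (TensorProduct.comm k H H).toLinearMap ∘ₗ Coalgebra.comul
  counit := Coalgebra.counit
  coassoc := by
    refine LinearMap.ext fun h => ?_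
    have h1 : ∀ t : H ⊗[k] H, TensorProduct.assoc k H H H
        (((TensorProduct.comm k H H).toLinearMap ∘ₗ Coalgebra.comul).rTensor H
          (TensorProduct.comm k H H t)) =
        TensorProduct.assoc k H H H ((TensorProduct.comm k H H).toLinearMap.rTensor H
          (TensorProduct.comm k H _ (Coalgebra.comul.lTensor H t))) := by
      intro t
      induction t with
      | zero => simp
      | add x y hx hy => simp only [map_add, hx, hy]
      | tmul a b => simp
    have h2 : ∀ t : H ⊗[k] H, ((TensorProduct.comm k H H).toLinearMap ∘ₗ
        Coalgebra.comul).lTensor H (TensorProduct.comm k H H t) =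
        (TensorProduct.comm k H H).toLinearMap.lTensor H
          (TensorProduct.comm k _ H (Coalgebra.comul.rTensor H t)) := by
      intro t
      induction t with
      | zero => simp
      | add x y hx hy => simp only [map_add, hx, hy]
      | tmul a b => simp
    have h3 : ∀ t : (H ⊗[k] H) ⊗[k] H,
        TensorProduct.assoc k H H H ((TensorProduct.comm k H H).toLinearMap.rTensor H
          (TensorProduct.comm k H _ (TensorProduct.assoc k H H H t))) =
        (TensorProduct.comm k H H).toLinearMap.lTensor H (TensorProduct.comm k _ H t) := by
      intro t
      induction t with
      | zero => simp
      | add x y hx hy => simp only [map_add, hx, hy]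
      | tmul x c =>
        induction x with
        | zero => simp
        | add x y hx hy => simp only [map_add, TensorProduct.add_tmul, hx, hy]
        | tmul a b => simp
    simp only [LinearMap.comp_apply, LinearEquiv.coe_coe]
    rw [h1, h2, ← h3, Coalgebra.coassoc_apply]
  rTensor_counit_comp_comul := by
    refine LinearMap.ext fun h => ?_
    have h1 : ∀ t : H ⊗[k] H, (Coalgebra.counit (R := k)).rTensor H (TensorProduct.comm k H H t) =
        TensorProduct.comm k H k ((Coalgebra.counit (R := k)).lTensor H t) := by
      intro t
      induction t with
      | zero => simp
      | add x y hx hy => simp only [map_add, hx, hy]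
      | tmul a b => simp
    simp only [LinearMap.comp_apply, LinearEquiv.coe_coe]
    rw [h1, Coalgebra.lTensor_counit_comul]
    rfl
  lTensor_counit_comp_comul := by
    refine LinearMap.ext fun h => ?_
    have h1 : ∀ t : H ⊗[k] H, (Coalgebra.counit (R := k)).lTensor H (TensorProduct.comm k H H t) =
        TensorProduct.comm k k H ((Coalgebra.counit (R := k)).rTensor H t) := by
      intro t
      induction t with
      | zero => simp
      | add x y hx hy => simp only [map_add, hx, hy]
      | tmul a b => simp
    simp only [LinearMap.comp_apply, LinearEquiv.coe_coe]
    rw [h1, Coalgebra.rTensor_counit_comul]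
    rfl

theorem comm_comul_mul (a b : H) : TensorProduct.comm k H H (Coalgebra.comul (R := k) (a * b)) =
    TensorProduct.comm k H H (Coalgebra.comul (R := k) a) *
      TensorProduct.comm k H H (Coalgebra.comul (R := k) b) := by
  rw [Bialgebra.comul_mul]
  exact map_mul (Algebra.TensorProduct.comm k H H) _ _

instance : Algebra k (Coop H) := inferInstanceAs (Algebra k H)

noncomputable instance : Coalgebra k (Coop H) := coopCoalgebra k H

noncomputable instance : Bialgebra k (Coop H) :=
  Bialgebra.mk' k (Coop H) (Bialgebra.counit_one (R := k) (A := H))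
    (fun {a b} => Bialgebra.counit_mul (R := k) (A := H) a b)
    (by
      change TensorProduct.comm k H H (Coalgebra.comul (R := k) (1 : H)) = 1
      rw [Bialgebra.comul_one]
      rfl)
    (fun {a b} => comm_comul_mul (H := H) a b)

/-- The inverse of the antipode is an antihomomorphism of algebras. -/
theorem antipode_symm_mul (hS : Function.Bijective (HopfAlgebra.antipode k (A := H))) (g h : H) :
    (LinearEquiv.ofBijective _ hS).symm (g * h) =
      (LinearEquiv.ofBijective _ hS).symm h * (LinearEquiv.ofBijective _ hS).symm g := by
  rw [LinearEquiv.symm_apply_eq, LinearEquiv.ofBijective_apply,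
    HopfAlgebra.antipode_mul_antidistrib]
  congr 1
  · exact ((LinearEquiv.ofBijective _ hS).apply_symm_apply g).symm
  · exact ((LinearEquiv.ofBijective _ hS).apply_symm_apply h).symm

theorem antipode_symm_algebraMap (hS : Function.Bijective (HopfAlgebra.antipode k (A := H)))
    (r : k) : (LinearEquiv.ofBijective _ hS).symm (algebraMap k H r) = algebraMap k H r := by
  rw [LinearEquiv.symm_apply_eq, LinearEquiv.ofBijective_apply, Algebra.algebraMap_eq_smul_one,
    map_smul, HopfAlgebra.antipode_one]

/-- The co-opposite of a Hopf algebra with bijective antipode. Its antipode is the inverse of the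
antipode of the given Hopf algebra. -/
@[reducible]
noncomputable def coopHopfAlgebra (hS : Function.Bijective (HopfAlgebra.antipode k (A := H))) :
    HopfAlgebra k (Coop H) where
  antipode := ((LinearEquiv.ofBijective _ hS).symm.toLinearMap : H →ₗ[k] H)
  mul_antipode_rTensor_comul := by
    have h1 : ∀ t : H ⊗[k] H, LinearMap.mul' k H
        ((LinearEquiv.ofBijective _ hS).symm.toLinearMap.rTensor H (TensorProduct.comm k H H t)) =
        (LinearEquiv.ofBijective _ hS).symm
          (LinearMap.mul' k H ((HopfAlgebra.antipode k).rTensor H t)) := by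
      intro t
      induction t with
      | zero => simp
      | add x y hx hy => simp only [map_add, hx, hy]
      | tmul a b =>
        have : (LinearEquiv.ofBijective _ hS).symm (HopfAlgebra.antipode k a) = a :=
          (LinearEquiv.ofBijective _ hS).symm_apply_apply a
        simp [antipode_symm_mul, this]
    exact LinearMap.ext fun h : H => (h1 _).trans ((congrArg _
      (HopfAlgebra.mul_antipode_rTensor_comul_apply h)).trans (antipode_symm_algebraMap hS _))
  mul_antipode_lTensor_comul := by
    have h1 : ∀ t : H ⊗[k] H, LinearMap.mul' k H
        ((LinearEquiv.ofBijective _ hS).symm.toLinearMap.lTensor H (TensorProduct.comm k H H t)) =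
        (LinearEquiv.ofBijective _ hS).symm
          (LinearMap.mul' k H ((HopfAlgebra.antipode k).lTensor H t)) := by
      intro t
      induction t with
      | zero => simp
      | add x y hx hy => simp only [map_add, hx, hy]
      | tmul a b =>
        have : (LinearEquiv.ofBijective _ hS).symm (HopfAlgebra.antipode k b) = b :=
          (LinearEquiv.ofBijective _ hS).symm_apply_apply b
        simp [antipode_symm_mul, this]
    exact LinearMap.ext fun h : H => (h1 _).trans ((congrArg _
      (HopfAlgebra.mul_antipode_lTensor_comul_apply h)).trans (antipode_symm_algebraMap hS _))

/-- The inverse of the antipode is an antihomomorphism of coalgebras. -/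
theorem comul_antipode_symm (hS : Function.Bijective (HopfAlgebra.antipode k (A := H))) (h : H) :
    TensorProduct.comm k H H (Coalgebra.comul (R := k) ((LinearEquiv.ofBijective _ hS).symm h)) =
      TensorProduct.map (LinearEquiv.ofBijective _ hS).symm.toLinearMap
        (LinearEquiv.ofBijective _ hS).symm.toLinearMap (Coalgebra.comul (R := k) h) := by
  obtain ⟨g, rfl⟩ := (LinearEquiv.ofBijective _ hS).surjective h
  have h1 : ∀ t : H ⊗[k] H, TensorProduct.map (LinearEquiv.ofBijective _ hS).symm.toLinearMap
      (LinearEquiv.ofBijective _ hS).symm.toLinearMap (TensorProduct.comm k H H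
        (TensorProduct.map (HopfAlgebra.antipode k) (HopfAlgebra.antipode k) t)) =
      TensorProduct.comm k H H t := by
    intro t
    induction t with
    | zero => simp
    | add x y hx hy => simp only [map_add, hx, hy]
    | tmul a b =>
      have h2 : ∀ a, (LinearEquiv.ofBijective _ hS).symm (HopfAlgebra.antipode k a) = a :=
        (LinearEquiv.ofBijective _ hS).symm_apply_apply
      simp [h2]
  rw [LinearEquiv.symm_apply_apply, LinearEquiv.ofBijective_apply, comul_antipode, h1]

theorem counit_antipode_symm (hS : Function.Bijective (HopfAlgebra.antipode k (A := H))) (h : H) :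
    Coalgebra.counit (R := k) ((LinearEquiv.ofBijective _ hS).symm h) =
      Coalgebra.counit (R := k) h := by
  obtain ⟨g, rfl⟩ := (LinearEquiv.ofBijective _ hS).surjective h
  rw [LinearEquiv.symm_apply_apply, LinearEquiv.ofBijective_apply, HopfAlgebra.counit_antipode]

theorem exists_coopTwist (hS : Function.Bijective (HopfAlgebra.antipode k (A := H))) :
    ∃ (K : Type u) (_ : Ring K) (_ : HopfAlgebra k K), Nonempty (CoopTwist k H K) := by
  refine ⟨Coop H, inferInstance, coopHopfAlgebra hS, ⟨?_⟩⟩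
  let _ := coopHopfAlgebra hS
  let e : H ≃ₐ[k] Coop H := (AlgEquiv.refl : H ≃ₐ[k] H)
  let j : H ≃ₗ[k] Coop H := ((LinearEquiv.ofBijective _ hS).symm : H ≃ₗ[k] H)
  have hmap : ∀ t : H ⊗[k] H, TensorProduct.map (LinearMap.id : H →ₗ[k] H)
      (LinearMap.id : H →ₗ[k] H) t = t := fun t => by rw [TensorProduct.map_id]; rfl
  refine
    { e := e
      j := j
      counit_e := fun h => rfl
      comul_e := fun h => ?_
      counit_j := counit_antipode_symm hS
      comul_j := comul_antipode_symm hS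
      j_one := ?_
      j_mul := antipode_symm_mul hS
      j_mul_e := fun h => ?_
      e_mul_j := fun h => ?_ }
  · exact congrArg _ (hmap _).symm
  · change (LinearEquiv.ofBijective _ hS).symm 1 = (1 : H)
    rw [LinearEquiv.symm_apply_eq, LinearEquiv.ofBijective_apply, HopfAlgebra.antipode_one]
  · exact HopfAlgebra.mul_antipode_rTensor_comul_apply (R := k) (A := Coop H) h
  · exact HopfAlgebra.mul_antipode_lTensor_comul_apply (R := k) (A := Coop H) h

end Coop

/-! ### Transport of coideal subalgebras and factor coalgebras to the co-opposite Hopf algebra -/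

namespace CoopTwist

variable {k : Type v} {H K : Type u} [Field k] [Ring H] [HopfAlgebra k H] [Ring K]
  [HopfAlgebra k K]

/-- The relation between a Hopf algebra and its co-opposite is symmetric. -/
@[simps e j]
def symm (T : CoopTwist k H K) : CoopTwist k K H where
  e := T.e.symm
  j := T.j.symm
  counit_e y := by rw [← T.counit_e, AlgEquiv.apply_symm_apply]
  comul_e y := by
    obtain ⟨h, rfl⟩ := T.e.surjective y
    have h1 : ∀ t : H ⊗[k] H, TensorProduct.comm k H H (TensorProduct.map T.e.symm.toLinearMap
        T.e.symm.toLinearMap (TensorProduct.comm k K K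
          (TensorProduct.map T.e.toLinearMap T.e.toLinearMap t))) = t := by
      intro t
      induction t with
      | zero => simp
      | add x y hx hy => simp only [map_add, hx, hy]
      | tmul a b => simp
    rw [T.comul_e, h1, AlgEquiv.symm_apply_apply]
  counit_j y := by rw [← T.counit_j, LinearEquiv.apply_symm_apply]
  comul_j y := by
    obtain ⟨h, rfl⟩ := T.j.surjective y
    have h1 : ∀ t : H ⊗[k] H, TensorProduct.map T.j.symm.toLinearMap T.j.symm.toLinearMap
        (TensorProduct.map T.j.toLinearMap T.j.toLinearMap t) = t := by
      intro t
      induction t with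
      | zero => simp
      | add x y hx hy => simp only [map_add, hx, hy]
      | tmul a b => simp
    rw [T.comul_j, h1, LinearEquiv.symm_apply_apply]
  j_one := by rw [LinearEquiv.symm_apply_eq, T.j_one]
  j_mul x y := by
    rw [LinearEquiv.symm_apply_eq, T.j_mul, LinearEquiv.apply_symm_apply,
      LinearEquiv.apply_symm_apply]
  j_mul_e y := by
    obtain ⟨h, rfl⟩ := T.j.surjective y
    have h1 : ∀ t : H ⊗[k] H, T.e (LinearMap.mul' k H (TensorProduct.map T.j.symm.toLinearMap
        T.e.symm.toLinearMap (TensorProduct.comm k K K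
          (TensorProduct.map T.j.toLinearMap T.j.toLinearMap t)))) =
        LinearMap.mul' k K (TensorProduct.map T.e.toLinearMap T.j.toLinearMap
          (TensorProduct.comm k H H t)) := by
      intro t
      induction t with
      | zero => simp
      | add x y hx hy => simp only [map_add, hx, hy]
      | tmul a b => simp
    apply T.e.injective
    rw [T.comul_j, h1, T.e_mul_j, T.counit_j, AlgEquiv.commutes]
  e_mul_j y := by
    obtain ⟨h, rfl⟩ := T.j.surjective y
    have h1 : ∀ t : H ⊗[k] H, T.e (LinearMap.mul' k H (TensorProduct.map T.e.symm.toLinearMap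
        T.j.symm.toLinearMap (TensorProduct.comm k K K
          (TensorProduct.map T.j.toLinearMap T.j.toLinearMap t)))) =
        LinearMap.mul' k K (TensorProduct.map T.j.toLinearMap T.e.toLinearMap
          (TensorProduct.comm k H H t)) := by
      intro t
      induction t with
      | zero => simp
      | add x y hx hy => simp only [map_add, hx, hy]
      | tmul a b => simp
    apply T.e.injective
    rw [T.comul_j, h1, T.j_mul_e, T.counit_j, AlgEquiv.commutes]

variable (T : CoopTwist k H K)

/-- The image of a coideal subalgebra under the antiisomorphism of algebras `j`. -/
noncomputable def mapSubalgebra (A : RightCoidealSubalgebra k H) : RightCoidealSubalgebra k K where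
  alg :=
    { carrier := {y | T.j.symm y ∈ A.alg}
      mul_mem' := fun {x y} hx hy => by
        change T.j.symm (x * y) ∈ A.alg
        rw [show T.j.symm (x * y) = T.j.symm y * T.j.symm x from T.symm.j_mul x y]
        exact A.alg.mul_mem hy hx
      add_mem' := fun {x y} hx hy => by
        change T.j.symm (x + y) ∈ A.alg
        rw [map_add]
        exact A.alg.add_mem hx hy
      algebraMap_mem' := fun r => by
        change T.j.symm (algebraMap k K r) ∈ A.alg
        rw [Algebra.algebraMap_eq_smul_one, map_smul, show T.j.symm 1 = 1 from T.symm.j_one]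
        exact A.alg.smul_mem A.alg.one_mem r }
  comul_mem y hy := by
    obtain ⟨h, rfl⟩ := T.j.surjective y
    have hh : h ∈ A.alg := by
      rw [← T.j.symm_apply_apply h]
      exact hy
    obtain ⟨t, ht⟩ := A.comul_mem h hh
    rw [T.comul_j, ← ht]
    clear ht
    induction t with
    | zero => simp
    | add x y hx hy =>
      rw [map_add, map_add]
      exact add_mem hx hy
    | tmul a b =>
      refine ⟨⟨T.j a, ?_⟩ ⊗ₜ T.j b, rfl⟩
      change T.j.symm (T.j a) ∈ A.alg
      rw [T.j.symm_apply_apply]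
      exact a.2

theorem mem_mapSubalgebra {A : RightCoidealSubalgebra k H} {y : K} :
    y ∈ (T.mapSubalgebra A).alg ↔ T.j.symm y ∈ A.alg := Iff.rfl

theorem j_mem_mapSubalgebra {A : RightCoidealSubalgebra k H} {h : H} :
    T.j h ∈ (T.mapSubalgebra A).alg ↔ h ∈ A.alg := by
  rw [mem_mapSubalgebra, T.j.symm_apply_apply]

theorem symm_mapSubalgebra_mapSubalgebra (A : RightCoidealSubalgebra k H) :
    T.symm.mapSubalgebra (T.mapSubalgebra A) = A := by
  refine RightCoidealSubalgebra.ext (SetLike.ext fun h => ?_)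
  rw [mem_mapSubalgebra, mem_mapSubalgebra]
  change T.j.symm (T.j h) ∈ A.alg ↔ _
  rw [T.j.symm_apply_apply]

theorem mapSubalgebra_injective : Function.Injective T.mapSubalgebra :=
  Function.LeftInverse.injective T.symm_mapSubalgebra_mapSubalgebra

/-- The image of a factor coalgebra under the isomorphism of algebras `e`. -/
noncomputable def mapFactor (C : ModuleFactorCoalgebra k H) : ModuleFactorCoalgebra k K where
  ideal := C.ideal.comap T.e.symm
  isCoideal := by
    obtain ⟨f, hf⟩ := exists_comp_eq_of_ker_le (q := C.proj) C.proj_surjective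
      (g := ((C.ideal.comap T.e.symm).restrictScalars k).mkQ ∘ₗ T.e.toLinearMap) (fun x hx => by
        refine (Submodule.Quotient.mk_eq_zero _).2 ?_
        change T.e.symm (T.e x) ∈ C.ideal
        rw [T.e.symm_apply_apply]
        exact (C.proj_eq_zero_iff x).1 hx)
    constructor
    · intro y hy
      rw [← T.symm.counit_e, ← C.counit_proj]
      change Coalgebra.counit (R := k) (C.proj (T.e.symm y)) = 0
      rw [(C.proj_eq_zero_iff _).2 hy, map_zero]
    · intro y hy
      obtain ⟨h, rfl⟩ := T.e.surjective y
      have hh : h ∈ C.ideal := by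
        rw [← T.e.symm_apply_apply h]
        exact hy
      have h1 : ∀ t : H ⊗[k] H, TensorProduct.map
          ((C.ideal.comap T.e.symm).restrictScalars k).mkQ
          ((C.ideal.comap T.e.symm).restrictScalars k).mkQ (TensorProduct.comm k K K
            (TensorProduct.map T.e.toLinearMap T.e.toLinearMap t)) =
          TensorProduct.comm k _ _ (TensorProduct.map f f (TensorProduct.map C.proj C.proj t)) := by
        intro t
        induction t with
        | zero => simp
        | add x y hx hy => simp only [map_add, hx, hy]
        | tmul a b =>
          have h2 : ∀ a, f (C.proj a) = Submodule.Quotient.mk (T.e a) := hf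
          simp [h2]
      rw [T.comul_e, h1, ← C.comul_proj, (C.proj_eq_zero_iff h).2 hh]
      simp

theorem mem_mapFactor {C : ModuleFactorCoalgebra k H} {y : K} :
    y ∈ (T.mapFactor C).ideal ↔ T.e.symm y ∈ C.ideal := Iff.rfl

theorem symm_mapFactor_mapFactor (C : ModuleFactorCoalgebra k H) :
    T.symm.mapFactor (T.mapFactor C) = C := by
  refine ModuleFactorCoalgebra.ext (SetLike.ext fun h => ?_)
  rw [mem_mapFactor, mem_mapFactor]
  change T.e.symm (T.e h) ∈ C.ideal ↔ _
  rw [T.e.symm_apply_apply]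

theorem mapFactor_injective : Function.Injective T.mapFactor :=
  Function.LeftInverse.injective T.symm_mapFactor_mapFactor

theorem augIdeal_mapSubalgebra_le (A : RightCoidealSubalgebra k H) :
    (T.mapSubalgebra A).augIdeal ≤ (T.mapFactor A.toFactorCoalgebra).ideal := by
  refine Ideal.span_le.2 ?_
  rintro y ⟨hy, hy0⟩
  obtain ⟨a, rfl⟩ := T.j.surjective y
  rw [T.counit_j] at hy0
  have ha : a ∈ A.alg := T.j_mem_mapSubalgebra.1 hy
  obtain ⟨t, ht⟩ := A.exists_incl_eq_comul ha
  -- modulo `e(HA⁺)`, the sum of all `j(a₍₂₎) e(a₍₁₎)` is congruent to `j(a)`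
  have h1 : ∀ t : A.alg ⊗[k] H, (T.mapFactor A.toFactorCoalgebra).proj
      (LinearMap.mul' k K (TensorProduct.map T.j.toLinearMap T.e.toLinearMap
        (TensorProduct.comm k H H (A.incl t)))) =
      (T.mapFactor A.toFactorCoalgebra).proj (T.j (TensorProduct.lid k H
        ((Coalgebra.counit (R := k)).rTensor H (A.incl t)))) := by
    intro t
    induction t with
    | zero => simp
    | add x y hx hy => simp only [map_add, hx, hy]
    | tmul b h =>
      have h2 : (T.mapFactor A.toFactorCoalgebra).proj (T.e b) =
          Coalgebra.counit (R := k) (b : H) • (T.mapFactor A.toFactorCoalgebra).proj 1 := by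
        rw [← sub_eq_zero, ← map_smul, ← map_sub, ModuleFactorCoalgebra.proj_eq_zero_iff,
          mem_mapFactor]
        have h3 := RightCoidealSubalgebra.proj_of_mem (A := A) (C := A.toFactorCoalgebra) le_rfl b.2
        rw [← sub_eq_zero, ← map_smul, ← map_sub, ModuleFactorCoalgebra.proj_eq_zero_iff] at h3
        simpa using h3
      simp only [RightCoidealSubalgebra.incl, LinearMap.rTensor_tmul, TensorProduct.comm_tmul,
        TensorProduct.map_tmul, LinearMap.mul'_apply, AlgHom.toLinearMap_apply, LinearEquiv.coe_coe,
        AlgEquiv.toLinearMap_apply, Subalgebra.coe_val, ModuleFactorCoalgebra.proj_mul,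
        TensorProduct.lid_tmul, map_smul]
      rw [h2, smul_comm, ← ModuleFactorCoalgebra.proj_mul, mul_one]
  have h2 := h1 t
  rw [ht, T.j_mul_e, Coalgebra.rTensor_counit_comul, hy0, map_zero, map_zero,
    TensorProduct.lid_tmul, one_smul] at h2
  exact ((T.mapFactor A.toFactorCoalgebra).proj_eq_zero_iff _).1 h2.symm

theorem toFactorCoalgebra_mapSubalgebra (A : RightCoidealSubalgebra k H) :
    (T.mapSubalgebra A).toFactorCoalgebra = T.mapFactor A.toFactorCoalgebra := by
  refine ModuleFactorCoalgebra.ext (le_antisymm (T.augIdeal_mapSubalgebra_le A) fun y hy => ?_)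
  have h1 := T.symm.augIdeal_mapSubalgebra_le (T.mapSubalgebra A)
  rw [symm_mapSubalgebra_mapSubalgebra] at h1
  have h2 := h1 (T.mem_mapFactor.1 hy)
  rw [mem_mapFactor] at h2
  change T.e (T.e.symm y) ∈ _ at h2
  rwa [T.e.apply_symm_apply] at h2

theorem j_mem_coinvariantSubalgebra {C : ModuleFactorCoalgebra k H} {h : H}
    (hh : h ∈ C.coinvariantSubalgebra) : T.j h ∈ (T.mapFactor C).coinvariantSubalgebra := by
  have hh' : C.leftCoactH h = C.proj 1 ⊗ₜ h := hh
  obtain ⟨f, hf⟩ := exists_comp_eq_of_ker_le (q := C.proj) C.proj_surjective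
    (g := (T.mapFactor C).proj ∘ₗ T.e.toLinearMap) (fun x hx => by
      rw [LinearMap.comp_apply, ModuleFactorCoalgebra.proj_eq_zero_iff, mem_mapFactor]
      change T.e.symm (T.e x) ∈ C.ideal
      rw [T.e.symm_apply_apply]
      exact (C.proj_eq_zero_iff x).1 hx)
  have hf' : ∀ x, f (C.proj x) = (T.mapFactor C).proj (T.e x) := hf
  -- the map `q ⊗ h ↦ j(h₍₁₎) q ⊗ j(h₍₂₎)`
  let Ψ : (T.mapFactor C).Quot ⊗[k] H →ₗ[k] (T.mapFactor C).Quot ⊗[k] K :=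
    (actionMap (T.mapFactor C).action ∘ₗ (TensorProduct.comm k _ _).toLinearMap).rTensor K ∘ₗ
      (TensorProduct.assoc k _ _ _).symm.toLinearMap ∘ₗ
        (TensorProduct.map T.j.toLinearMap T.j.toLinearMap ∘ₗ Coalgebra.comul).lTensor _
  have h1 : Ψ (f.rTensor H (C.leftCoactH h)) = (T.mapFactor C).proj 1 ⊗ₜ T.j h := by
    have key : ∀ t : H ⊗[k] H, Ψ (f.rTensor H (C.proj.rTensor H t)) =
        ((T.mapFactor C).proj ∘ₗ LinearMap.mul' k K ∘ₗ TensorProduct.map T.j.toLinearMap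
          T.e.toLinearMap ∘ₗ (TensorProduct.comm k H H).toLinearMap).rTensor K
            (T.j.toLinearMap.lTensor _ ((TensorProduct.assoc k H H H).symm
              (Coalgebra.comul.lTensor H t))) := by
      intro t
      induction t with
      | zero => simp
      | add x y hx hy => simp only [map_add, hx, hy]
      | tmul a b =>
        simp only [Ψ, LinearMap.comp_apply, LinearMap.rTensor_tmul, LinearMap.lTensor_tmul]
        generalize Coalgebra.comul (R := k) b = s
        induction s with
        | zero => simp
        | add x y hx hy => simp only [map_add, TensorProduct.tmul_add, hx, hy]
        | tmul c d => simp [hf']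
    have h2 : ((T.mapFactor C).proj ∘ₗ LinearMap.mul' k K ∘ₗ TensorProduct.map T.j.toLinearMap
        T.e.toLinearMap ∘ₗ (TensorProduct.comm k H H).toLinearMap) ∘ₗ Coalgebra.comul =
        (T.mapFactor C).proj ∘ₗ Algebra.linearMap k K ∘ₗ Coalgebra.counit :=
      LinearMap.ext fun x => congrArg _ (T.j_mul_e x)
    refine (key _).trans ?_
    rw [Coalgebra.coassoc_symm_apply, rTensor_lTensor_comm,
      ← LinearMap.comp_apply (LinearMap.rTensor _ _), ← LinearMap.rTensor_comp, h2,
      LinearMap.rTensor_comp, LinearMap.rTensor_comp, LinearMap.comp_apply, LinearMap.comp_apply,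
      Coalgebra.rTensor_counit_comul]
    simp
  rw [hh', LinearMap.rTensor_tmul, hf', map_one] at h1
  refine Eq.trans ?_ h1
  change (T.mapFactor C).proj.rTensor K (Coalgebra.comul (R := k) (T.j h)) = _
  rw [T.comul_j]
  simp only [Ψ, LinearMap.comp_apply, LinearMap.lTensor_tmul]
  generalize Coalgebra.comul (R := k) h = s
  induction s with
  | zero => simp
  | add x y hx hy => simp only [map_add, TensorProduct.tmul_add, hx, hy]
  | tmul c d => simp

theorem toCoidealSubalgebra_mapFactor (C : ModuleFactorCoalgebra k H) :
    (T.mapFactor C).toCoidealSubalgebra = T.mapSubalgebra C.toCoidealSubalgebra := by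
  refine RightCoidealSubalgebra.ext (SetLike.ext fun y => ⟨fun hy => ?_, fun hy => ?_⟩)
  · have h1 := T.symm.j_mem_coinvariantSubalgebra hy
    rw [symm_mapFactor_mapFactor] at h1
    exact h1
  · have h1 := T.j_mem_coinvariantSubalgebra hy
    rw [T.j.apply_symm_apply] at h1
    exact h1

end CoopTwist

/-! ### Transport of Hopf modules to the co-opposite Hopf algebra -/

section Corestriction

variable {k : Type v} {C D : Type u} [Field k] [AddCommGroup C] [Module k C] [Coalgebra k C]
  [AddCommGroup D] [Module k D] [Coalgebra k D] {f : D →ₗ[k] C}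
  (hε : ∀ d, Coalgebra.counit (R := k) (f d) = Coalgebra.counit (R := k) d)
  (hΔ : ∀ d, Coalgebra.comul (R := k) (f d) =
    TensorProduct.comm k C C (TensorProduct.map f f (Coalgebra.comul (R := k) d)))
  {M N : Type u} [AddCommGroup M] [Module k M] [AddCommGroup N] [Module k N]

/-- A left comodule over `D` is a right comodule over `C` through an antihomomorphism of coalgebras
`f : D → C`. -/
noncomputable def LeftCoaction.toRight (l : LeftCoaction k D M) : RightCoaction k C M where
  coact := (TensorProduct.comm k C M).toLinearMap ∘ₗ f.rTensor M ∘ₗ l.coact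
  coassoc := by
    refine LinearMap.ext fun m => ?_
    let X : D ⊗[k] (D ⊗[k] M) →ₗ[k] M ⊗[k] (C ⊗[k] C) :=
      (TensorProduct.assoc k M C C).toLinearMap ∘ₗ (TensorProduct.comm k C _).toLinearMap ∘ₗ
        TensorProduct.map f ((TensorProduct.comm k C M).toLinearMap ∘ₗ f.rTensor M)
    have h1 : ∀ t : D ⊗[k] M, TensorProduct.assoc k M C C
        (((TensorProduct.comm k C M).toLinearMap ∘ₗ f.rTensor M ∘ₗ l.coact).rTensor C
          (TensorProduct.comm k C M (f.rTensor M t))) = X (l.coact.lTensor D t) := by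
      intro t
      induction t with
      | zero => simp
      | add x y hx hy => simp only [map_add, hx, hy]
      | tmul d m => simp [X]
    have h2 : ∀ t : D ⊗[k] M, Coalgebra.comul.lTensor M (TensorProduct.comm k C M (f.rTensor M t)) =
        X (TensorProduct.assoc k D D M (Coalgebra.comul.rTensor M t)) := by
      intro t
      induction t with
      | zero => simp
      | add x y hx hy => simp only [map_add, hx, hy]
      | tmul d m =>
        simp only [LinearMap.rTensor_tmul, TensorProduct.comm_tmul, LinearMap.lTensor_tmul, hΔ]
        generalize Coalgebra.comul (R := k) d = s
        induction s with
        | zero => simp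
        | add x y hx hy =>
          simp only [map_add, TensorProduct.add_tmul, TensorProduct.tmul_add, hx, hy]
        | tmul a b => simp [X]
    refine (h1 _).trans (Eq.trans ?_ (h2 _).symm)
    exact congrArg X (LinearMap.congr_fun l.coassoc m).symm
  counit := by
    refine LinearMap.ext fun m => ?_
    have h1 : ∀ t : D ⊗[k] M, TensorProduct.rid k M
        (Coalgebra.counit.lTensor M (TensorProduct.comm k C M (f.rTensor M t))) =
        TensorProduct.lid k M (Coalgebra.counit.rTensor M t) := by
      intro t
      induction t with
      | zero => simp
      | add x y hx hy => simp only [map_add, hx, hy]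
      | tmul d m => simp [hε]
    exact (h1 _).trans (LinearMap.congr_fun l.counit m)

/-- A right comodule over `D` is a left comodule over `C` through an antihomomorphism of coalgebras
`f : D → C`. -/
noncomputable def RightCoaction.toLeft (ρ : RightCoaction k D M) : LeftCoaction k C M where
  coact := (TensorProduct.comm k M C).toLinearMap ∘ₗ f.lTensor M ∘ₗ ρ.coact
  coassoc := by
    refine LinearMap.ext fun m => ?_
    let X : (M ⊗[k] D) ⊗[k] D →ₗ[k] C ⊗[k] (C ⊗[k] M) :=
      (TensorProduct.comm k _ C).toLinearMap ∘ₗ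
        TensorProduct.map ((TensorProduct.comm k M C).toLinearMap ∘ₗ f.lTensor M) f
    have h1 : ∀ t : M ⊗[k] D, ((TensorProduct.comm k M C).toLinearMap ∘ₗ f.lTensor M ∘ₗ
        ρ.coact).lTensor C (TensorProduct.comm k M C (f.lTensor M t)) =
        X (ρ.coact.rTensor D t) := by
      intro t
      induction t with
      | zero => simp
      | add x y hx hy => simp only [map_add, hx, hy]
      | tmul d m => simp [X]
    have h2 : ∀ t : M ⊗[k] D, TensorProduct.assoc k C C M (Coalgebra.comul.rTensor M
        (TensorProduct.comm k M C (f.lTensor M t))) =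
        X ((TensorProduct.assoc k M D D).symm (Coalgebra.comul.lTensor M t)) := by
      intro t
      induction t with
      | zero => simp
      | add x y hx hy => simp only [map_add, hx, hy]
      | tmul m d =>
        simp only [LinearMap.rTensor_tmul, TensorProduct.comm_tmul, LinearMap.lTensor_tmul, hΔ]
        generalize Coalgebra.comul (R := k) d = s
        induction s with
        | zero => simp
        | add x y hx hy =>
          simp only [map_add, TensorProduct.add_tmul, TensorProduct.tmul_add, hx, hy]
        | tmul a b => simp [X]
    refine (h2 _).trans (Eq.trans ?_ (h1 _).symm)
    refine congrArg X ?_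
    rw [LinearEquiv.symm_apply_eq]
    exact (LinearMap.congr_fun ρ.coassoc m).symm
  counit := by
    refine LinearMap.ext fun m => ?_
    have h1 : ∀ t : M ⊗[k] D, TensorProduct.lid k M
        (Coalgebra.counit.rTensor M (TensorProduct.comm k M C (f.lTensor M t))) =
        TensorProduct.rid k M (Coalgebra.counit.lTensor M t) := by
      intro t
      induction t with
      | zero => simp
      | add x y hx hy => simp only [map_add, hx, hy]
      | tmul d m => simp [hε]
    exact (h1 _).trans (LinearMap.congr_fun ρ.counit m)

include hε hΔ

theorem LeftCoaction.colinear_toRight_iff (hf : Function.Injective f) {lM : LeftCoaction k D M}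
    {lN : LeftCoaction k D N} {g : M →ₗ[k] N} :
    (lM.toRight hε hΔ).Colinear (lN.toRight hε hΔ) g ↔ lM.Colinear lN g := by
  have h1 : ∀ t : D ⊗[k] M, g.rTensor C (TensorProduct.comm k C M (f.rTensor M t)) =
      TensorProduct.comm k C N (f.rTensor N (g.lTensor D t)) := by
    intro t
    induction t with
    | zero => simp
    | add x y hx hy => simp only [map_add, hx, hy]
    | tmul d m => simp
  refine ⟨fun h => LinearMap.ext fun m => ?_, fun h => LinearMap.ext fun m => ?_⟩
  · refine rTensor_injective hf ((TensorProduct.comm k C N).injective ?_)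
    exact (LinearMap.congr_fun h m).trans (h1 _)
  · refine Eq.trans ?_ (h1 _).symm
    exact congrArg (fun t => TensorProduct.comm k C N (f.rTensor N t)) (LinearMap.congr_fun h m)

theorem RightCoaction.colinear_toLeft_iff (hf : Function.Injective f) {ρM : RightCoaction k D M}
    {ρN : RightCoaction k D N} {g : M →ₗ[k] N} :
    (ρM.toLeft hε hΔ).Colinear (ρN.toLeft hε hΔ) g ↔ ρM.Colinear ρN g := by
  have h1 : ∀ t : M ⊗[k] D, g.lTensor C (TensorProduct.comm k M C (f.lTensor M t)) =
      TensorProduct.comm k N C (f.lTensor N (g.rTensor D t)) := by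
    intro t
    induction t with
    | zero => simp
    | add x y hx hy => simp only [map_add, hx, hy]
    | tmul d m => simp
  refine ⟨fun h => LinearMap.ext fun m => ?_, fun h => LinearMap.ext fun m => ?_⟩
  · refine Module.Flat.lTensor_preserves_injective_linearMap f hf
      ((TensorProduct.comm k N C).injective ?_)
    exact (LinearMap.congr_fun h m).trans (h1 _)
  · refine Eq.trans ?_ (h1 _).symm
    exact congrArg (fun t => TensorProduct.comm k N C (f.lTensor N t)) (LinearMap.congr_fun h m)

theorem LeftCoaction.isInjective_of_toRight (hf : Function.Injective f) {l : LeftCoaction k D M}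
    (h : (l.toRight hε hΔ).IsInjective) : l.IsInjective := by
  intro X Y _ _ _ _ lX lY i φ hi hinj hφ
  obtain ⟨g, hg, hgi⟩ := h X Y (lX.toRight hε hΔ) (lY.toRight hε hΔ) i φ
    ((colinear_toRight_iff hε hΔ hf).2 hi) hinj ((colinear_toRight_iff hε hΔ hf).2 hφ)
  exact ⟨g, (colinear_toRight_iff hε hΔ hf).1 hg, hgi⟩

theorem RightCoaction.isInjective_of_toLeft (hf : Function.Injective f) {ρ : RightCoaction k D M}
    (h : (ρ.toLeft hε hΔ).IsInjective) : ρ.IsInjective := by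
  intro X Y _ _ _ _ lX lY i φ hi hinj hφ
  obtain ⟨g, hg, hgi⟩ := h X Y (lX.toLeft hε hΔ) (lY.toLeft hε hΔ) i φ
    ((colinear_toLeft_iff hε hΔ hf).2 hi) hinj ((colinear_toLeft_iff hε hΔ hf).2 hφ)
  exact ⟨g, (colinear_toLeft_iff hε hΔ hf).1 hg, hgi⟩

end Corestriction

theorem ModuleFactorCoalgebra.isRightHopfModule_iff {k : Type v} {H : Type u} [Field k] [Ring H]
    [HopfAlgebra k H] {C : ModuleFactorCoalgebra k H} {M : Type*} [AddCommGroup M] [Module k M]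
    [Module H M] [IsScalarTower k H M] {ρ : RightCoaction k C.Quot M} :
    C.IsRightHopfModule ρ ↔ ∀ (h : H) (m : M),
      ρ.coact (h • m) = diagAction (Algebra.lsmul k k M) C.action h (ρ.coact m) := by
  have h : ∀ (g : H) (m : M), TensorProduct.map (leftAct k H M) (leftAct k H C.Quot)
      (TensorProduct.tensorTensorTensorComm k H H M C.Quot
        (TensorProduct.map Coalgebra.comul ρ.coact (g ⊗ₜ m))) =
      diagAction (Algebra.lsmul k k M) C.action g (ρ.coact m) := by
    intro g m
    rw [TensorProduct.map_tmul]
    generalize ρ.coact m = t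
    induction t with
    | zero => simp
    | add x y hx hy => simp only [map_add, TensorProduct.tmul_add, hx, hy]
    | tmul c d =>
      rw [diagAction_tmul]
      generalize Coalgebra.comul (R := k) g = s
      induction s with
      | zero => simp
      | add x y hx hy => simp only [map_add, TensorProduct.add_tmul, hx, hy]
      | tmul a b => simp [leftAct_tmul, action]
  constructor
  · intro H g m
    rw [← h]
    exact LinearMap.congr_fun H (g ⊗ₜ m)
  · intro H
    refine TensorProduct.ext' fun g m => ?_
    simp only [LinearMap.comp_apply, LinearEquiv.coe_coe, h, leftAct_tmul]
    exact H g m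

namespace CoopTwist

variable {k : Type v} {H K : Type u} [Field k] [Ring H] [HopfAlgebra k H] [Ring K]
  [HopfAlgebra k K] (T : CoopTwist k H K)

/-- The antiisomorphism of coalgebras induced by `e⁻¹`. -/
theorem exists_mapFactor_quot (C : ModuleFactorCoalgebra k H) :
    ∃ f : (T.mapFactor C).Quot →ₗ[k] C.Quot, Function.Injective f ∧
      (∀ d, Coalgebra.counit (R := k) (f d) = Coalgebra.counit (R := k) d) ∧
      (∀ d, Coalgebra.comul (R := k) (f d) =
        TensorProduct.comm k _ _ (TensorProduct.map f f (Coalgebra.comul (R := k) d))) ∧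
      ∀ (h : H) (d : (T.mapFactor C).Quot),
        f ((T.mapFactor C).action (T.e h) d) = C.action h (f d) := by
  obtain ⟨f, hf⟩ := exists_comp_eq_of_ker_le (q := (T.mapFactor C).proj)
    (T.mapFactor C).proj_surjective (g := C.proj ∘ₗ T.e.symm.toLinearMap) (fun y hy => by
      rw [ModuleFactorCoalgebra.proj_eq_zero_iff, mem_mapFactor] at hy
      exact (C.proj_eq_zero_iff _).2 hy)
  have hf' : ∀ y, f ((T.mapFactor C).proj y) = C.proj (T.e.symm y) := hf
  refine ⟨f, (injective_iff_map_eq_zero f).2 fun d hd => ?_, fun d => ?_, fun d => ?_,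
    fun h d => ?_⟩
  all_goals obtain ⟨y, rfl⟩ := (T.mapFactor C).proj_surjective d
  · rw [hf', ModuleFactorCoalgebra.proj_eq_zero_iff] at hd
    exact ((T.mapFactor C).proj_eq_zero_iff y).2 hd
  · rw [hf', C.counit_proj, ModuleFactorCoalgebra.counit_proj]
    exact T.symm.counit_e y
  · rw [hf', C.comul_proj, ModuleFactorCoalgebra.comul_proj,
      show Coalgebra.comul (R := k) (T.e.symm y) = _ from T.symm.comul_e y]
    generalize Coalgebra.comul (R := k) y = s
    induction s with
    | zero => simp
    | add x y hx hy => simp only [map_add, hx, hy]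
    | tmul a b => simp [hf']
  · rw [ModuleFactorCoalgebra.action_proj, hf', hf', ModuleFactorCoalgebra.action_proj, map_mul,
      AlgEquiv.symm_apply_apply]

/-- An object `M` of `_K^{C'} M`, where `C'` is the image of `C`, is an object of `_H M^C`. -/
theorem leftHopfModulesInjective_mapFactor {C : ModuleFactorCoalgebra k H}
    (hC : C.RightHopfModulesInjective) : (T.mapFactor C).LeftHopfModulesInjective := by
  intro M _ _ _ _ l hl
  rw [ModuleFactorCoalgebra.isLeftHopfModule_iff] at hl
  obtain ⟨f, hf, hε, hΔ, hact⟩ := T.exists_mapFactor_quot C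
  let _ : Module H M := Module.compHom M T.e.toAlgHom.toRingHom
  have : IsScalarTower k H M := ⟨fun r h m => by
    change T.e (r • h) • m = r • T.e h • m
    rw [map_smul, smul_assoc]⟩
  refine l.isInjective_of_toRight hε hΔ hf (hC M _ ?_)
  rw [ModuleFactorCoalgebra.isRightHopfModule_iff]
  intro h m
  have h1 : ∀ t, TensorProduct.comm k C.Quot M (f.rTensor M
      (diagAction (T.mapFactor C).action (Algebra.lsmul k k M (A := K)) (T.e h) t)) =
      diagAction (Algebra.lsmul k k M (A := H)) C.action h
        (TensorProduct.comm k C.Quot M (f.rTensor M t)) := by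
    intro t
    induction t with
    | zero => simp
    | add x y hx hy => simp only [map_add, hx, hy]
    | tmul d n =>
      rw [LinearMap.rTensor_tmul, TensorProduct.comm_tmul, diagAction_tmul, diagAction_tmul,
        T.comul_e]
      generalize Coalgebra.comul (R := k) h = s
      induction s with
      | zero => simp
      | add x y hx hy => simp only [map_add, hx, hy]
      | tmul a b =>
        simp only [TensorProduct.map_tmul, TensorProduct.comm_tmul, LinearMap.rTensor_tmul,
          AlgEquiv.toLinearMap_apply, orbitMap_apply, hact]
        rfl
  refine Eq.trans ?_ (h1 _)
  exact congrArg (fun t => TensorProduct.comm k C.Quot M (f.rTensor M t)) (hl (T.e h) m)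

/-- An object `M` of `_K M^{C'}`, where `C'` is the image of `C`, is an object of `_H^C M`. -/
theorem rightHopfModulesInjective_mapFactor {C : ModuleFactorCoalgebra k H}
    (hC : C.LeftHopfModulesInjective) : (T.mapFactor C).RightHopfModulesInjective := by
  intro M _ _ _ _ ρ hρ
  rw [ModuleFactorCoalgebra.isRightHopfModule_iff] at hρ
  obtain ⟨f, hf, hε, hΔ, hact⟩ := T.exists_mapFactor_quot C
  let _ : Module H M := Module.compHom M T.e.toAlgHom.toRingHom
  have : IsScalarTower k H M := ⟨fun r h m => by
    change T.e (r • h) • m = r • T.e h • m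
    rw [map_smul, smul_assoc]⟩
  refine ρ.isInjective_of_toLeft hε hΔ hf (hC M _ ?_)
  rw [ModuleFactorCoalgebra.isLeftHopfModule_iff]
  intro h m
  have h1 : ∀ t, TensorProduct.comm k M C.Quot (f.lTensor M
      (diagAction (Algebra.lsmul k k M (A := K)) (T.mapFactor C).action (T.e h) t)) =
      diagAction C.action (Algebra.lsmul k k M (A := H)) h
        (TensorProduct.comm k M C.Quot (f.lTensor M t)) := by
    intro t
    induction t with
    | zero => simp
    | add x y hx hy => simp only [map_add, hx, hy]
    | tmul n d =>
      rw [LinearMap.lTensor_tmul, TensorProduct.comm_tmul, diagAction_tmul, diagAction_tmul,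
        T.comul_e]
      generalize Coalgebra.comul (R := k) h = s
      induction s with
      | zero => simp
      | add x y hx hy => simp only [map_add, hx, hy]
      | tmul a b =>
        simp only [TensorProduct.map_tmul, TensorProduct.comm_tmul, LinearMap.lTensor_tmul,
          AlgEquiv.toLinearMap_apply, orbitMap_apply, hact]
        rfl
  refine Eq.trans ?_ (h1 _)
  exact congrArg (fun t => TensorProduct.comm k M C.Quot (f.lTensor M t)) (hρ (T.e h) m)

end CoopTwist

/-- A right comodule over `D` is a right comodule over `C` through a homomorphism of coalgebras
`f : D → C`. -/
noncomputable def RightCoaction.corestrict {k C D M : Type*} [CommRing k] [AddCommGroup C]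
    [Module k C] [Coalgebra k C] [AddCommGroup D] [Module k D] [Coalgebra k D] [AddCommGroup M]
    [Module k M] {f : D →ₗ[k] C}
    (hε : ∀ d, Coalgebra.counit (R := k) (f d) = Coalgebra.counit (R := k) d)
    (hΔ : ∀ d, Coalgebra.comul (R := k) (f d) =
      TensorProduct.map f f (Coalgebra.comul (R := k) d))
    (ρ : RightCoaction k D M) : RightCoaction k C M where
  coact := f.lTensor M ∘ₗ ρ.coact
  coassoc := by
    refine LinearMap.ext fun m => ?_
    let X : (M ⊗[k] D) ⊗[k] D →ₗ[k] M ⊗[k] (C ⊗[k] C) :=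
      (TensorProduct.assoc k M C C).toLinearMap ∘ₗ TensorProduct.map (f.lTensor M) f
    have h1 : ∀ t : M ⊗[k] D, TensorProduct.assoc k M C C
        ((f.lTensor M ∘ₗ ρ.coact).rTensor C (f.lTensor M t)) = X (ρ.coact.rTensor D t) := by
      intro t
      induction t with
      | zero => simp
      | add x y hx hy => simp only [map_add, hx, hy]
      | tmul d m => simp [X]
    have h2 : ∀ t : M ⊗[k] D, Coalgebra.comul.lTensor M (f.lTensor M t) =
        X ((TensorProduct.assoc k M D D).symm (Coalgebra.comul.lTensor M t)) := by
      intro t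
      induction t with
      | zero => simp
      | add x y hx hy => simp only [map_add, hx, hy]
      | tmul m d =>
        simp only [LinearMap.lTensor_tmul, hΔ]
        generalize Coalgebra.comul (R := k) d = s
        induction s with
        | zero => simp
        | add x y hx hy => simp only [map_add, TensorProduct.tmul_add, hx, hy]
        | tmul a b => simp [X]
    refine (h1 _).trans (Eq.trans ?_ (h2 _).symm)
    refine congrArg X ?_
    rw [LinearEquiv.eq_symm_apply]
    exact LinearMap.congr_fun ρ.coassoc m
  counit := by
    refine LinearMap.ext fun m => ?_
    have h1 : ∀ t : M ⊗[k] D, TensorProduct.rid k M (Coalgebra.counit.lTensor M (f.lTensor M t)) =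
        TensorProduct.rid k M (Coalgebra.counit.lTensor M t) := by
      intro t
      induction t with
      | zero => simp
      | add x y hx hy => simp only [map_add, hx, hy]
      | tmul d m => simp [hε]
    exact (h1 _).trans (LinearMap.congr_fun ρ.counit m)

/-- Restriction of scalars along an isomorphism of rings reflects projectivity. -/
theorem projective_of_ringEquiv {R S M : Type*} [Ring R] [Ring S] [AddCommGroup M] [Module R M]
    [Module S M] (r : R ≃+* S) (h : ∀ (a : R) (m : M), r a • m = a • m)
    [Module.Projective R M] : Module.Projective S M := by
  have := RingHomInvPair.of_ringEquiv r
  have := RingHomInvPair.symm (r : R →+* S) (r.symm : S →+* R)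
  exact Module.Projective.of_equiv
    ({ AddEquiv.refl M with map_smul' := fun a m => (h a m).symm } : M ≃ₛₗ[(r : R →+* S)] M)

namespace CoopTwist

variable {k : Type v} {H K : Type u} [Field k] [Ring H] [HopfAlgebra k H] [Ring K]
  [HopfAlgebra k K] (T : CoopTwist k H K) (A : RightCoidealSubalgebra k H)

/-- The restriction of `j` to a coideal subalgebra and its image. -/
noncomputable def subalgebraEquiv : A.alg ≃ₗ[k] (T.mapSubalgebra A).alg where
  toFun a := ⟨T.j a, T.j_mem_mapSubalgebra.2 a.2⟩
  invFun b := ⟨T.j.symm b, T.mem_mapSubalgebra.1 b.2⟩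
  map_add' _ _ := Subtype.ext (map_add T.j _ _)
  map_smul' r _ := Subtype.ext (map_smul T.j r _)
  left_inv _ := Subtype.ext (T.j.symm_apply_apply _)
  right_inv _ := Subtype.ext (T.j.apply_symm_apply _)

theorem subalgebraEquiv_mul (a b : A.alg) :
    T.subalgebraEquiv A (a * b) = T.subalgebraEquiv A b * T.subalgebraEquiv A a :=
  Subtype.ext (T.j_mul a b)

theorem coaction_subalgebraEquiv (a : A.alg) :
    (T.mapSubalgebra A).coaction (T.subalgebraEquiv A a) =
      TensorProduct.map (T.subalgebraEquiv A).toLinearMap T.j.toLinearMap (A.coaction a) := by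
  apply (T.mapSubalgebra A).incl_injective
  rw [RightCoidealSubalgebra.incl_coaction]
  refine (T.comul_j a).trans ?_
  rw [← A.incl_coaction]
  generalize A.coaction a = s
  induction s with
  | zero => simp
  | add x y hx hy => simp only [map_add, hx, hy]
  | tmul a b => rfl

/-- The isomorphism of rings induced by `j`. -/
noncomputable def ringEquivOp : A.alg ≃+* (T.mapSubalgebra A).algᵐᵒᵖ where
  toEquiv := (T.subalgebraEquiv A).toEquiv.trans MulOpposite.opEquiv
  map_mul' a b := congrArg MulOpposite.op (T.subalgebraEquiv_mul A a b)
  map_add' a b := congrArg MulOpposite.op (map_add (T.subalgebraEquiv A) a b)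

/-- The isomorphism of rings induced by `j` on the opposite of a coideal subalgebra. -/
noncomputable def opRingEquiv : A.algᵐᵒᵖ ≃+* (T.mapSubalgebra A).alg where
  toEquiv := MulOpposite.opEquiv.symm.trans (T.subalgebraEquiv A).toEquiv
  map_mul' a b := T.subalgebraEquiv_mul A b.unop a.unop
  map_add' a b := map_add (T.subalgebraEquiv A) a.unop b.unop

variable {A}

/-- A right Hopf module over the image of `A` is a left Hopf module over `A`. -/
theorem rightHopfModulesProjective_mapSubalgebra (hA : A.LeftHopfModulesProjective) :
    (T.mapSubalgebra A).RightHopfModulesProjective := by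
  intro M _ _ _ _ ρ hρ
  rw [RightCoidealSubalgebra.isRightHopfModule_iff] at hρ
  let _ : Module A.alg M := Module.compHom M (T.ringEquivOp A).toRingHom
  have hsmul : ∀ (a : A.alg) (m : M), a • m = MulOpposite.op (T.subalgebraEquiv A a) • m :=
    fun _ _ => rfl
  have : IsScalarTower k A.alg M := ⟨fun r a m => by
    rw [hsmul, hsmul, map_smul, MulOpposite.op_smul, smul_assoc]⟩
  have : Module.Projective A.alg M :=
    hA M (ρ.corestrict (f := T.j.symm.toLinearMap) T.symm.counit_j T.symm.comul_j) (by
      refine TensorProduct.ext' fun a m => ?_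
      have h1 : ∀ (s : A.alg ⊗[k] H) (t : M ⊗[k] K), T.j.symm.toLinearMap.lTensor M
          ((T.mapSubalgebra A).tensorRightAct M
            (TensorProduct.map (T.subalgebraEquiv A).toLinearMap T.j.toLinearMap s) t) =
          TensorProduct.map (leftAct k A.alg M) (LinearMap.mul' k H)
            (TensorProduct.tensorTensorTensorComm k A.alg H M H
              (s ⊗ₜ T.j.symm.toLinearMap.lTensor M t)) := by
        intro s t
        induction s with
        | zero => simp
        | add x y hx hy =>
          simp only [map_add, LinearMap.add_apply, TensorProduct.add_tmul, hx, hy]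
        | tmul a b =>
          induction t with
          | zero => simp
          | add x y hx hy => simp only [map_add, TensorProduct.tmul_add, hx, hy]
          | tmul m y =>
            have h2 : T.j.symm (y * T.j b) = b * T.j.symm y :=
              (T.symm.j_mul y (T.j b)).trans (congrArg (· * _) (T.j.symm_apply_apply b))
            simp [h2, leftAct_tmul, hsmul]
      refine Eq.trans ?_ (h1 _ _)
      refine congrArg (T.j.symm.toLinearMap.lTensor M) ((hρ (T.subalgebraEquiv A a) m).trans ?_)
      rw [coaction_subalgebraEquiv])
  exact projective_of_ringEquiv (T.ringEquivOp A) fun _ _ => rfl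

/-- A left Hopf module over the image of `A` is a right Hopf module over `A`. -/
theorem leftHopfModulesProjective_mapSubalgebra (hA : A.RightHopfModulesProjective) :
    (T.mapSubalgebra A).LeftHopfModulesProjective := by
  intro M _ _ _ _ ρ hρ
  let _ : Module A.algᵐᵒᵖ M := Module.compHom M (T.opRingEquiv A).toRingHom
  have hsmul : ∀ (a : A.alg) (m : M), MulOpposite.op a • m = T.subalgebraEquiv A a • m :=
    fun _ _ => rfl
  have : IsScalarTower k A.algᵐᵒᵖ M := ⟨fun r a m => by
    obtain ⟨a, rfl⟩ := MulOpposite.op_surjective a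
    rw [← MulOpposite.op_smul, hsmul, hsmul, map_smul, smul_assoc]⟩
  have : Module.Projective A.algᵐᵒᵖ M :=
    hA M (ρ.corestrict (f := T.j.symm.toLinearMap) T.symm.counit_j T.symm.comul_j) (by
      rw [RightCoidealSubalgebra.isRightHopfModule_iff]
      intro a m
      have h1 : ∀ (s : A.alg ⊗[k] H) (t : M ⊗[k] K), T.j.symm.toLinearMap.lTensor M
          (TensorProduct.map (leftAct k (T.mapSubalgebra A).alg M) (LinearMap.mul' k K)
            (TensorProduct.tensorTensorTensorComm k _ K M K
              (TensorProduct.map (T.subalgebraEquiv A).toLinearMap T.j.toLinearMap s ⊗ₜ t))) =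
          A.tensorRightAct M s (T.j.symm.toLinearMap.lTensor M t) := by
        intro s t
        induction s with
        | zero => simp
        | add x y hx hy =>
          simp only [map_add, LinearMap.add_apply, TensorProduct.add_tmul, hx, hy]
        | tmul a b =>
          induction t with
          | zero => simp
          | add x y hx hy => simp only [map_add, TensorProduct.tmul_add, hx, hy]
          | tmul m y =>
            have h2 : T.j.symm (T.j b * y) = T.j.symm y * b :=
              (T.symm.j_mul (T.j b) y).trans (congrArg (_ * ·) (T.j.symm_apply_apply b))
            simp [h2, leftAct_tmul, hsmul]
      refine Eq.trans ?_ (h1 _ _)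
      refine congrArg (T.j.symm.toLinearMap.lTensor M)
        ((LinearMap.congr_fun hρ (T.subalgebraEquiv A a ⊗ₜ m)).trans ?_)
      simp only [LinearMap.comp_apply, TensorProduct.map_tmul, coaction_subalgebraEquiv,
        LinearEquiv.coe_coe])
  exact projective_of_ringEquiv (T.opRingEquiv A) fun _ _ => rfl

end CoopTwist

/-! ### Takeuchi's correspondence -/

/-- Two maps which preserve given sets and are inverse to each other on them restrict to
bijections. -/
theorem bijOn_bijOn_invOn {α β : Type*} {f : α → β} {g : β → α} {s : Set α} {t : Set β}
    (hf : Set.MapsTo f s t) (hg : Set.MapsTo g t s) (hgf : Set.LeftInvOn g f s)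
    (hfg : Set.LeftInvOn f g t) : Set.BijOn f s t ∧ Set.BijOn g t s ∧ Set.InvOn g f s t :=
  have h : Set.InvOn g f s t := ⟨hgf, hfg⟩
  ⟨h.bijOn hf hg, h.symm.bijOn hg hf, h⟩

theorem theorem8p4 {k : Type v} {H : Type u} [Field k] [Ring H] [HopfAlgebra k H]
    (hS : Function.Bijective (HopfAlgebra.antipode k (A := H))) :
    (Set.BijOn RightCoidealSubalgebra.toFactorCoalgebra
        {A : RightCoidealSubalgebra k H | A.RightHopfModulesProjective}
        {C : ModuleFactorCoalgebra k H | C.LeftHopfModulesInjective} ∧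
      Set.BijOn ModuleFactorCoalgebra.toCoidealSubalgebra
        {C : ModuleFactorCoalgebra k H | C.LeftHopfModulesInjective}
        {A : RightCoidealSubalgebra k H | A.RightHopfModulesProjective} ∧
      Set.InvOn ModuleFactorCoalgebra.toCoidealSubalgebra RightCoidealSubalgebra.toFactorCoalgebra
        {A : RightCoidealSubalgebra k H | A.RightHopfModulesProjective}
        {C : ModuleFactorCoalgebra k H | C.LeftHopfModulesInjective}) ∧
    (Set.BijOn RightCoidealSubalgebra.toFactorCoalgebra
        {A : RightCoidealSubalgebra k H | A.LeftHopfModulesProjective}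
        {C : ModuleFactorCoalgebra k H | C.RightHopfModulesInjective} ∧
      Set.BijOn ModuleFactorCoalgebra.toCoidealSubalgebra
        {C : ModuleFactorCoalgebra k H | C.RightHopfModulesInjective}
        {A : RightCoidealSubalgebra k H | A.LeftHopfModulesProjective} ∧
      Set.InvOn ModuleFactorCoalgebra.toCoidealSubalgebra RightCoidealSubalgebra.toFactorCoalgebra
        {A : RightCoidealSubalgebra k H | A.LeftHopfModulesProjective}
        {C : ModuleFactorCoalgebra k H | C.RightHopfModulesInjective}) := by
  refine ⟨bijOn_bijOn_invOn (fun A hA => hA.leftHopfModulesInjective)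
    (fun C hC => hC.rightHopfModulesProjective)
    (fun A hA => hA.toCoidealSubalgebra_toFactorCoalgebra)
    (fun C hC => hC.toFactorCoalgebra_toCoidealSubalgebra), ?_⟩
  obtain ⟨K, _, _, ⟨T⟩⟩ := exists_coopTwist hS
  refine bijOn_bijOn_invOn (fun A hA => ?_) (fun C hC => ?_) (fun A hA => ?_) (fun C hC => ?_)
  · have h := (T.rightHopfModulesProjective_mapSubalgebra hA).leftHopfModulesInjective
    rw [T.toFactorCoalgebra_mapSubalgebra] at h
    have h' := T.symm.rightHopfModulesInjective_mapFactor h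
    rwa [T.symm_mapFactor_mapFactor] at h'
  · have h := (T.leftHopfModulesInjective_mapFactor hC).rightHopfModulesProjective
    rw [T.toCoidealSubalgebra_mapFactor] at h
    have h' := T.symm.leftHopfModulesProjective_mapSubalgebra h
    rwa [T.symm_mapSubalgebra_mapSubalgebra] at h'
  · have h := (T.rightHopfModulesProjective_mapSubalgebra
      hA).toCoidealSubalgebra_toFactorCoalgebra
    rw [T.toFactorCoalgebra_mapSubalgebra, T.toCoidealSubalgebra_mapFactor] at h
    exact T.mapSubalgebra_injective h
  · have h := (T.leftHopfModulesInjective_mapFactor hC).toFactorCoalgebra_toCoidealSubalgebra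
    rw [T.toCoidealSubalgebra_mapFactor, T.toFactorCoalgebra_mapSubalgebra] at h
    exact T.mapFactor_injective h
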